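/- Let $T>0$, $n\ge 1$. For $H:[0,T]\times\mathbb R^n\times\mathbb R^n\to\mathbb R$ let $$L(t,x,v)=\sup_{p\in\mathbb R^n}\{\langle v,p\rangle-H(t,x,p)\}\in\mathbb R\cup\{\pm\infty\},\qquad E_L(t,x)=\{(v,\eta)\in\mathbb R^n\times\mathbb R : L(t,x,v)\le\eta\},$$ and $\mathrm{dom}\,L(t,x,\cdot)=\{v: L(t,x,v)\neq\pm\infty\}$. Let $B_R$ denote the closed ball of radius $R$ about $0$ in $\mathbb R^n$, and let $B$ be the closed unit ball of $\mathbb R^{n+1}=\mathbb R^n\times\mathbb R$. Let $c:[0,T]\to[0,\infty)$ and, for every $R>0$, $k_R:[0,T]\to[0,\infty)$ be Lebesgue integrable. With these functions consider the following conditions on a pair $(H,\lambda)$, where $\lambda:[0,T]\times\mathbb R^n\to\mathbb R$: - (H1) $t\mapsto H(t,x,p)$ is Lebesgue measurable for all $x,p$; (H2) $(x,p)\mapsto H(t,x,p)$ is continuous for all $t$; (H3) $p\mapsto H(t,x,p)$ is convex for all $t,x$; (H4) $|H(t,x,p)-H(t,x,q)|\le c(t)(1+|x|)|p-q|$ for all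 $t,x,p,q$. - (HLC) For every $R>0$: $|H(t,x,p)-H(t,y,p)|\le k_R(t)(1+|p|)|x-y|$ for all $t\in[0,T]$, $x,y\in B_R$, $p\in\mathbb R^n$. - (BLC) $\lambda(\cdot,x)$ is Lebesgue measurable for all $x$, $\lambda(t,\cdot)$ is continuous for all $t$, $L(t,x,v)\le\lambda(t,x)$ for all $t,x$ and all $v\in\mathrm{dom}\,L(t,x,\cdot)$, and for every $R>0$ and $t$ the function $\lambda(t,\cdot)$ is $k_R(t)$-Lipschitz on $B_R$. Under these conditions a representation $(B,f,l)$ of $H$ (built from $c,\lambda,H$) is defined as follows. Put $\omega(t,x)=|\lambda(t,x)|+|H(t,x,0)|+c(t)(1+|x|)+1$ and, for $a\in B$, $$(f(t,x,a),\,l(t,x,a)):=s_{n+1}\big(E_L(t,x)\cap\{z\in\mathbb R^{n+1}:|z-\omega(t,x)a|\le 2\,d(\omega(t,x)a,E_L(t,x))\}\big)\in\mathbb R^n\times\mathbb R,$$ where $d(y,K)$ is the Euclidean distance from $y$ to $K$ and, for a nonempty convex compact set $K\subset\mathbb R^m$, $s_m(K)=m\int_{S^{m-1}}p\,\max_{y\in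 K}\langle p,y\rangle\,\sigma(dp)$ is its Steiner point, $\sigma$ being the normalized surface measure on the unit sphere $S^{m-1}$. For $g:\mathbb R^n\to\mathbb R\cup\{+\infty\}$, the value function associated with $(B,f,l,g)$ is $$V(t_0,x_0)=\inf\Big\{g(x(T))+\int_{t_0}^T l(t,x(t),a(t))\,dt\Big\},\qquad (t_0,x_0)\in[0,T]\times\mathbb R^n,$$ the infimum being over all pairs $(x,a)$ with $a$ measurable on $[t_0,T]$, $a(t)\in B$ for a.e. $t$, $x:[t_0,T]\to\mathbb R^n$ absolutely continuous, $x(t_0)=x_0$ and $\dot x(t)=f(t,x(t),a(t))$ for a.e. $t$. Extended-real-valued functions $\varphi_i$ ($i\in\mathbb N$) on a set $D$ (here $D=\mathbb R^n$ or $D=[0,T]\times\mathbb R^n$) epi-converge to $\varphi$ if for every $z\in D$: $\liminf_i\varphi_i(z_i)\ge\varphi(z)$ for every sequence $z_i\to z$ in $D$, and $\limsup_i\varphi_i(z_i)\le\varphi(z)$ for some sequence $z_i\to z$ in $D$. **Statement.** Let $(H,\lambda)$ and $(H_i,\lambda_i)$, $i\in\mathbb N$, satisfy (H1)–(H4), (HLC)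 and (BLC), all with the same integrable functions $c$ and $k_R$. Let $g_i,g:\mathbb R^n\to\mathbb R\cup\{+\infty\}$ be proper (not identically $+\infty$) and lower semicontinuous, and let $g_i$ epi-converge to $g$. Assume that there is an integrable $\mu:[0,T]\to\mathbb R$ with $|H_i(t,0,0)|\le\mu(t)$ and $|\lambda_i(t,0)|\le\mu(t)$ for all $t\in[0,T]$, $i\in\mathbb N$. Let $(B,f_i,l_i)$ and $(B,f,l)$ be the representations of $H_i$ and $H$ defined above (from $c,\lambda_i,H_i$ and from $c,\lambda,H$), and let $V_i$ and $V$ be the value functions associated with $(B,f_i,l_i,g_i)$ and $(B,f,l,g)$. If for every $t\in[0,T]$, $H_i(t,\cdot,\cdot)\to H(t,\cdot,\cdot)$ and $\lambda_i(t,\cdot)\to\lambda(t,\cdot)$ uniformly on compact sets, then $V_i$ epi-converge to $V$ on $[0,T]\times\mathbb R^n$. -/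

import Mathlib

open Set Filter Topology MeasureTheory

noncomputable section

/-- The Euclidean space `ℝⁿ`. -/
abbrev StateSpace (n : ℕ) : Type := EuclideanSpace ℝ (Fin n)

/-- The product `ℝⁿ × ℝ` with the Euclidean norm, that is, `ℝⁿ⁺¹`. It contains the epigraphs of
functions on `ℝⁿ`, and the controls. -/
abbrev EpiSpace (n : ℕ) : Type := WithLp 2 (StateSpace n × ℝ)

/-! ### Lagrangian -/

/-- The Lagrangian: the Legendre-Fenchel transform of `H(t,x,·)`, with values in `[-∞,+∞]`. -/
def lagrangian {n : ℕ} (H : ℝ → StateSpace n → StateSpace n → ℝ)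
    (t : ℝ) (x v : StateSpace n) : EReal :=
  ⨆ p : StateSpace n, ((inner ℝ v p - H t x p : ℝ) : EReal)

/-- The effective domain of an extended-real-valued function: the points where it is finite. -/
def effectiveDomain {X : Type*} (φ : X → EReal) : Set X :=
  {x | φ x ≠ ⊥ ∧ φ x ≠ ⊤}

/-- The epigraph of `L(t,x,·)`, as a subset of `ℝⁿ × ℝ`. -/
def lagrangianEpigraph {n : ℕ} (H : ℝ → StateSpace n → StateSpace n → ℝ)
    (t : ℝ) (x : StateSpace n) : Set (EpiSpace n) :=
  {z | lagrangian H t x z.fst ≤ ((z.snd : ℝ) : EReal)}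

/-! ### Conditions on the Hamiltonian

Functions of time are only looked at on `[0,T]`; measurability on `[0,T]` is Lebesgue
measurability, i.e. almost everywhere measurability for the restricted Lebesgue measure. -/

/-- Conditions (H1)-(H4), with the function `c` in (H4). -/
structure HamiltonianConditions {n : ℕ} (T : ℝ) (c : ℝ → ℝ)
    (H : ℝ → StateSpace n → StateSpace n → ℝ) : Prop where
  measurable_time : ∀ x p : StateSpace n,
    AEMeasurable (fun t => H t x p) (volume.restrict (Icc 0 T))
  continuous_space : ∀ t ∈ Icc 0 T,
    Continuous (fun z : StateSpace n × StateSpace n => H t z.1 z.2)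
  convex_gradient : ∀ t ∈ Icc 0 T, ∀ x : StateSpace n, ConvexOn ℝ univ (H t x)
  lipschitz_gradient : ∀ t ∈ Icc 0 T, ∀ x p q : StateSpace n,
    |H t x p - H t x q| ≤ c t * (1 + ‖x‖) * ‖p - q‖

/-- Condition (HLC), with the functions `k R`, `R > 0`. -/
def HamiltonianLipschitz {n : ℕ} (T : ℝ) (k : ℝ → ℝ → ℝ)
    (H : ℝ → StateSpace n → StateSpace n → ℝ) : Prop :=
  ∀ R > 0, ∀ t ∈ Icc 0 T, ∀ x ∈ Metric.closedBall (0 : StateSpace n) R,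
    ∀ y ∈ Metric.closedBall (0 : StateSpace n) R, ∀ p : StateSpace n,
      |H t x p - H t y p| ≤ k R t * (1 + ‖p‖) * ‖x - y‖

/-- Condition (BLC) for the Lagrangian of `H`, with the upper bound `lam` and the functions `k R`,
`R > 0`. -/
structure LagrangianBounded {n : ℕ} (T : ℝ) (k : ℝ → ℝ → ℝ) (lam : ℝ → StateSpace n → ℝ)
    (H : ℝ → StateSpace n → StateSpace n → ℝ) : Prop where
  measurable_time : ∀ x : StateSpace n,
    AEMeasurable (fun t => lam t x) (volume.restrict (Icc 0 T))
  continuous_state : ∀ t ∈ Icc 0 T, Continuous (lam t)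
  lagrangian_le : ∀ t ∈ Icc 0 T, ∀ x : StateSpace n,
    ∀ v ∈ effectiveDomain (lagrangian H t x), lagrangian H t x v ≤ ((lam t x : ℝ) : EReal)
  lipschitz_state : ∀ R > 0, ∀ t ∈ Icc 0 T, ∀ x ∈ Metric.closedBall (0 : StateSpace n) R,
    ∀ y ∈ Metric.closedBall (0 : StateSpace n) R, |lam t x - lam t y| ≤ k R t * ‖x - y‖

/-! ### The representation -/

/-- The support function `σ(K,p) = sup {⟪p, y⟫ : y ∈ K}` (a maximum for nonempty compact `K`). -/
def supportFn {X : Type*} [NormedAddCommGroup X] [InnerProductSpace ℝ X]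
    (K : Set X) (p : X) : ℝ :=
  sSup ((fun y => inner ℝ p y) '' K)

/-- The Steiner point `m ∫ p σ(K,p) μ(dp)` of a nonempty convex compact subset `K` of an
`m`-dimensional Euclidean space. Here `μ` is the surface measure of the unit sphere, normalized to
a probability measure, so the integral is an average. -/
def steinerPoint {X : Type*} [NormedAddCommGroup X] [InnerProductSpace ℝ X]
    [FiniteDimensional ℝ X] [MeasurableSpace X] [BorelSpace X] (K : Set X) : X :=
  (Module.finrank ℝ X : ℝ) •
    ⨍ p : Metric.sphere (0 : X) 1, supportFn K (p : X) • (p : X) ∂(volume : Measure X).toSphere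

/-- `P(y,K)`: the part of `K` in the closed ball about `y` of radius `2 d(y,K)`. -/
def nearPart {X : Type*} [PseudoMetricSpace X] (y : X) (K : Set X) : Set X :=
  K ∩ Metric.closedBall y (2 * Metric.infDist y K)

/-- `ω(t,x) = |λ(t,x)| + |H(t,x,0)| + c(t)(1+|x|) + 1`. -/
def repRadius {n : ℕ} (c : ℝ → ℝ) (lam : ℝ → StateSpace n → ℝ)
    (H : ℝ → StateSpace n → StateSpace n → ℝ) (t : ℝ) (x : StateSpace n) : ℝ :=
  |lam t x| + |H t x 0| + c t * (1 + ‖x‖) + 1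

/-- The parametrization `e(t,x,a)` of the epigraph of `L(t,x,·)`: the Steiner point of
`P(ω(t,x) a, epi L(t,x,·))`. -/
def epiParam {n : ℕ} (c : ℝ → ℝ) (lam : ℝ → StateSpace n → ℝ)
    (H : ℝ → StateSpace n → StateSpace n → ℝ) (t : ℝ) (x : StateSpace n) (a : EpiSpace n) :
    EpiSpace n :=
  steinerPoint (nearPart (repRadius c lam H t x • a) (lagrangianEpigraph H t x))

/-- The dynamics `f` of the representation: the `ℝⁿ`-component of `e`. -/
def repDynamics {n : ℕ} (c : ℝ → ℝ) (lam : ℝ → StateSpace n → ℝ)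
    (H : ℝ → StateSpace n → StateSpace n → ℝ) (t : ℝ) (x : StateSpace n) (a : EpiSpace n) :
    StateSpace n :=
  (epiParam c lam H t x a).fst

/-- The running cost `l` of the representation: the `ℝ`-component of `e`. -/
def repCost {n : ℕ} (c : ℝ → ℝ) (lam : ℝ → StateSpace n → ℝ)
    (H : ℝ → StateSpace n → StateSpace n → ℝ) (t : ℝ) (x : StateSpace n) (a : EpiSpace n) : ℝ :=
  (epiParam c lam H t x a).snd

/-! ### The value function -/

/-- `(x,a)` is a trajectory-control pair on `[t₀,T]` starting at `x₀`: the control `a` is measurable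
with values in `A` a.e., the arc `x` is absolutely continuous, `x(t₀) = x₀`, and
`x'(t) = f(t,x(t),a(t))` a.e. -/
structure IsTrajectoryControl {X Y : Type*} [NormedAddCommGroup X] [NormedSpace ℝ X]
    [TopologicalSpace Y] (A : Set Y) (f : ℝ → X → Y → X) (T t₀ : ℝ) (x₀ : X)
    (x : ℝ → X) (a : ℝ → Y) : Prop where
  control_measurable : AEStronglyMeasurable a (volume.restrict (Icc t₀ T))
  control_mem : ∀ᵐ t ∂(volume.restrict (Icc t₀ T)), a t ∈ A
  absolutelyContinuous : AbsolutelyContinuousOnInterval x t₀ T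
  initial : x t₀ = x₀
  dynamics : ∀ᵐ t ∂(volume.restrict (Icc t₀ T)), HasDerivAt x (f t (x t) (a t)) t

/-- The value function of the Bolza problem: the infimum in `[-∞,+∞]` of
`g(x(T)) + ∫ l(t,x(t),a(t)) dt` over all trajectory-control pairs on `[t₀,T]` starting at `x₀`. -/
def valueFunction {X Y : Type*} [NormedAddCommGroup X] [NormedSpace ℝ X]
    [TopologicalSpace Y] (A : Set Y) (f : ℝ → X → Y → X) (l : ℝ → X → Y → ℝ) (g : X → EReal)
    (T t₀ : ℝ) (x₀ : X) : EReal :=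
  ⨅ (x : ℝ → X) (a : ℝ → Y) (_ : IsTrajectoryControl A f T t₀ x₀ x a),
    g (x T) + ((∫ t in t₀..T, l t (x t) (a t) : ℝ) : EReal)

/-- The value function associated with the representation of `H` built from `c`, `λ`, with the
closed unit ball of `ℝⁿ⁺¹` as the control set, and with the terminal cost `g`. -/
def repValue {n : ℕ} (T : ℝ) (c : ℝ → ℝ) (lam : ℝ → StateSpace n → ℝ)
    (H : ℝ → StateSpace n → StateSpace n → ℝ) (g : StateSpace n → EReal)
    (t₀ : ℝ) (x₀ : StateSpace n) : EReal :=
  valueFunction (Metric.closedBall (0 : EpiSpace n) 1) (repDynamics c lam H) (repCost c lam H) g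
    T t₀ x₀

/-! ### Epi-convergence -/

/-- An extended-real-valued function is proper if it never takes the value `-∞` and is not
identically `+∞`. -/
def IsProperFn {X : Type*} (φ : X → EReal) : Prop :=
  (∀ x, φ x ≠ ⊥) ∧ ∃ x, φ x ≠ ⊤

/-- Epi-convergence of `φ i` to `ψ`, as functions on the set `D`. -/
def EpiConvergesOn {X : Type*} [TopologicalSpace X] (D : Set X) (φ : ℕ → X → EReal)
    (ψ : X → EReal) : Prop :=
  ∀ x ∈ D,
    (∀ u : ℕ → X, (∀ i, u i ∈ D) → Tendsto u atTop (𝓝 x) →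
      ψ x ≤ liminf (fun i => φ i (u i)) atTop) ∧
    (∃ u : ℕ → X, (∀ i, u i ∈ D) ∧ Tendsto u atTop (𝓝 x) ∧
      limsup (fun i => φ i (u i)) atTop ≤ ψ x)

end

/-! Both halves of epi-convergence rest on two properties of the parametrization e = (f,l) of the
epigraph of L(t,x,·).

Stability. By convex duality, a bound |H - H'| ≤ κ(1+|q|) moves the distance function of the
epigraph by at most 2κ, and pointwise convergence of Hamiltonians with a common Lipschitz constant
in q makes these distances converge (`exists_mem_conjEpi_dist_le`, `tendsto_infDist_conjEpi`).
Cutting a closed convex set with the ball about y of radius twice the distance is a Lipschitz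
operation (`exists_mem_nearPart_dist_le`), and the Steiner point is a Lipschitz selection
(`norm_steinerPoint_sub_le`, `steinerPoint_mem`). Hence e is Lipschitz in x on balls with an
integrable constant common to all i, and e_i(t,x_i,a) → e(t,x,a) when x_i → x.

Surjectivity. The near part of a point of the epigraph is that point alone, so e(z/ω) = z for z in
the epigraph. Condition (BLC) puts the graph of L in the ball of radius ω, so after lowering the
cost every velocity in the epigraph is e(a) for an explicit a in the unit ball.

Lower bound (`exists_limit_trajectory`). The arcs (state, accumulated cost) have increments
dominated by one integrable function, so a subsequence converges. The relation ⟨x',q⟩ - y' ≤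
H_i(t,x,q) is linear in the velocity; integrated, it passes to the limit for each q, and
differentiating returns an arc with velocity in the limit epigraph. Surjectivity turns it into a
trajectory of no larger cost, and the lower epi-limit of g_i at the endpoint finishes.

Upper bound (`exists_trajectory_of_control`, `tendsto_trajectory`). Take an almost optimal pair
(x,a) and points z_i → x(T) with limsup g_i(z_i) ≤ g(x(T)). Solving x' = f_i(t,x,a) backward from
x_i(T) = z_i with the same control, Grönwall's inequality gives convergence of the arcs and costs.
The initial points x_i(t₀) converge to x₀ and form the recovery sequence. -/

set_option linter.unusedSectionVars false

/-! ### The uniform probability measure on the unit sphere -/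

section Sphere

variable {X : Type*} [NormedAddCommGroup X] [InnerProductSpace ℝ X] [FiniteDimensional ℝ X]
  [MeasurableSpace X] [BorelSpace X]

/-- A linear isometry acts on the unit sphere. -/
def sphereMap (R : X ≃ₗᵢ[ℝ] X) (p : Metric.sphere (0 : X) 1) : Metric.sphere (0 : X) 1 :=
  ⟨R p, by simp⟩

theorem continuous_sphereMap (R : X ≃ₗᵢ[ℝ] X) : Continuous (sphereMap R) :=
  Continuous.subtype_mk (R.continuous.comp continuous_subtype_val) _

/-- A linear isometry acts on the unit sphere by a homeomorphism. -/
def sphereHomeomorph (R : X ≃ₗᵢ[ℝ] X) :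
    Metric.sphere (0 : X) 1 ≃ₜ Metric.sphere (0 : X) 1 where
  toFun := sphereMap R
  invFun := sphereMap R.symm
  left_inv p := by ext; simp [sphereMap]
  right_inv p := by ext; simp [sphereMap]
  continuous_toFun := continuous_sphereMap R
  continuous_invFun := continuous_sphereMap R.symm

-- The surface measure of s is a multiple of the Lebesgue measure of the cone of s in the unit ball,
-- and a linear isometry maps cones to cones and preserves volume.
open scoped Pointwise in
theorem measurePreserving_sphereMap_toSphere (R : X ≃ₗᵢ[ℝ] X) :
    MeasurePreserving (sphereMap R) (volume : Measure X).toSphere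
      (volume : Measure X).toSphere := by
  refine ⟨(continuous_sphereMap R).measurable, ?_⟩
  ext s hs
  rw [Measure.map_apply (continuous_sphereMap R).measurable hs,
    Measure.toSphere_apply' _ ((continuous_sphereMap R).measurable hs),
    Measure.toSphere_apply' _ hs]
  congr 1
  have himg : (Ioo (0 : ℝ) 1 • (((↑) : Metric.sphere (0 : X) 1 → X) '' (sphereMap R ⁻¹' s)))
      = R ⁻¹' (Ioo (0 : ℝ) 1 • (((↑) : Metric.sphere (0 : X) 1 → X) '' s)) := by
    ext x
    simp only [mem_preimage, Set.mem_smul, mem_image]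
    constructor
    · rintro ⟨r, hr, _, ⟨p, hp, rfl⟩, rfl⟩
      exact ⟨r, hr, R p, ⟨sphereMap R p, hp, rfl⟩, by simp⟩
    · rintro ⟨r, hr, _, ⟨p, hp, rfl⟩, hx⟩
      refine ⟨r, hr, R.symm p, ⟨sphereMap R.symm p, ?_, rfl⟩, ?_⟩
      · have : sphereMap R (sphereMap R.symm p) = p := (sphereHomeomorph R).right_inv p
        simpa [this] using hp
      · rw [← map_smul, hx]; simp
  rw [himg]
  exact R.measurePreserving.measure_preimage_equiv (f := R.toHomeomorph.toMeasurableEquiv) _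

variable (X) in
/-- The surface measure of the unit sphere, normalized to a probability measure. -/
noncomputable def sphereProb : Measure (Metric.sphere (0 : X) 1) :=
  ((volume : Measure X).toSphere univ)⁻¹ • (volume : Measure X).toSphere

instance [Nontrivial X] : IsProbabilityMeasure (sphereProb X) := by
  refine ⟨?_⟩
  rw [sphereProb, Measure.smul_apply, smul_eq_mul]
  refine ENNReal.inv_mul_cancel ?_ (measure_ne_top _ _)
  rw [Ne, Measure.measure_univ_eq_zero]
  exact Measure.toSphere_ne_zero _

theorem steinerPoint_eq_integral (K : Set X) :
    steinerPoint K = (Module.finrank ℝ X : ℝ) •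
      ∫ p : Metric.sphere (0 : X) 1, supportFn K (p : X) • (p : X) ∂(sphereProb X) := rfl

theorem integral_sphereProb_comp {F : Type*} [NormedAddCommGroup F] [NormedSpace ℝ F]
    (R : X ≃ₗᵢ[ℝ] X) (φ : Metric.sphere (0 : X) 1 → F) :
    ∫ p, φ (sphereMap R p) ∂(sphereProb X) = ∫ p, φ p ∂(sphereProb X) :=
  MeasurePreserving.integral_comp ((measurePreserving_sphereMap_toSphere R).smul_measure _)
    (sphereHomeomorph R).measurableEmbedding φ

theorem integrable_sphereProb_of_continuous [Nontrivial X] {F : Type*} [NormedAddCommGroup F]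
    {φ : Metric.sphere (0 : X) 1 → F} (hφ : Continuous φ) : Integrable φ (sphereProb X) :=
  hφ.integrable_of_hasCompactSupport (HasCompactSupport.of_compactSpace φ)

theorem integral_inner_mul_inner_comp (R : X ≃ₗᵢ[ℝ] X) (u y : X) :
    ∫ p : Metric.sphere (0 : X) 1, inner ℝ (R u) (p : X) * inner ℝ (p : X) (R y) ∂(sphereProb X)
      = ∫ p : Metric.sphere (0 : X) 1, inner ℝ u (p : X) * inner ℝ (p : X) y ∂(sphereProb X) := by
  rw [← integral_sphereProb_comp R]
  simp [sphereMap]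

theorem continuous_inner_mul_inner_sphere (u y : X) :
    Continuous fun p : Metric.sphere (0 : X) 1 => inner ℝ u (p : X) * inner ℝ (p : X) y := by
  fun_prop

/-- The reflection in the hyperplane orthogonal to u negates u and fixes y, so the integral equals
its own negative. -/
theorem integral_inner_mul_inner_of_orthogonal {u y : X} (h : inner ℝ u y = 0) :
    ∫ p : Metric.sphere (0 : X) 1, inner ℝ u (p : X) * inner ℝ (p : X) y ∂(sphereProb X) = 0 := by
  have h1 := integral_inner_mul_inner_comp (Submodule.reflection (Submodule.span ℝ {u})ᗮ) u y
  rw [Submodule.reflection_orthogonalComplement_singleton_eq_neg,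
    Submodule.reflection_mem_subspace_eq_self
      (by rwa [Submodule.mem_orthogonal_singleton_iff_inner_right])] at h1
  simp only [inner_neg_left, neg_mul, integral_neg] at h1
  linarith

/-- By invariance under reflections the integral depends on ‖u‖ only, so u may be replaced by ‖u‖
times each vector of an orthonormal basis; Parseval's identity on the unit sphere evaluates the sum.
-/
theorem integral_inner_mul_inner_self [Nontrivial X] (u : X) :
    (Module.finrank ℝ X : ℝ) *
      ∫ p : Metric.sphere (0 : X) 1, inner ℝ u (p : X) * inner ℝ (p : X) u ∂(sphereProb X)
      = ‖u‖ ^ 2 := by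
  set b := stdOrthonormalBasis ℝ X
  have key : ∀ i, ∫ p : Metric.sphere (0 : X) 1, inner ℝ (‖u‖ • b i) (p : X) *
      inner ℝ (p : X) (‖u‖ • b i) ∂(sphereProb X) =
      ∫ p : Metric.sphere (0 : X) 1, inner ℝ u (p : X) * inner ℝ (p : X) u ∂(sphereProb X) := by
    intro i
    have hn : ‖u‖ = ‖‖u‖ • b i‖ := by simp [norm_smul]
    rw [← Submodule.reflection_sub hn]
    exact integral_inner_mul_inner_comp _ u u
  have hsum : ∑ i, ∫ p : Metric.sphere (0 : X) 1, inner ℝ (‖u‖ • b i) (p : X) *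
      inner ℝ (p : X) (‖u‖ • b i) ∂(sphereProb X) = ‖u‖ ^ 2 := by
    rw [← integral_finsetSum]
    · have : ∀ p : Metric.sphere (0 : X) 1, ∑ i, inner ℝ (‖u‖ • b i) (p : X) *
          inner ℝ (p : X) (‖u‖ • b i) = ‖u‖ ^ 2 := by
        intro p
        have h2 := b.sum_sq_norm_inner_right (p : X)
        have h3 : ∀ i, inner ℝ (‖u‖ • b i) (p : X) * inner ℝ (p : X) (‖u‖ • b i)
            = ‖u‖ ^ 2 * ‖inner ℝ (b i) (p : X)‖ ^ 2 := by
          intro i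
          rw [real_inner_comm (‖u‖ • b i) (p : X), inner_smul_left, Real.norm_eq_abs, sq_abs]
          simp; ring
        simp_rw [h3]
        rw [← Finset.mul_sum, h2]; simp
      simp [this]
    · intro i _
      exact integrable_sphereProb_of_continuous (continuous_inner_mul_inner_sphere _ _)
  rw [Finset.sum_congr rfl (fun i _ => key i)] at hsum
  simpa using hsum

/-- Splitting y along u and its orthogonal complement reduces this to the two preceding integrals.
It expresses that translating a set by y translates its Steiner point by y. -/
theorem finrank_mul_integral_inner_mul_inner [Nontrivial X] {u : X} (hu : ‖u‖ = 1) (y : X) :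
    (Module.finrank ℝ X : ℝ) *
      ∫ p : Metric.sphere (0 : X) 1, inner ℝ u (p : X) * inner ℝ (p : X) y ∂(sphereProb X)
      = inner ℝ u y := by
  set r : ℝ := inner ℝ u y with hr
  have horth : inner ℝ u (y - r • u) = 0 := by
    rw [inner_sub_right, inner_smul_right, real_inner_self_eq_norm_sq, hu]; simp [hr]
  have h1 := integral_inner_mul_inner_of_orthogonal horth
  have h2 := integral_inner_mul_inner_self u
  have hsplit : ∀ p : Metric.sphere (0 : X) 1, inner ℝ u (p : X) * inner ℝ (p : X) y =
      inner ℝ u (p : X) * inner ℝ (p : X) (y - r • u) +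
        r * (inner ℝ u (p : X) * inner ℝ (p : X) u) := by
    intro p
    rw [inner_sub_right, inner_smul_right]; ring
  simp_rw [hsplit]
  rw [integral_add (integrable_sphereProb_of_continuous (continuous_inner_mul_inner_sphere _ _))
    ((integrable_sphereProb_of_continuous (continuous_inner_mul_inner_sphere _ _)).const_mul r),
    h1, integral_const_mul, zero_add, mul_left_comm, h2, hu]
  simp

end Sphere

/-! ### Support functions and Steiner points -/

section Steiner

variable {X : Type*} [NormedAddCommGroup X] [InnerProductSpace ℝ X]

theorem supportFn_le {K : Set X} (hK : K.Nonempty) {p : X} {r : ℝ}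
    (h : ∀ y ∈ K, inner ℝ p y ≤ r) : supportFn K p ≤ r :=
  csSup_le (hK.image _) (by rintro _ ⟨y, hy, rfl⟩; exact h y hy)

theorem bddAbove_image_inner {K : Set X} (hK : Bornology.IsBounded K) (p : X) :
    BddAbove ((fun y => inner ℝ p y) '' K) := by
  obtain ⟨C, hC⟩ := hK.exists_norm_le
  refine ⟨‖p‖ * C, ?_⟩
  rintro _ ⟨y, hy, rfl⟩
  exact (real_inner_le_norm p y).trans (mul_le_mul_of_nonneg_left (hC y hy) (norm_nonneg _))

theorem inner_le_supportFn {K : Set X} (hK : Bornology.IsBounded K) (p : X) {y : X} (hy : y ∈ K) :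
    inner ℝ p y ≤ supportFn K p :=
  le_csSup (bddAbove_image_inner hK p) ⟨y, hy, rfl⟩

theorem supportFn_le_add {K K' : Set X} (hK : K.Nonempty) (hK' : Bornology.IsBounded K') {ρ : ℝ}
    (h : ∀ y ∈ K, ∃ y' ∈ K', dist y y' ≤ ρ) {p : X} (hp : ‖p‖ = 1) :
    supportFn K p ≤ supportFn K' p + ρ := by
  refine supportFn_le hK fun y hy => ?_
  obtain ⟨y', hy', hd⟩ := h y hy
  have h1 := inner_le_supportFn hK' p hy'
  have h2 : inner ℝ p (y - y') ≤ ρ := by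
    refine (real_inner_le_norm _ _).trans ?_
    rwa [hp, one_mul, ← dist_eq_norm]
  rw [inner_sub_right] at h2
  linarith

theorem continuous_supportFn {K : Set X} (hK : K.Nonempty) (hKb : Bornology.IsBounded K) :
    Continuous (supportFn K) := by
  obtain ⟨C, hC⟩ := hKb.exists_norm_le
  have hC0 : 0 ≤ C := by
    obtain ⟨y, hy⟩ := hK
    exact (norm_nonneg y).trans (hC y hy)
  have hle : ∀ p q, supportFn K p ≤ supportFn K q + C * dist p q := by
    intro p q
    refine supportFn_le hK fun y hy => ?_
    have h1 := inner_le_supportFn hKb q hy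
    have h2 : inner ℝ (p - q) y ≤ C * dist p q := by
      refine (real_inner_le_norm _ _).trans ?_
      rw [dist_eq_norm, mul_comm]
      exact mul_le_mul_of_nonneg_right (hC y hy) (norm_nonneg _)
    rw [inner_sub_left] at h2
    linarith
  exact (LipschitzWith.of_le_add_mul ⟨C, hC0⟩ hle).continuous

variable [FiniteDimensional ℝ X] [MeasurableSpace X] [BorelSpace X]

theorem continuous_supportFn_smul {K : Set X} (hK : K.Nonempty) (hKb : Bornology.IsBounded K) :
    Continuous fun p : Metric.sphere (0 : X) 1 => supportFn K (p : X) • (p : X) :=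
  ((continuous_supportFn hK hKb).comp continuous_subtype_val).smul continuous_subtype_val

/-- Sets at Hausdorff distance at most ρ have support functions within ρ on the unit sphere.
Averaging keeps the bound, and the dimension factor of the Steiner point remains. -/
theorem norm_steinerPoint_sub_le [Nontrivial X] {K K' : Set X} (hK : K.Nonempty)
    (hKb : Bornology.IsBounded K) (hK' : K'.Nonempty) (hKb' : Bornology.IsBounded K') {ρ : ℝ}
    (h : ∀ y ∈ K, ∃ y' ∈ K', dist y y' ≤ ρ) (h' : ∀ y ∈ K', ∃ y' ∈ K, dist y y' ≤ ρ) :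
    ‖steinerPoint K - steinerPoint K'‖ ≤ Module.finrank ℝ X * ρ := by
  rw [steinerPoint_eq_integral, steinerPoint_eq_integral, ← smul_sub,
    ← integral_sub (integrable_sphereProb_of_continuous (continuous_supportFn_smul hK hKb))
      (integrable_sphereProb_of_continuous (continuous_supportFn_smul hK' hKb')), norm_smul]
  simp only [Real.norm_natCast]
  refine mul_le_mul_of_nonneg_left ?_ (Nat.cast_nonneg _)
  refine (norm_integral_le_of_norm_le_const (C := ρ) (ae_of_all _ fun p => ?_)).trans (by simp)
  have hp : ‖(p : X)‖ = 1 := by simp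
  rw [← sub_smul, norm_smul, hp, mul_one, Real.norm_eq_abs, abs_le]
  have h1 := supportFn_le_add hK hKb' h hp
  have h2 := supportFn_le_add hK' hKb h' hp
  constructor <;> linarith

/-- Each direction p is paired with its mirror image in the hyperplane orthogonal to u. Once K is
translated so that its maximizer in direction u is the origin, the support function is no larger on
the side of u than on the mirror side, so the average against ⟨u,p⟩ is nonpositive. -/
theorem inner_steinerPoint_le [Nontrivial X] {K : Set X} (hK : K.Nonempty) (hKc : IsCompact K)
    {u : X} (hu : ‖u‖ = 1) : inner ℝ u (steinerPoint K) ≤ supportFn K u := by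
  obtain ⟨y₀, hy₀, hmax⟩ := hKc.exists_isMaxOn hK
    (f := fun y => inner ℝ u y) (by fun_prop)
  have hKb := hKc.isBounded
  have hy₀' : inner ℝ u y₀ = supportFn K u :=
    le_antisymm (inner_le_supportFn hKb u hy₀) (supportFn_le hK fun y hy => hmax hy)
  set R := Submodule.reflection (Submodule.span ℝ {u})ᗮ with hR
  have hRp : ∀ p : X, R p = p - (2 * inner ℝ u p) • u := by
    intro p
    rw [hR, Submodule.reflection_orthogonal_apply, Submodule.reflection_singleton_apply, hu]
    simp [two_smul, two_mul, add_smul]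
  -- This is the support function of K - y₀. The translation contributes exactly ⟨u,y₀⟩, which is
  -- the bound sought.
  set φ : Metric.sphere (0 : X) 1 → ℝ := fun p => supportFn K (p : X) - inner ℝ (p : X) y₀ with hφ
  have hφc : Continuous φ :=
    ((continuous_supportFn hK hKb).comp continuous_subtype_val).sub (by fun_prop)
  have hpc : Continuous fun p : Metric.sphere (0 : X) 1 => inner ℝ u (p : X) * φ p :=
    Continuous.mul (by fun_prop) hφc
  have hmono : ∀ p q : X, (∀ y ∈ K, inner ℝ p (y - y₀) ≤ inner ℝ q (y - y₀)) →
      supportFn K p - inner ℝ p y₀ ≤ supportFn K q - inner ℝ q y₀ := by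
    intro p q h
    rw [sub_le_iff_le_add]
    refine supportFn_le hK fun y hy => ?_
    have h1 := h y hy
    have h2 := inner_le_supportFn hKb q hy
    rw [inner_sub_right, inner_sub_right] at h1
    linarith
  have hneg : ∫ p : Metric.sphere (0 : X) 1, inner ℝ u (p : X) * φ p ∂(sphereProb X) ≤ 0 := by
    have hcomp := integral_sphereProb_comp R
      (fun p : Metric.sphere (0 : X) 1 => inner ℝ u (p : X) * φ p)
    have hadd : ∫ p : Metric.sphere (0 : X) 1, (inner ℝ u (p : X) * φ p +
        inner ℝ u (sphereMap R p : X) * φ (sphereMap R p)) ∂(sphereProb X) ≤ 0 := by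
      refine integral_nonpos fun p => ?_
      have hup : inner ℝ u (sphereMap R p : X) = - inner ℝ u (p : X) := by
        change inner ℝ u (R p) = _
        rw [hRp, inner_sub_right, inner_smul_right, real_inner_self_eq_norm_sq, hu]; ring
      have hdiff : ∀ y, inner ℝ (p : X) (y - y₀) - inner ℝ (sphereMap R p : X) (y - y₀)
          = 2 * inner ℝ u (p : X) * inner ℝ u (y - y₀) := by
        intro y
        change _ - inner ℝ (R p) _ = _
        rw [hRp, inner_sub_left, inner_smul_left]; simp
      have hle : ∀ y ∈ K, inner ℝ u (y - y₀) ≤ 0 := by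
        intro y hy
        rw [inner_sub_right, sub_nonpos]; exact hmax hy
      change inner ℝ u (p : X) * φ p + inner ℝ u (sphereMap R p : X) * φ (sphereMap R p) ≤ 0
      rw [hup]
      rcases le_total 0 (inner ℝ u (p : X)) with h0 | h0
      · have : φ p ≤ φ (sphereMap R p) := by
          refine hmono _ _ fun y hy => ?_
          have := hdiff y
          nlinarith [hle y hy]
        nlinarith
      · have : φ (sphereMap R p) ≤ φ p := by
          refine hmono _ _ fun y hy => ?_
          have := hdiff y
          nlinarith [hle y hy]
        nlinarith
    have hint : Integrable (fun p : Metric.sphere (0 : X) 1 =>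
        inner ℝ u (sphereMap R p : X) * φ (sphereMap R p)) (sphereProb X) :=
      integrable_sphereProb_of_continuous (hpc.comp (continuous_sphereMap R))
    rw [integral_add (integrable_sphereProb_of_continuous hpc) hint, hcomp] at hadd
    linarith
  have hinner : inner ℝ u (steinerPoint K) = (Module.finrank ℝ X : ℝ) *
      ∫ p : Metric.sphere (0 : X) 1, (inner ℝ u (p : X) * φ p +
        inner ℝ u (p : X) * inner ℝ (p : X) y₀) ∂(sphereProb X) := by
    rw [steinerPoint_eq_integral, inner_smul_right, ← integral_inner
      (integrable_sphereProb_of_continuous (continuous_supportFn_smul hK hKb))]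
    congr 2
    ext p
    rw [inner_smul_right]; simp only [hφ]; ring
  rw [hinner, integral_add (integrable_sphereProb_of_continuous hpc)
    (integrable_sphereProb_of_continuous (continuous_inner_mul_inner_sphere _ _)), mul_add,
    finrank_mul_integral_inner_mul_inner hu, hy₀']
  have : (Module.finrank ℝ X : ℝ) *
      ∫ p : Metric.sphere (0 : X) 1, inner ℝ u (p : X) * φ p ∂(sphereProb X) ≤ 0 :=
    mul_nonpos_of_nonneg_of_nonpos (Nat.cast_nonneg _) hneg
  linarith

/-- A point outside K would be strictly separated from it by some functional, against
`inner_steinerPoint_le` in the normalized direction of that functional. -/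
theorem steinerPoint_mem [Nontrivial X] {K : Set X} (hK : K.Nonempty) (hKc : IsCompact K)
    (hKconv : Convex ℝ K) : steinerPoint K ∈ K := by
  by_contra hmem
  obtain ⟨f, r, hf, hr⟩ := geometric_hahn_banach_closed_point hKconv hKc.isClosed hmem
  obtain ⟨v, hv⟩ : ∃ v : X, ∀ x, f x = inner ℝ v x :=
    ⟨(InnerProductSpace.toDual ℝ X).symm f, fun x => by simp⟩
  have hv0 : v ≠ 0 := by
    rintro rfl
    obtain ⟨y, hy⟩ := hK
    have := hf y hy
    simp [hv] at this hr
    linarith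
  have hvn : 0 < ‖v‖ := norm_pos_iff.mpr hv0
  have h1 := inner_steinerPoint_le hK hKc (u := ‖v‖⁻¹ • v) (by
    rw [norm_smul, norm_inv, norm_norm, inv_mul_cancel₀ hvn.ne'])
  have h2 : supportFn K (‖v‖⁻¹ • v) ≤ ‖v‖⁻¹ * r := by
    refine supportFn_le hK fun y hy => ?_
    rw [inner_smul_left]
    have := hf y hy
    rw [hv] at this
    simpa using mul_le_mul_of_nonneg_left this.le (inv_nonneg.mpr hvn.le)
  rw [inner_smul_left] at h1
  rw [hv] at hr
  have h3 : ‖v‖⁻¹ * r < ‖v‖⁻¹ * inner ℝ v (steinerPoint K) :=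
    mul_lt_mul_of_pos_left hr (inv_pos.mpr hvn)
  simp at h1
  linarith

theorem steinerPoint_singleton [Nontrivial X] (y : X) : steinerPoint {y} = y :=
  steinerPoint_mem (singleton_nonempty y) isCompact_singleton (convex_singleton y)

end Steiner

/-! ### The part of a closed convex set near a point -/

section NearPart

variable {X : Type*} [NormedAddCommGroup X] [InnerProductSpace ℝ X] [FiniteDimensional ℝ X]

theorem isCompact_nearPart {E : Set X} (hE : IsClosed E) (y : X) : IsCompact (nearPart y E) :=
  (isCompact_closedBall y _).inter_left hE

theorem convex_nearPart {E : Set X} (hE : Convex ℝ E) (y : X) : Convex ℝ (nearPart y E) :=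
  hE.inter (convex_closedBall _ _)

theorem nonempty_nearPart {E : Set X} (hE : IsClosed E) (hne : E.Nonempty) (y : X) :
    (nearPart y E).Nonempty := by
  obtain ⟨w, hw, hd⟩ := hE.exists_infDist_eq_dist hne y
  refine ⟨w, hw, ?_⟩
  rw [Metric.mem_closedBall, dist_comm, ← hd]
  linarith [Metric.infDist_nonneg (x := y) (s := E)]

theorem nearPart_of_mem {E : Set X} {y : X} (hy : y ∈ E) : nearPart y E = {y} := by
  rw [nearPart, Metric.infDist_zero_of_mem hy]
  simp [hy]

/-- The projection w of z to E' may miss the ball about y' of radius 2d' by up to 3ρ. The projection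
π of y' lies at depth d' inside that ball, so a short move from w towards π, which stays in E' by
convexity, re-enters it. The factor 2 in `nearPart` provides this depth. -/
theorem exists_mem_nearPart_dist_le {E E' : Set X} (hE' : IsClosed E') (hc : Convex ℝ E')
    (hne : E'.Nonempty) {y y' z : X} {ρ : ℝ} (hz : z ∈ nearPart y E)
    (h1 : Metric.infDist z E' + dist y y' ≤ ρ)
    (h2 : Metric.infDist y E ≤ Metric.infDist y' E' + ρ) :
    ∃ z' ∈ nearPart y' E', dist z z' ≤ 10 * ρ := by
  obtain ⟨w, hw, hwd⟩ := hE'.exists_infDist_eq_dist hne z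
  obtain ⟨π, hπ, hπd⟩ := hE'.exists_infDist_eq_dist hne y'
  set d' := Metric.infDist y' E' with hd'
  have hd0 : 0 ≤ d' := Metric.infDist_nonneg
  have hρ0 : 0 ≤ ρ := by
    have := Metric.infDist_nonneg (x := z) (s := E')
    have := dist_nonneg (x := y) (y := y')
    linarith
  have hzy : dist z y ≤ 2 * Metric.infDist y E := hz.2
  have hwz : dist z w + dist y y' ≤ ρ := by rw [← hwd]; exact h1
  have hwy : dist w y' ≤ 2 * d' + 3 * ρ := by
    have e1 := dist_triangle4 w z y y'
    rw [dist_comm w z] at e1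
    linarith
  have hzw : dist z w ≤ ρ := by linarith [dist_nonneg (x := y) (y := y')]
  -- For ρ = 0 the point w already lies in the ball, while d' + 3ρ below might vanish.
  rcases hρ0.eq_or_lt with h0 | hpos
  · refine ⟨w, ⟨hw, ?_⟩, by linarith⟩
    rw [Metric.mem_closedBall]
    linarith
  -- This θ solves (1-θ)(2d'+3ρ) + θd' = 2d'. The move costs θ(3d'+3ρ) ≤ 9ρ, which with dist z w ≤ ρ
  -- gives 10ρ.
  set θ := 3 * ρ / (d' + 3 * ρ) with hθ
  have hden : 0 < d' + 3 * ρ := by linarith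
  have hθ0 : 0 ≤ θ := by positivity
  have hθ1 : θ ≤ 1 := by rw [hθ, div_le_one hden]; linarith
  have hθe : θ * (d' + 3 * ρ) = 3 * ρ := by rw [hθ]; field_simp
  have hwy' : ‖w - y'‖ ≤ 2 * d' + 3 * ρ := by rwa [← dist_eq_norm]
  have hπy' : ‖π - y'‖ = d' := by rw [← dist_eq_norm, dist_comm]; exact hπd.symm
  refine ⟨(1 - θ) • w + θ • π, ⟨hc hw hπ (by linarith) hθ0 (by ring), ?_⟩, ?_⟩
  · rw [Metric.mem_closedBall, dist_eq_norm]
    have : (1 - θ) • w + θ • π - y' = (1 - θ) • (w - y') + θ • (π - y') := by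
      simp only [smul_sub, sub_smul, one_smul]; abel
    rw [this]
    refine (norm_add_le _ _).trans ?_
    rw [norm_smul, norm_smul, Real.norm_of_nonneg hθ0, Real.norm_of_nonneg (by linarith), hπy']
    have := mul_le_mul_of_nonneg_left hwy' (by linarith : (0 : ℝ) ≤ 1 - θ)
    nlinarith
  · have h3 : dist w ((1 - θ) • w + θ • π) ≤ 9 * ρ := by
      rw [dist_eq_norm]
      have : w - ((1 - θ) • w + θ • π) = θ • ((w - y') - (π - y')) := by
        simp only [smul_sub, sub_smul, one_smul]; abel
      rw [this, norm_smul, Real.norm_of_nonneg hθ0]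
      have h4 : ‖(w - y') - (π - y')‖ ≤ 3 * d' + 3 * ρ := by
        refine (norm_sub_le _ _).trans ?_
        linarith
      have := mul_le_mul_of_nonneg_left h4 hθ0
      nlinarith
    have := dist_triangle z w ((1 - θ) • w + θ • π)
    linarith

theorem norm_le_of_mem_nearPart {E : Set X} {y z : X} (hz : z ∈ nearPart y E) :
    ‖z‖ ≤ ‖y‖ + 2 * Metric.infDist y E := by
  have h1 : dist z y ≤ 2 * Metric.infDist y E := hz.2
  rw [dist_eq_norm] at h1
  have := norm_le_norm_add_norm_sub' z y
  linarith

variable [MeasurableSpace X] [BorelSpace X] [Nontrivial X]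

theorem steinerPoint_nearPart_mem {E : Set X} (hE : IsClosed E) (hc : Convex ℝ E)
    (hne : E.Nonempty) (y : X) : steinerPoint (nearPart y E) ∈ nearPart y E :=
  steinerPoint_mem (nonempty_nearPart hE hne y) (isCompact_nearPart hE y) (convex_nearPart hc y)

/-- Both near parts lie in the ball of radius R, so the distance functions need to be compared on
that ball only; locally uniform convergence of distances will therefore suffice. -/
theorem norm_steinerPoint_nearPart_sub_le {E E' : Set X} (hE : IsClosed E) (hc : Convex ℝ E)
    (hne : E.Nonempty) (hE' : IsClosed E') (hc' : Convex ℝ E') (hne' : E'.Nonempty) {y y' : X}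
    {R ε : ℝ} (hR : ∀ z, ‖z‖ ≤ R → |Metric.infDist z E - Metric.infDist z E'| ≤ ε)
    (hy : ‖y‖ + 2 * Metric.infDist y E ≤ R) (hy' : ‖y'‖ + 2 * Metric.infDist y' E' ≤ R) :
    ‖steinerPoint (nearPart y E) - steinerPoint (nearPart y' E')‖ ≤
      Module.finrank ℝ X * (10 * (ε + dist y y')) := by
  have hd := Metric.infDist_nonneg (x := y) (s := E)
  have hd' := Metric.infDist_nonneg (x := y') (s := E')
  have hy1 := abs_le.mp (hR y (by linarith))
  have hy1' := abs_le.mp (hR y' (by linarith))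
  refine norm_steinerPoint_sub_le (nonempty_nearPart hE hne y) (isCompact_nearPart hE y).isBounded
    (nonempty_nearPart hE' hne' y') (isCompact_nearPart hE' y').isBounded (fun z hz => ?_)
    (fun z hz => ?_)
  · refine exists_mem_nearPart_dist_le hE' hc' hne' hz ?_ ?_
    · have := abs_le.mp (hR z ((norm_le_of_mem_nearPart hz).trans hy))
      rw [Metric.infDist_zero_of_mem hz.1] at this
      linarith
    · have := Metric.infDist_le_infDist_add_dist (s := E') (x := y) (y := y')
      linarith
  · refine exists_mem_nearPart_dist_le hE hc hne hz ?_ ?_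
    · have := abs_le.mp (hR z ((norm_le_of_mem_nearPart hz).trans hy'))
      rw [Metric.infDist_zero_of_mem hz.1] at this
      rw [dist_comm y' y]
      linarith
    · have := Metric.infDist_le_infDist_add_dist (s := E) (x := y') (y := y)
      rw [dist_comm y' y] at this
      linarith

end NearPart

/-! ### Epigraphs of conjugate functions -/

section Uniform

theorem nonpos_of_forall_mul_le {A B : ℝ} (h : ∀ s : ℝ, 0 ≤ s → s * A ≤ B) : A ≤ 0 := by
  by_contra hA
  push Not at hA
  have h1 := h ((|B| + 1) / A) (by positivity)
  rw [div_mul_cancel₀ _ hA.ne'] at h1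
  linarith [le_abs_self B]

/-- Convergence on a finite net of points of the dense set controls all of K, since the common
Lipschitz constant bounds the error between net points. -/
theorem tendstoUniformlyOn_of_lipschitz {α : Type*} [PseudoMetricSpace α] {s : Set α}
    (hs : Dense s) {F : ℕ → α → ℝ} {f : α → ℝ} {C : ℝ}
    (hF : ∀ i x y, |F i x - F i y| ≤ C * dist x y) (hf : ∀ x y, |f x - f y| ≤ C * dist x y)
    (h : ∀ x ∈ s, Tendsto (fun i => F i x) atTop (𝓝 (f x))) {K : Set α} (hK : IsCompact K) :
    TendstoUniformlyOn F f atTop K := by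
  rw [Metric.tendstoUniformlyOn_iff]
  intro ε hε
  set δ := ε / (4 * (|C| + 1)) with hδ
  have hδ0 : 0 < δ := by positivity
  have hCδ : C * δ ≤ ε / 4 := by
    have : (|C| + 1) * δ = ε / 4 := by rw [hδ]; field_simp
    nlinarith [le_abs_self C]
  have hcover : K ⊆ ⋃ c ∈ s, Metric.ball c δ := by
    intro x _
    obtain ⟨c, hc, hxc⟩ := hs.exists_dist_lt x hδ0
    exact mem_biUnion hc hxc
  obtain ⟨b, hbs, hbf, hb⟩ := hK.elim_finite_subcover_image
    (fun c _ => Metric.isOpen_ball) hcover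
  have hev : ∀ᶠ i in atTop, ∀ c ∈ b, dist (F i c) (f c) < ε / 4 :=
    (hbf.eventually_all).mpr fun c hc => Metric.tendsto_nhds.mp (h c (hbs hc)) _ (by positivity)
  filter_upwards [hev] with i hi x hx
  obtain ⟨c, hc, hxc⟩ := mem_iUnion₂.mp (hb hx)
  rw [Metric.mem_ball] at hxc
  have h1 := abs_le.mp (hF i x c)
  have h2 := abs_le.mp (hf x c)
  have h3 := abs_lt.mp (Real.dist_eq _ _ ▸ hi c hc)
  have h4 : C * dist x c ≤ ε / 4 := by
    rcases le_total 0 C with h0 | h0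
    · exact (mul_le_mul_of_nonneg_left hxc.le h0).trans hCδ
    · exact (mul_nonpos_of_nonpos_of_nonneg h0 dist_nonneg).trans (by positivity)
  rw [Real.dist_eq, abs_lt]
  constructor <;> linarith [h1.1, h1.2, h2.1, h2.2, h3.1, h3.2]

theorem tendsto_of_lipschitz {α : Type*} [PseudoMetricSpace α] {s : Set α}
    (hs : Dense s) {F : ℕ → α → ℝ} {f : α → ℝ} {C : ℝ}
    (hF : ∀ i x y, |F i x - F i y| ≤ C * dist x y) (hf : ∀ x y, |f x - f y| ≤ C * dist x y)
    (h : ∀ x ∈ s, Tendsto (fun i => F i x) atTop (𝓝 (f x))) (x : α) :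
    Tendsto (fun i => F i x) atTop (𝓝 (f x)) :=
  (tendstoUniformlyOn_of_lipschitz hs hF hf h isCompact_singleton).tendsto_at (mem_singleton x)

theorem abs_infDist_sub_infDist_le {α : Type*} [PseudoMetricSpace α] (E : Set α) (x y : α) :
    |Metric.infDist x E - Metric.infDist y E| ≤ 1 * dist x y := by
  rw [abs_le]
  have h1 := Metric.infDist_le_infDist_add_dist (s := E) (x := x) (y := y)
  have h2 := Metric.infDist_le_infDist_add_dist (s := E) (x := y) (y := x)
  rw [dist_comm y x] at h2
  constructor <;> linarith

end Uniform

/-! ### Convex duality: how the epigraph of the conjugate moves with the function -/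

section Epigraph

variable {n : ℕ}

theorem norm_epiSpace_le (z : EpiSpace n) : ‖z‖ ≤ ‖z.fst‖ + |z.snd| := by
  rw [WithLp.prod_norm_eq_of_L2]
  refine Real.sqrt_le_iff.mpr ⟨by positivity, ?_⟩
  rw [Real.norm_eq_abs]
  nlinarith [norm_nonneg z.fst, abs_nonneg z.snd]

theorem norm_fst_le_norm (z : EpiSpace n) : ‖z.fst‖ ≤ ‖z‖ := by
  rw [WithLp.prod_norm_eq_of_L2]
  exact Real.le_sqrt_of_sq_le (by nlinarith [sq_nonneg ‖z.snd‖])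

theorem abs_snd_le_norm (z : EpiSpace n) : |z.snd| ≤ ‖z‖ := by
  rw [WithLp.prod_norm_eq_of_L2]
  exact Real.le_sqrt_of_sq_le (by rw [Real.norm_eq_abs]; nlinarith [sq_nonneg ‖z.fst‖])

theorem continuous_epiSpace_fst : Continuous fun z : EpiSpace n => z.fst :=
  continuous_fst.comp (WithLp.prod_continuous_ofLp 2 _ _)

theorem continuous_epiSpace_snd : Continuous fun z : EpiSpace n => z.snd :=
  continuous_snd.comp (WithLp.prod_continuous_ofLp 2 _ _)

/-- The epigraph of the Legendre-Fenchel conjugate of `h`. -/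
def conjEpi (h : StateSpace n → ℝ) : Set (EpiSpace n) :=
  {z | ∀ q, inner ℝ z.fst q - h q ≤ z.snd}

theorem lagrangianEpigraph_eq (H : ℝ → StateSpace n → StateSpace n → ℝ) (t : ℝ)
    (x : StateSpace n) : lagrangianEpigraph H t x = conjEpi (H t x) := by
  ext z
  simp only [lagrangianEpigraph, conjEpi, lagrangian, mem_ofPred_eq, iSup_le_iff,
    EReal.coe_le_coe_iff]

theorem isClosed_conjEpi (h : StateSpace n → ℝ) : IsClosed (conjEpi h) := by
  simp only [conjEpi, ofPred_forall]
  refine isClosed_iInter fun q => isClosed_le ?_ continuous_epiSpace_snd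
  exact (continuous_epiSpace_fst.inner continuous_const).sub continuous_const

theorem convex_conjEpi (h : StateSpace n → ℝ) : Convex ℝ (conjEpi h) := by
  intro z hz w hw a b ha hb hab q
  have h1 := mul_le_mul_of_nonneg_left (hz q) ha
  have h2 := mul_le_mul_of_nonneg_left (hw q) hb
  simp only [WithLp.add_fst, WithLp.smul_fst, WithLp.add_snd, WithLp.smul_snd, inner_add_left,
    inner_smul_left, smul_eq_mul]
  have : h q = a * h q + b * h q := by rw [← add_mul, hab, one_mul]
  simp only [RCLike.conj_to_real]
  linarith

/-- Testing the defining inequality with q = s v, where v is the first component, and letting s grow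
rules out ‖v‖ > C. -/
theorem norm_fst_le_of_mem_conjEpi {h : StateSpace n → ℝ} {C : ℝ} (hC : 0 ≤ C)
    (hlip : ∀ p q, |h p - h q| ≤ C * ‖p - q‖) {z : EpiSpace n} (hz : z ∈ conjEpi h) :
    ‖z.fst‖ ≤ C := by
  rcases eq_or_ne z.fst 0 with h0 | h0
  · rw [h0, norm_zero]; exact hC
  have hpos : 0 < ‖z.fst‖ := norm_pos_iff.mpr h0
  have hA : ‖z.fst‖ * (‖z.fst‖ - C) ≤ 0 := by
    refine nonpos_of_forall_mul_le (B := z.snd + h 0) fun s hs => ?_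
    have h1 := hz (s • z.fst)
    have h2 := (abs_le.mp (hlip (s • z.fst) 0)).2
    rw [inner_smul_right, real_inner_self_eq_norm_sq] at h1
    rw [sub_zero, norm_smul, Real.norm_of_nonneg hs] at h2
    nlinarith
  nlinarith

/-- A sandwich argument: the convex function h - ⟨v,·⟩ + η lies above the concave function
-δ(1+‖q‖), so an affine function ⟨v',·⟩ - η' fits between them. Adding its coefficients to (v,η)
restores all inequalities, and the concave minorant forces ‖v'‖ ≤ δ and η' ≤ δ. -/
theorem exists_mem_conjEpi_dist_le {h : StateSpace n → ℝ} (hconv : ConvexOn ℝ univ h)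
    (hcont : Continuous h) {z : EpiSpace n} {δ : ℝ} (hδ : 0 ≤ δ)
    (hz : ∀ q, inner ℝ z.fst q - z.snd - h q ≤ δ * (1 + ‖q‖)) :
    ∃ w ∈ conjEpi h, dist z w ≤ 2 * δ := by
  set k : StateSpace n → ℝ := fun q => h q - inner ℝ z.fst q + z.snd with hk
  set g : StateSpace n → ℝ := fun q => δ * (1 + ‖q‖) with hg
  have hkconv : ConvexOn ℝ univ k := by
    refine ⟨convex_univ, fun p _ q _ a b ha hb hab => ?_⟩
    have h1 := hconv.2 (mem_univ p) (mem_univ q) ha hb hab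
    simp only [smul_eq_mul, hk, inner_add_right, inner_smul_right] at h1 ⊢
    have : z.snd = a * z.snd + b * z.snd := by rw [← add_mul, hab, one_mul]
    linarith
  have hkcont : Continuous k := by simp only [hk]; fun_prop
  have hs : Convex ℝ {p : StateSpace n × ℝ | k p.1 < p.2} := by
    simpa using hkconv.convex_strict_epigraph
  have hso : IsOpen {p : StateSpace n × ℝ | k p.1 < p.2} :=
    isOpen_lt (hkcont.comp continuous_fst) continuous_snd
  have ht : Convex ℝ {p : StateSpace n × ℝ | p.2 ≤ - g p.1} := by
    intro p hp q hq a b ha hb hab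
    have h1 := mul_le_mul_of_nonneg_left hp ha
    have h2 := mul_le_mul_of_nonneg_left hq hb
    have h3 : ‖a • p.1 + b • q.1‖ ≤ a * ‖p.1‖ + b * ‖q.1‖ := by
      refine (norm_add_le _ _).trans ?_
      rw [norm_smul, norm_smul, Real.norm_of_nonneg ha, Real.norm_of_nonneg hb]
    have h4 := mul_le_mul_of_nonneg_left h3 hδ
    simp only [mem_ofPred_eq, Prod.snd_add, Prod.smul_snd, smul_eq_mul, Prod.fst_add,
      Prod.smul_fst, hg] at h1 h2 ⊢
    have : δ = a * δ + b * δ := by rw [← add_mul, hab, one_mul]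
    linarith
  have hdisj : Disjoint {p : StateSpace n × ℝ | k p.1 < p.2} {p | p.2 ≤ - g p.1} := by
    rw [Set.disjoint_left]
    intro p hp hp'
    have := hz p.1
    simp only [mem_ofPred_eq, hk, hg] at hp hp'
    linarith
  obtain ⟨f, u, hf1, hf2⟩ := geometric_hahn_banach_open hs hso ht hdisj
  have hfsplit : ∀ (q : StateSpace n) (r : ℝ), f (q, r) = f (q, 0) + r * f (0, 1) := by
    intro q r
    have : ((q, r) : StateSpace n × ℝ) = (q, 0) + r • ((0, 1) : StateSpace n × ℝ) := by simp
    rw [this, map_add, map_smul, smul_eq_mul]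
  -- The vertical component of the separating functional. It is negative because, over q = 0, the
  -- strict epigraph contains a point above a point of the hypograph; hence the separating
  -- hyperplane is the graph of an affine function.
  set α := f (0, 1) with hα
  have hα0 : α < 0 := by
    have e1 := hf1 (0, |k 0| + 1) (by
      simp only [mem_ofPred_eq]; linarith [le_abs_self (k 0)])
    have e2 := hf2 (0, - g 0) (by simp)
    rw [hfsplit] at e1 e2
    have e3 : g 0 = δ := by simp [hg]
    have e4 : (|k 0| + 1 + δ) * α < 0 := by rw [e3] at e2; linarith
    by_contra hcon
    push Not at hcon
    have : 0 ≤ (|k 0| + 1 + δ) * α := by positivity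
    linarith
  obtain ⟨v, hv⟩ : ∃ v : StateSpace n, ∀ q, f (q, 0) = inner ℝ v q :=
    ⟨(InnerProductSpace.toDual ℝ _).symm (f.comp (ContinuousLinearMap.inl ℝ _ ℝ)), fun q => by simp⟩
  have hlow : ∀ q, inner ℝ v q - u ≤ (-α) * k q := by
    intro q
    refine le_of_forall_pos_le_add fun ε hε => ?_
    have e1 := hf1 (q, k q + ε / (-α)) (by
      simp only [mem_ofPred_eq]
      have : 0 < ε / (-α) := div_pos hε (by linarith)
      linarith)
    rw [hfsplit, hv] at e1
    have e2 : ε / (-α) * α = -ε := by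
      rw [div_neg, neg_mul, div_mul_cancel₀ _ hα0.ne]
    nlinarith
  have hup : ∀ q, u - inner ℝ v q ≤ (-α) * g q := by
    intro q
    have e1 := hf2 (q, - g q) (by simp)
    rw [hfsplit, hv] at e1
    linarith
  have hαp : 0 < -α := by linarith
  set v' : StateSpace n := (-α)⁻¹ • v with hv'
  set η' : ℝ := (-α)⁻¹ * u with hη'
  have hlow' : ∀ q, inner ℝ v' q - η' ≤ k q := by
    intro q
    have := mul_le_mul_of_nonneg_left (hlow q) (inv_nonneg.mpr hαp.le)
    rw [inv_mul_cancel_left₀ hαp.ne'] at this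
    rw [hv', inner_smul_left, hη']
    simp only [RCLike.conj_to_real]
    linarith
  have hup' : ∀ q, η' - inner ℝ v' q ≤ g q := by
    intro q
    have := mul_le_mul_of_nonneg_left (hup q) (inv_nonneg.mpr hαp.le)
    rw [inv_mul_cancel_left₀ hαp.ne'] at this
    rw [hv', inner_smul_left, hη']
    simp only [RCLike.conj_to_real]
    linarith
  have hη : η' ≤ δ := by
    have := hup' 0
    simpa [hg] using this
  have hvδ : ‖v'‖ ≤ δ := by
    have hA : ‖v'‖ * (‖v'‖ - δ) ≤ 0 := by
      refine nonpos_of_forall_mul_le (B := δ - η') fun s hs => ?_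
      have h1 := hup' (-(s • v'))
      simp only [hg] at h1
      rw [inner_neg_right, inner_smul_right, real_inner_self_eq_norm_sq, norm_neg, norm_smul s v',
        Real.norm_of_nonneg hs] at h1
      nlinarith
    rcases (norm_nonneg v').eq_or_lt with h0 | h0
    · rw [← h0]; exact hδ
    · nlinarith
  -- Only an upper bound on η' is at hand. Raising a negative η' to 0 stays in the epigraph and
  -- keeps the displacement at most δ.
  refine ⟨WithLp.toLp 2 (z.fst + v', z.snd + max η' 0), fun q => ?_, ?_⟩
  · have h1 := hlow' q
    simp only [hk] at h1
    change inner ℝ (z.fst + v') q - h q ≤ z.snd + max η' 0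
    rw [inner_add_left]
    linarith [le_max_left η' 0]
  · rw [dist_eq_norm]
    refine (norm_epiSpace_le _).trans ?_
    change ‖z.fst - (z.fst + v')‖ + |z.snd - (z.snd + max η' 0)| ≤ _
    rw [sub_add_cancel_left, sub_add_cancel_left, norm_neg, abs_neg,
      abs_of_nonneg (le_max_right _ _)]
    have := max_le hη hδ
    linarith

theorem nonempty_conjEpi {h : StateSpace n → ℝ} (hconv : ConvexOn ℝ univ h)
    {C : ℝ} (hlip : ∀ p q, |h p - h q| ≤ C * ‖p - q‖) (hcont : Continuous h) :
    (conjEpi h).Nonempty := by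
  obtain ⟨w, hw, -⟩ := exists_mem_conjEpi_dist_le (z := 0) (δ := |h 0| + |C|) hconv hcont
    (by positivity) (fun q => by
      have h1 := abs_le.mp (hlip q 0)
      rw [sub_zero] at h1
      simp only [WithLp.zero_fst, WithLp.zero_snd, inner_zero_left]
      have h2 : C * ‖q‖ ≤ |C| * ‖q‖ := mul_le_mul_of_nonneg_right (le_abs_self C) (norm_nonneg _)
      nlinarith [neg_abs_le (h 0), norm_nonneg q, abs_nonneg C, abs_nonneg (h 0), h1.1,
        mul_nonneg (abs_nonneg (h 0)) (norm_nonneg q)])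
  exact ⟨w, hw⟩

theorem continuous_of_abs_sub_le {h : StateSpace n → ℝ} {C : ℝ}
    (hlip : ∀ p q, |h p - h q| ≤ C * ‖p - q‖) : Continuous h := by
  refine (LipschitzWith.of_dist_le_mul (K := Real.toNNReal C) fun p q => ?_).continuous
  rw [Real.dist_eq, dist_eq_norm]
  exact (hlip p q).trans (mul_le_mul_of_nonneg_right (Real.le_coe_toNNReal C) (norm_nonneg _))

/-- The point of one epigraph nearest to z violates the inequalities of the other by at most
κ(1+‖q‖), so it can be corrected at cost 2κ. -/
theorem abs_infDist_conjEpi_sub_le {h h' : StateSpace n → ℝ} (hconv : ConvexOn ℝ univ h)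
    (hcont : Continuous h) (hne : (conjEpi h).Nonempty) (hconv' : ConvexOn ℝ univ h')
    (hcont' : Continuous h') (hne' : (conjEpi h').Nonempty) {κ : ℝ} (hκ : 0 ≤ κ)
    (hhh : ∀ q, |h q - h' q| ≤ κ * (1 + ‖q‖)) (z : EpiSpace n) :
    |Metric.infDist z (conjEpi h) - Metric.infDist z (conjEpi h')| ≤ 2 * κ := by
  have key : ∀ {h h' : StateSpace n → ℝ}, (conjEpi h).Nonempty → ConvexOn ℝ univ h' →
      Continuous h' → (∀ q, |h q - h' q| ≤ κ * (1 + ‖q‖)) →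
      Metric.infDist z (conjEpi h') ≤ Metric.infDist z (conjEpi h) + 2 * κ := by
    intro h h' hne hconv' hcont' hhh
    obtain ⟨w, hw, hwd⟩ := (isClosed_conjEpi h).exists_infDist_eq_dist hne z
    obtain ⟨w', hw', hd⟩ := exists_mem_conjEpi_dist_le (z := w) hconv' hcont' hκ (fun q => by
      have h1 := hw q
      have h2 := abs_le.mp (hhh q)
      linarith [h2.1, h2.2])
    have h3 := Metric.infDist_le_dist_of_mem (x := z) hw'
    have h4 := dist_triangle z w w'
    linarith
  have h1 := key hne hconv' hcont' hhh
  have h2 := key hne' hconv hcont (fun q => by rw [abs_sub_comm]; exact hhh q)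
  rw [abs_le]
  constructor <;> linarith

/-- Pointwise convergence is uniform on a ball of radius M. Outside it, convexity of h_i along the
segment from 0 to q shows that the violation at q grows at most linearly, with slope A/M = δ. Hence
w nearly satisfies all inequalities of h_i and can be corrected. -/
theorem eventually_infDist_conjEpi_le {h : ℕ → StateSpace n → ℝ} {h₀ : StateSpace n → ℝ} {C : ℝ}
    (hconv : ∀ i, ConvexOn ℝ univ (h i)) (hlip : ∀ i p q, |h i p - h i q| ≤ C * ‖p - q‖)
    (hlip₀ : ∀ p q, |h₀ p - h₀ q| ≤ C * ‖p - q‖)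
    (hlim : ∀ q, Tendsto (fun i => h i q) atTop (𝓝 (h₀ q))) {w : EpiSpace n}
    (hw : w ∈ conjEpi h₀) {ε : ℝ} (hε : 0 < ε) :
    ∀ᶠ i in atTop, Metric.infDist w (conjEpi (h i)) ≤ ε := by
  set δ := ε / 2 with hδ
  have hδ0 : 0 < δ := by positivity
  -- The summand 2 collects two approximation errors of at most 1: one at the rescaled point l • q,
  -- one at 0.
  set A := |w.snd| + |h₀ 0| + 2 with hA
  have hA0 : 0 < A := by positivity
  set M := A / δ with hM
  have hM0 : 0 < M := by positivity
  have hMδ : M * δ = A := by rw [hM]; field_simp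
  have hunif := tendstoUniformlyOn_of_lipschitz dense_univ
    (fun i x y => by rw [dist_eq_norm]; exact hlip i x y)
    (fun x y => by rw [dist_eq_norm]; exact hlip₀ x y) (fun x _ => hlim x)
    (isCompact_closedBall (0 : StateSpace n) M)
  filter_upwards [Metric.tendstoUniformlyOn_iff.mp hunif (min δ 1) (by positivity)] with i hi
  have hball : ∀ q, ‖q‖ ≤ M → |h₀ q - h i q| ≤ min δ 1 := by
    intro q hq
    have := hi q (by simpa using hq)
    rw [Real.dist_eq] at this
    exact this.le
  obtain ⟨w', hw', hd⟩ := exists_mem_conjEpi_dist_le (z := w) (hconv i)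
    (continuous_of_abs_sub_le (hlip i)) hδ0.le (fun q => by
      have hm1 := min_le_left δ 1
      have hm2 := min_le_right δ 1
      rcases le_or_gt ‖q‖ M with hq | hq
      · have h1 := abs_le.mp (hball q hq)
        have h2 := hw q
        have h3 : 0 ≤ δ * ‖q‖ := by positivity
        linarith [h1.1, h1.2]
      · have hq0 : 0 < ‖q‖ := hM0.trans hq
        set l := M / ‖q‖ with hl
        have hl0 : 0 < l := by positivity
        have hl1 : l < 1 := by rw [hl, div_lt_one hq0]; exact hq
        have hlq : l * ‖q‖ = M := by rw [hl]; field_simp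
        have hn : ‖l • q‖ ≤ M := by rw [norm_smul, Real.norm_of_nonneg hl0.le, hlq]
        have h1 := abs_le.mp (hball (l • q) hn)
        have h2 := hw (l • q)
        have h3 := (hconv i).2 (mem_univ 0) (mem_univ q) (by linarith : (0 : ℝ) ≤ 1 - l) hl0.le
          (by ring)
        have h4 := abs_le.mp (hball 0 (by simpa using hM0.le))
        rw [smul_zero, zero_add, smul_eq_mul, smul_eq_mul] at h3
        rw [inner_smul_right] at h2
        have h5 : l * (inner ℝ w.fst q - w.snd - h i q) ≤ A := by
          have e1 : (1 - l) * w.snd ≤ |w.snd| := by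
            nlinarith [le_abs_self w.snd, abs_nonneg w.snd]
          have e2 : (1 - l) * h i 0 ≤ |h₀ 0| + 1 := by
            have : h i 0 ≤ |h₀ 0| + 1 := by linarith [le_abs_self (h₀ 0), h4.1]
            nlinarith [abs_nonneg (h₀ 0)]
          linarith [h1.1, h1.2]
        have h6 : l * (inner ℝ w.fst q - w.snd - h i q) ≤ l * (δ * ‖q‖) := by
          have : l * (δ * ‖q‖) = A := by rw [mul_left_comm, hlq, mul_comm, hMδ]
          rw [this]; exact h5
        have h7 := le_of_mul_le_mul_left h6 hl0
        linarith)
  exact (Metric.infDist_le_dist_of_mem hw').trans (by rw [hδ] at hd; linarith)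

/-- Points of the limit epigraph are approximated by the preceding lemma, which bounds the distances
from above. Conversely, if the distances dropped along a subsequence, nearest points would
subconverge, and their limit would satisfy every inequality of the limit epigraph while lying too
close to z. -/
theorem tendsto_infDist_conjEpi {h : ℕ → StateSpace n → ℝ} {h₀ : StateSpace n → ℝ} {C : ℝ}
    (hconv : ∀ i, ConvexOn ℝ univ (h i)) (hconv₀ : ConvexOn ℝ univ h₀)
    (hlip : ∀ i p q, |h i p - h i q| ≤ C * ‖p - q‖)
    (hlip₀ : ∀ p q, |h₀ p - h₀ q| ≤ C * ‖p - q‖)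
    (hlim : ∀ q, Tendsto (fun i => h i q) atTop (𝓝 (h₀ q))) (z : EpiSpace n) :
    Tendsto (fun i => Metric.infDist z (conjEpi (h i))) atTop
      (𝓝 (Metric.infDist z (conjEpi h₀))) := by
  set d := Metric.infDist z (conjEpi h₀) with hd
  have hne₀ := nonempty_conjEpi hconv₀ hlip₀ (continuous_of_abs_sub_le hlip₀)
  have hupper : ∀ ε > 0, ∀ᶠ i in atTop, Metric.infDist z (conjEpi (h i)) ≤ d + ε := by
    intro ε hε
    obtain ⟨w, hw, hwd⟩ := (isClosed_conjEpi h₀).exists_infDist_eq_dist hne₀ z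
    filter_upwards [eventually_infDist_conjEpi_le hconv hlip hlip₀ hlim hw hε] with i hi
    have := Metric.infDist_le_infDist_add_dist (s := conjEpi (h i)) (x := z) (y := w)
    rw [← hwd] at this
    linarith
  have hlower : ∀ ε > 0, ∀ᶠ i in atTop, d - ε ≤ Metric.infDist z (conjEpi (h i)) := by
    intro ε hε
    by_contra hcon
    rw [not_eventually] at hcon
    obtain ⟨φ, hφ, hφs⟩ := extraction_of_frequently_atTop hcon
    have hch : ∀ k, ∃ w ∈ conjEpi (h (φ k)), dist w z ≤ d - ε := by
      intro k
      obtain ⟨w, hw, hwd⟩ := (isClosed_conjEpi (h (φ k))).exists_infDist_eq_dist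
        (nonempty_conjEpi (hconv _) (hlip _) (continuous_of_abs_sub_le (hlip _))) z
      refine ⟨w, hw, ?_⟩
      have := hφs k
      push Not at this
      rw [dist_comm, ← hwd]
      exact this.le
    choose w hw hwz using hch
    obtain ⟨w₀, hw₀, ψ, hψ, hlimw⟩ := (isCompact_closedBall z (d - ε)).tendsto_subseq
      (x := w) (fun k => hwz k)
    have hmem : w₀ ∈ conjEpi h₀ := by
      intro q
      refine le_of_tendsto_of_tendsto (b := atTop)
        (f := fun k => inner ℝ (w (ψ k)).fst q - h (φ (ψ k)) q) (g := fun k => (w (ψ k)).snd)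
        ?_ ?_ (Eventually.of_forall fun k => hw (ψ k) q)
      · refine Tendsto.sub ?_ ((hlim q).comp (hφ.comp hψ).tendsto_atTop)
        exact ((continuous_epiSpace_fst.tendsto w₀).comp hlimw).inner tendsto_const_nhds
      · exact (continuous_epiSpace_snd.tendsto w₀).comp hlimw
    have h1 := Metric.infDist_le_dist_of_mem (x := z) hmem
    have h2 : dist w₀ z ≤ d - ε := hw₀
    rw [dist_comm] at h2
    linarith
  rw [Metric.tendsto_nhds]
  intro ε hε
  filter_upwards [hupper (ε / 2) (by positivity), hlower (ε / 2) (by positivity)] with i h1 h2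
  rw [Real.dist_eq, abs_lt]
  constructor <;> linarith

end Epigraph

/-! ### The parametrization of an epigraph by Steiner points -/

section EpiPoint

variable {n : ℕ}

/-- The Steiner point of the part near `y` of the epigraph of the conjugate of `h`. -/
noncomputable def epiPoint (h : StateSpace n → ℝ) (y : EpiSpace n) : EpiSpace n :=
  steinerPoint (nearPart y (conjEpi h))

instance : Nontrivial (EpiSpace n) :=
  ⟨⟨WithLp.toLp 2 (0, 0), WithLp.toLp 2 (0, 1), fun h => by
    have : (0 : ℝ) = 1 := congrArg (fun z : EpiSpace n => z.snd) h
    exact zero_ne_one this⟩⟩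

theorem epiParam_eq (c : ℝ → ℝ) (lam : ℝ → StateSpace n → ℝ)
    (H : ℝ → StateSpace n → StateSpace n → ℝ) (t : ℝ) (x : StateSpace n) (a : EpiSpace n) :
    epiParam c lam H t x a = epiPoint (H t x) (repRadius c lam H t x • a) := by
  rw [epiParam, epiPoint, lagrangianEpigraph_eq]

/-- At distance zero the near part collapses to a point. This is what makes the parametrization
onto. -/
theorem epiPoint_of_mem {h : StateSpace n → ℝ} {y : EpiSpace n} (hy : y ∈ conjEpi h) :
    epiPoint h y = y := by
  rw [epiPoint, nearPart_of_mem hy, steinerPoint_singleton]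

theorem epiPoint_mem {h : StateSpace n → ℝ} (hconv : ConvexOn ℝ univ h) {C : ℝ}
    (hlip : ∀ p q, |h p - h q| ≤ C * ‖p - q‖) (y : EpiSpace n) :
    epiPoint h y ∈ nearPart y (conjEpi h) :=
  steinerPoint_nearPart_mem (isClosed_conjEpi h) (convex_conjEpi h)
    (nonempty_conjEpi hconv hlip (continuous_of_abs_sub_le hlip)) y

theorem norm_epiPoint_sub_le {h h' : StateSpace n → ℝ} (hconv : ConvexOn ℝ univ h) {C C' : ℝ}
    (hlip : ∀ p q, |h p - h q| ≤ C * ‖p - q‖) (hconv' : ConvexOn ℝ univ h')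
    (hlip' : ∀ p q, |h' p - h' q| ≤ C' * ‖p - q‖) {κ : ℝ} (hκ : 0 ≤ κ)
    (hhh : ∀ q, |h q - h' q| ≤ κ * (1 + ‖q‖)) (y y' : EpiSpace n) :
    ‖epiPoint h y - epiPoint h' y'‖ ≤
      Module.finrank ℝ (EpiSpace n) * (10 * (2 * κ + dist y y')) := by
  have hcont := continuous_of_abs_sub_le hlip
  have hcont' := continuous_of_abs_sub_le hlip'
  have hne := nonempty_conjEpi hconv hlip hcont
  have hne' := nonempty_conjEpi hconv' hlip' hcont'
  exact norm_steinerPoint_nearPart_sub_le (isClosed_conjEpi h) (convex_conjEpi h) hne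
    (isClosed_conjEpi h') (convex_conjEpi h') hne'
    (fun z _ => abs_infDist_conjEpi_sub_le hconv hcont hne hconv' hcont' hne' hκ hhh z)
    (le_max_left _ _) (le_max_right _ _)

/-- The distance functions are 1-Lipschitz, so their pointwise convergence is uniform on a ball
containing all the relevant near parts; the Lipschitz estimate for Steiner points then applies. -/
theorem tendsto_epiPoint {h : ℕ → StateSpace n → ℝ} {h₀ : StateSpace n → ℝ} {C : ℝ}
    (hconv : ∀ i, ConvexOn ℝ univ (h i)) (hconv₀ : ConvexOn ℝ univ h₀)
    (hlip : ∀ i p q, |h i p - h i q| ≤ C * ‖p - q‖)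
    (hlip₀ : ∀ p q, |h₀ p - h₀ q| ≤ C * ‖p - q‖)
    (hlim : ∀ q, Tendsto (fun i => h i q) atTop (𝓝 (h₀ q))) {y : ℕ → EpiSpace n}
    {y₀ : EpiSpace n} (hy : Tendsto y atTop (𝓝 y₀)) :
    Tendsto (fun i => epiPoint (h i) (y i)) atTop (𝓝 (epiPoint h₀ y₀)) := by
  have hdist := tendsto_infDist_conjEpi hconv hconv₀ hlip hlip₀ hlim
  have hyd : Tendsto (fun i => dist (y i) y₀) atTop (𝓝 0) := tendsto_iff_dist_tendsto_zero.mp hy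
  have hyi : Tendsto (fun i => Metric.infDist (y i) (conjEpi (h i))) atTop
      (𝓝 (Metric.infDist y₀ (conjEpi h₀))) := by
    refine (hdist y₀).congr_dist (squeeze_zero (fun _ => dist_nonneg) (fun i => ?_) hyd)
    rw [Real.dist_eq, dist_comm]
    simpa using abs_infDist_sub_infDist_le (conjEpi (h i)) y₀ (y i)
  set R := ‖y₀‖ + 2 * Metric.infDist y₀ (conjEpi h₀) + 1 with hR
  have hRev : ∀ᶠ i in atTop, ‖y i‖ + 2 * Metric.infDist (y i) (conjEpi (h i)) < R :=
    (hy.norm.add (hyi.const_mul 2)).eventually_lt_const (by rw [hR]; linarith)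
  have hunif := tendstoUniformlyOn_of_lipschitz dense_univ
    (fun i => abs_infDist_sub_infDist_le (conjEpi (h i)))
    (abs_infDist_sub_infDist_le (conjEpi h₀)) (fun z _ => hdist z)
    (isCompact_closedBall (0 : EpiSpace n) R)
  set m : ℝ := (Module.finrank ℝ (EpiSpace n) : ℝ) with hm
  have hm0 : 0 ≤ m := Nat.cast_nonneg _
  rw [Metric.tendsto_nhds]
  intro ε hε
  set δ := ε / (20 * (m + 1)) with hδ
  have hδ0 : 0 < δ := by positivity
  have hmδ : 20 * (m + 1) * δ = ε := by rw [hδ]; field_simp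
  filter_upwards [hRev, Metric.tendstoUniformlyOn_iff.mp hunif δ hδ0,
    hyd.eventually_lt_const hδ0] with i h1 h2 h3
  have hb := norm_steinerPoint_nearPart_sub_le (isClosed_conjEpi (h i)) (convex_conjEpi (h i))
    (nonempty_conjEpi (hconv i) (hlip i) (continuous_of_abs_sub_le (hlip i)))
    (isClosed_conjEpi h₀) (convex_conjEpi h₀)
    (nonempty_conjEpi hconv₀ hlip₀ (continuous_of_abs_sub_le hlip₀)) (y := y i) (y' := y₀)
    (R := R) (ε := δ) (fun z hz => by
      have := h2 z (by simpa using hz)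
      rw [dist_comm, Real.dist_eq] at this
      exact this.le) h1.le (by rw [hR]; linarith)
  rw [dist_eq_norm]
  refine lt_of_le_of_lt hb ?_
  rw [← hm]
  nlinarith

/-- A convex N-Lipschitz function is encoded by its values on a dense sequence. By
`tendsto_epiPoint`, the Steiner point depends continuously on this code and on y, so measurability
reduces to that of countably many functions h(·,q) and of y. -/
theorem aemeasurable_epiPoint {α : Type*} [MeasurableSpace α] {μ : Measure α}
    {h : α → StateSpace n → ℝ} {c : α → ℝ} {y : α → EpiSpace n}
    (hh : ∀ q, AEMeasurable (fun t => h t q) μ) (hc : AEMeasurable c μ) (hy : AEMeasurable y μ)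
    (hconv : ∀ᵐ t ∂μ, ConvexOn ℝ univ (h t))
    (hlip : ∀ᵐ t ∂μ, ∀ p q, |h t p - h t q| ≤ c t * ‖p - q‖) :
    AEMeasurable (fun t => epiPoint (h t) (y t)) μ := by
  classical
  -- Continuity of the encoded map needs one Lipschitz constant, so the time set is cut into the
  -- countably many pieces where c ≤ N.
  have huniv : (⋃ N : ℕ, {t | c t ≤ N}) = univ :=
    eq_univ_of_forall fun t => mem_iUnion.mpr (exists_nat_ge (c t))
  rw [← Measure.restrict_univ (μ := μ), ← huniv, aemeasurable_iUnion_iff]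
  intro N
  set ν := μ.restrict {t | c t ≤ N} with hν
  have hνμ : ν ≤ μ := Measure.restrict_le_self
  set G : (StateSpace n → ℝ) → Prop := fun f =>
    ConvexOn ℝ univ f ∧ ∀ p q, |f p - f q| ≤ (N : ℝ) * ‖p - q‖ with hG
  have hG0 : G 0 := ⟨convexOn_const 0 convex_univ, fun p q => by simp; positivity⟩
  have hcN : NullMeasurableSet {t | c t ≤ N} μ :=
    nullMeasurableSet_le hc aemeasurable_const
  have hgood : ∀ᵐ t ∂ν, G (h t) := by
    filter_upwards [ae_mono hνμ hconv, ae_mono hνμ hlip, ae_restrict_mem₀ hcN] with t h1 h2 h3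
    exact ⟨h1, fun p q => (h2 p q).trans (mul_le_mul_of_nonneg_right h3 (norm_nonneg _))⟩
  -- Replacing h by 0 at exceptional times puts every code in S, so the composition can be formed
  -- through the subtype.
  set h' : α → StateSpace n → ℝ := fun t => if G (h t) then h t else 0 with hh'
  have hG' : ∀ t, G (h' t) := by
    intro t
    simp only [hh']
    split_ifs with hg
    · exact hg
    · exact hG0
  have heq : ∀ᵐ t ∂ν, h t = h' t := by
    filter_upwards [hgood] with t ht
    simp [hh', ht]
  set d := TopologicalSpace.denseSeq (StateSpace n) with hd
  set S : Set (ℕ → ℝ) := {b | ∃ f, G f ∧ ∀ j, f (d j) = b j} with hS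
  choose F hFG hFd using fun b : S => b.2
  set Ψ : S × EpiSpace n → EpiSpace n := fun w => epiPoint (F w.1) w.2 with hΨ
  have hΨc : Continuous Ψ := by
    refine continuous_iff_seqContinuous.mpr fun w w₀ hw => ?_
    have hw1 : Tendsto (fun i => (w i).1) atTop (𝓝 w₀.1) := (continuous_fst.tendsto w₀).comp hw
    have hw2 : Tendsto (fun i => (w i).2) atTop (𝓝 w₀.2) := (continuous_snd.tendsto w₀).comp hw
    refine tendsto_epiPoint (fun i => (hFG _).1) (hFG _).1 (fun i => (hFG _).2) (hFG _).2 ?_ hw2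
    refine tendsto_of_lipschitz (TopologicalSpace.denseRange_denseSeq (StateSpace n))
      (fun i x y => by rw [dist_eq_norm]; exact (hFG _).2 x y)
      (fun x y => by rw [dist_eq_norm]; exact (hFG _).2 x y) ?_
    rintro _ ⟨j, rfl⟩
    simp only [← hd, hFd]
    have := (continuous_subtype_val.tendsto w₀.1).comp hw1
    exact (tendsto_pi_nhds.mp this) j
  have hbS : ∀ t, (fun j => h' t (d j)) ∈ S := fun t => ⟨h' t, hG' t, fun _ => rfl⟩
  have hb : AEMeasurable (fun t j => h' t (d j)) ν := by
    refine aemeasurable_pi_iff.mpr fun j => ?_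
    refine ((hh (d j)).mono_measure hνμ).congr ?_
    filter_upwards [heq] with t ht
    rw [ht]
  have hmeas : AEMeasurable (fun t => Ψ (⟨_, hbS t⟩, y t)) ν :=
    hΨc.measurable.comp_aemeasurable
      ((hb.subtype_mk (hfs := hbS)).prodMk (hy.mono_measure hνμ))
  refine hmeas.congr ?_
  filter_upwards [heq] with t ht
  have hF : F ⟨_, hbS t⟩ = h' t := by
    refine Continuous.ext_on (TopologicalSpace.denseRange_denseSeq (StateSpace n))
      (continuous_of_abs_sub_le (hFG _).2) (continuous_of_abs_sub_le (hG' t).2) ?_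
    rintro _ ⟨j, rfl⟩
    exact hFd ⟨_, hbS t⟩ j
  simp only [hΨ, hF, ht]

end EpiPoint

/-! ### Superposition with measurable functions -/

section Caratheodory

/-- For a simple function in place of u the claim holds piecewise; continuity in the second variable
carries it to the limit of simple approximations. -/
theorem aestronglyMeasurable_superposition {α X Y : Type*} [MeasurableSpace α] {μ : Measure α}
    [TopologicalSpace X] [TopologicalSpace Y] [TopologicalSpace.PseudoMetrizableSpace Y]
    {F : α → X → Y} {u : α → X} (hF : ∀ x, AEStronglyMeasurable (fun t => F t x) μ)
    (hc : ∀ᵐ t ∂μ, Continuous (F t)) (hu : AEStronglyMeasurable u μ) :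
    AEStronglyMeasurable (fun t => F t (u t)) μ := by
  classical
  set v := hu.mk u with hv
  have hvm : StronglyMeasurable v := hu.stronglyMeasurable_mk
  have key : AEStronglyMeasurable (fun t => F t (v t)) μ := by
    refine aestronglyMeasurable_of_tendsto_ae (u := atTop)
      (f := fun (k : ℕ) t => F t (hvm.approx k t)) (fun k => ?_) ?_
    · set s := hvm.approx k
      have hcover : (⋃ x : s.range, s ⁻¹' {(x : X)}) = univ :=
        eq_univ_of_forall fun t => mem_iUnion.mpr ⟨⟨s t, s.mem_range_self t⟩, rfl⟩
      rw [← Measure.restrict_univ (μ := μ), ← hcover, aestronglyMeasurable_iUnion_iff]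
      intro x
      refine ((hF x).mono_measure Measure.restrict_le_self).congr ?_
      filter_upwards [ae_restrict_mem (s.measurableSet_fiber x)] with t ht
      have : s t = x := ht
      rw [this]
    · filter_upwards [hc] with t ht
      exact (ht.tendsto _).comp (hvm.tendsto_approx t)
  refine key.congr ?_
  filter_upwards [hu.ae_eq_mk] with t ht
  rw [ht]

end Caratheodory

/-! ### Integral inequalities with integrable coefficients -/

section Gronwall

/-- Powers of the primitive are absolutely continuous, so the fundamental theorem of calculus
applies to them although K is merely integrable. -/
theorem integral_mul_primitive_pow {K : ℝ → ℝ} (hK : Integrable K) (τ t : ℝ) (k : ℕ) :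
    ∫ s in τ..t, K s * (∫ r in τ..s, K r) ^ k = (∫ r in τ..t, K r) ^ (k + 1) / (k + 1) := by
  have hKi : IntervalIntegrable K volume τ t := hK.intervalIntegrable
  have hac : AbsolutelyContinuousOnInterval (fun s => ∫ r in τ..s, K r) τ t :=
    hKi.absolutelyContinuousOnInterval_intervalIntegral left_mem_uIcc
  have hacp : ∀ j : ℕ,
      AbsolutelyContinuousOnInterval (fun s => (∫ r in τ..s, K r) ^ (j + 1)) τ t := by
    intro j
    induction j with
    | zero => simpa using hac
    | succ j ih =>
      have := ih.fun_mul hac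
      simpa only [← pow_succ] using this
  have h1 := (hacp k).integral_deriv_eq_sub
  have h2 : ∫ s in τ..t, deriv (fun s => (∫ r in τ..s, K r) ^ (k + 1)) s =
      ∫ s in τ..t, ((k : ℝ) + 1) * (K s * (∫ r in τ..s, K r) ^ k) := by
    refine intervalIntegral.integral_congr_ae ?_
    filter_upwards [hKi.ae_hasDerivAt_integral] with s hs hsm
    have hd := (hs (uIoc_subset_uIcc hsm) τ left_mem_uIcc).fun_pow (k + 1)
    rw [hd.deriv]
    push_cast
    ring
  rw [h2, intervalIntegral.integral_const_mul] at h1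
  have hk : ((k : ℝ) + 1) ≠ 0 := by positivity
  rw [eq_div_iff hk, mul_comm, h1]
  simp

/-- The unoriented form serves times on both sides of the base point τ, as needed for equations
solved backward from T. -/
theorem setIntegral_uIoc_mul_pow {K : ℝ → ℝ} (hK : Integrable K) (τ t : ℝ) (k : ℕ) :
    ∫ s in uIoc τ t, K s * (∫ r in uIoc τ s, K r) ^ k =
      (∫ r in uIoc τ t, K r) ^ (k + 1) / (k + 1) := by
  have h := integral_mul_primitive_pow hK τ t k
  rcases le_total τ t with hle | hle
  · rw [uIoc_of_le hle]
    rw [intervalIntegral.integral_of_le hle, intervalIntegral.integral_of_le hle] at h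
    rw [← h]
    refine setIntegral_congr_fun measurableSet_Ioc fun s hs => ?_
    simp only [intervalIntegral.integral_of_le hs.1.le, uIoc_of_le hs.1.le]
  · rw [uIoc_of_ge hle]
    rw [intervalIntegral.integral_of_ge hle, intervalIntegral.integral_of_ge hle] at h
    have h2 : ∫ s in Ioc t τ, K s * (∫ r in uIoc τ s, K r) ^ k =
        ∫ s in Ioc t τ, (-1) ^ k * (K s * (∫ r in τ..s, K r) ^ k) := by
      refine setIntegral_congr_fun measurableSet_Ioc fun s hs => ?_
      simp only [intervalIntegral.integral_of_ge hs.2, uIoc_of_ge hs.2]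
      rw [mul_left_comm, ← mul_pow]
      simp
    rw [h2, integral_const_mul]
    have h3 : ∫ s in Ioc t τ, K s * (∫ r in τ..s, K r) ^ k =
        - ((-∫ r in Ioc t τ, K r) ^ (k + 1) / (k + 1)) := by linarith
    rw [h3, neg_pow (∫ r in Ioc t τ, K r)]
    have h4 : ((-1 : ℝ) ^ k) * (-1) ^ k = 1 := by rw [← mul_pow]; simp
    rw [pow_succ (-1 : ℝ) k]
    linear_combination ((∫ r in Ioc t τ, K r) ^ (k + 1) / (k + 1)) * h4

theorem continuous_integral_uIoc {K : ℝ → ℝ} (hK : Integrable K) (hK0 : ∀ s, 0 ≤ K s) (τ : ℝ) :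
    Continuous fun t => ∫ s in uIoc τ t, K s := by
  have h : (fun t => ∫ s in uIoc τ t, K s) = fun t => |∫ s in τ..t, K s| := by
    ext t
    rw [intervalIntegral.abs_integral_eq_abs_integral_uIoc, abs_of_nonneg]
    exact integral_nonneg hK0
  rw [h]
  exact (hK.continuous_primitive τ).abs

theorem integral_uIoc_nonneg {K : ℝ → ℝ} (hK0 : ∀ s, 0 ≤ K s) (τ t : ℝ) :
    0 ≤ ∫ s in uIoc τ t, K s :=
  integral_nonneg hK0

theorem integral_uIoc_le_integral {K : ℝ → ℝ} (hK : Integrable K) (hK0 : ∀ s, 0 ≤ K s) (τ t : ℝ) :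
    ∫ s in uIoc τ t, K s ≤ ∫ s, K s :=
  setIntegral_le_integral hK (ae_of_all _ hK0)

theorem uIoc_subset_Icc {a b τ t : ℝ} (hτ : τ ∈ Icc a b) (ht : t ∈ Icc a b) :
    uIoc τ t ⊆ Icc a b :=
  uIoc_subset_uIcc.trans (uIcc_subset_Icc hτ ht)

/-- **Grönwall's inequality** with an integrable coefficient and an arbitrary base point. -/
theorem le_mul_exp_of_le_add_integral {K φ : ℝ → ℝ} (hK : Integrable K) (hK0 : ∀ s, 0 ≤ K s)
    {A a b τ : ℝ} (hA : 0 ≤ A) (hτ : τ ∈ Icc a b) (hφ : ContinuousOn φ (Icc a b))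
    (h : ∀ t ∈ Icc a b, φ t ≤ A + ∫ s in uIoc τ t, K s * φ s) :
    ∀ t ∈ Icc a b, φ t ≤ A * Real.exp (∫ s in uIoc τ t, K s) := by
  obtain ⟨M, hM⟩ := isCompact_Icc.exists_bound_of_continuousOn hφ
  have hM0 : 0 ≤ M := (norm_nonneg _).trans (hM τ hτ)
  set κ : ℝ → ℝ := fun t => ∫ s in uIoc τ t, K s with hκ
  have hκc : Continuous κ := continuous_integral_uIoc hK hK0 τ
  -- Substituting the inequality into itself k times produces the partial exponential sum; the crude
  -- bound M on φ leaves a remainder that tends to zero.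
  have hiter : ∀ k : ℕ, ∀ t ∈ Icc a b,
      φ t ≤ A * ∑ j ∈ Finset.range k, κ t ^ j / j.factorial + M * (κ t ^ k / k.factorial) := by
    intro k
    induction k with
    | zero =>
      intro t ht
      simpa using (le_abs_self _).trans (hM t ht)
    | succ k ih =>
      intro t ht
      have hsub := uIoc_subset_Icc hτ ht
      have hint : ∀ {ψ : ℝ → ℝ}, ContinuousOn ψ (Icc a b) →
          IntegrableOn (fun s => K s * ψ s) (uIoc τ t) := fun hψ =>
        hK.integrableOn.mul_continuousOn_of_subset hψ measurableSet_uIoc isCompact_Icc hsub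
      have hpow : ∀ j : ℕ, ∫ s in uIoc τ t, K s * (κ s ^ j / j.factorial) =
          κ t ^ (j + 1) / (j + 1).factorial := by
        intro j
        have e1 : ∀ s, K s * (κ s ^ j / j.factorial) = (j.factorial : ℝ)⁻¹ * (K s * κ s ^ j) := by
          intro s; ring
        simp_rw [e1]
        rw [integral_const_mul, setIntegral_uIoc_mul_pow hK τ t j, Nat.factorial_succ]
        push_cast
        field_simp
        rfl
      have hle : ∫ s in uIoc τ t, K s * φ s ≤ ∫ s in uIoc τ t,
          K s * (A * ∑ j ∈ Finset.range k, κ s ^ j / j.factorial +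
            M * (κ s ^ k / k.factorial)) := by
        refine setIntegral_mono_on (hint hφ) (hint (by fun_prop)) measurableSet_uIoc fun s hs => ?_
        exact mul_le_mul_of_nonneg_left (ih s (hsub hs)) (hK0 s)
      have heq : ∫ s in uIoc τ t, K s * (A * ∑ j ∈ Finset.range k, κ s ^ j / j.factorial +
            M * (κ s ^ k / k.factorial)) =
          A * ∑ j ∈ Finset.range k, κ t ^ (j + 1) / (j + 1).factorial +
            M * (κ t ^ (k + 1) / (k + 1).factorial) := by
        have e1 : ∀ s, K s * (A * ∑ j ∈ Finset.range k, κ s ^ j / j.factorial +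
            M * (κ s ^ k / k.factorial)) =
            A * ∑ j ∈ Finset.range k, K s * (κ s ^ j / j.factorial) +
              M * (K s * (κ s ^ k / k.factorial)) := by
          intro s
          rw [← Finset.mul_sum]; ring
        simp_rw [e1]
        have hi : ∀ j : ℕ, IntegrableOn (fun s => K s * (κ s ^ j / j.factorial)) (uIoc τ t) :=
          fun j => hint (by fun_prop)
        rw [integral_add, integral_const_mul, integral_const_mul,
          integral_finsetSum _ (fun j _ => hi j), hpow k, Finset.sum_congr rfl (fun j _ => hpow j)]
        · exact (integrable_finsetSum _ (fun j _ => hi j)).const_mul A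
        · exact (hi k).const_mul M
      have h1 := h t ht
      rw [Finset.sum_range_succ']
      simp only [pow_zero, Nat.factorial_zero, Nat.cast_one, div_one]
      linarith
  intro t ht
  have hκ0 : 0 ≤ κ t := integral_uIoc_nonneg hK0 τ t
  have hlim : Tendsto (fun k : ℕ => A * Real.exp (κ t) + M * (κ t ^ k / k.factorial)) atTop
      (𝓝 (A * Real.exp (κ t) + M * 0)) :=
    tendsto_const_nhds.add ((FloorSemiring.tendsto_pow_div_factorial_atTop (κ t)).const_mul M)
  rw [mul_zero, add_zero] at hlim
  refine ge_of_tendsto hlim (Eventually.of_forall fun k => (hiter k t ht).trans ?_)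
  have := mul_le_mul_of_nonneg_left (Real.sum_le_exp_of_nonneg hκ0 k) hA
  linarith

end Gronwall

/-! ### Differential equations with integrable Lipschitz constants -/

section Picard

variable {X : Type*} [NormedAddCommGroup X] [NormedSpace ℝ X] [CompleteSpace X]

/-- **Picard-Lindelöf** for right-hand sides that are measurable in time and globally Lipschitz in
the state, with an integrable Lipschitz constant. -/
theorem exists_eq_add_integral {F : ℝ → X → X} {K m : ℝ → ℝ} (hK : Integrable K)
    (hK0 : ∀ s, 0 ≤ K s) (hm : Integrable m)
    (hmeas : ∀ x : ℝ → X, Continuous x → AEStronglyMeasurable (fun s => F s (x s)))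
    (hlip : ∀ s x y, ‖F s x - F s y‖ ≤ K s * ‖x - y‖)
    (hbd : ∀ᵐ s, ∀ x, ‖F s x‖ ≤ m s) {a b τ : ℝ} (hτ : τ ∈ Icc a b) (z : X) :
    ∃ x : ℝ → X, Continuous x ∧ ∀ t ∈ Icc a b, x t = z + ∫ s in τ..t, F s (x s) := by
  have hab : a ≤ b := hτ.1.trans hτ.2
  have hint : ∀ x : ℝ → X, Continuous x → Integrable (fun s => F s (x s)) := fun x hx =>
    hm.mono' (hmeas x hx) (by filter_upwards [hbd] with s hs using hs _)
  have hext : ∀ x : C(Icc a b, X), Continuous fun s => x (projIcc a b hab s) := fun x =>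
    x.continuous.comp continuous_projIcc
  set P : C(Icc a b, X) → C(Icc a b, X) := fun x =>
    ⟨fun t => z + ∫ s in τ..(t : ℝ), F s (x (projIcc a b hab s)),
      continuous_const.add (((hint _ (hext x)).continuous_primitive τ).comp
        continuous_subtype_val)⟩ with hP
  have hPt : ∀ x t, P x t = z + ∫ s in τ..(t : ℝ), F s (x (projIcc a b hab s)) := fun x t => rfl
  set κ : ℝ → ℝ := fun t => ∫ s in uIoc τ t, K s with hκ
  have hκc : Continuous κ := continuous_integral_uIoc hK hK0 τ
  -- The Picard operator itself need not contract in the uniform norm, but its iterates gain a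
  -- factorial.
  have hiter : ∀ (k : ℕ) (x y : C(Icc a b, X)) (t : Icc a b),
      ‖(P^[k] x) t - (P^[k] y) t‖ ≤ κ t ^ k / k.factorial * dist x y := by
    intro k
    induction k with
    | zero =>
      intro x y t
      simpa [dist_eq_norm] using ContinuousMap.dist_apply_le_dist (f := x) (g := y) t
    | succ k ih =>
      intro x y t
      rw [Function.iterate_succ_apply', Function.iterate_succ_apply', hPt, hPt,
        add_sub_add_left_eq_sub, ← intervalIntegral.integral_sub
          (hint _ (hext _)).intervalIntegrable (hint _ (hext _)).intervalIntegrable]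
      refine intervalIntegral.norm_integral_le_integral_norm_uIoc.trans ?_
      have hsub := uIoc_subset_Icc hτ t.2
      have hle : ∫ s in uIoc τ (t : ℝ), ‖F s ((P^[k] x) (projIcc a b hab s)) -
          F s ((P^[k] y) (projIcc a b hab s))‖ ≤
          ∫ s in uIoc τ (t : ℝ), ((k.factorial : ℝ)⁻¹ * dist x y) * (K s * κ s ^ k) := by
        refine setIntegral_mono_on ((hint _ (hext _)).sub (hint _ (hext _))).norm.integrableOn
          ?_ measurableSet_uIoc fun s hs => ?_
        · exact (hK.integrableOn.mul_continuousOn_of_subset (hκc.pow k).continuousOn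
            measurableSet_uIoc isCompact_Icc hsub).const_mul _
        · refine (hlip _ _ _).trans ?_
          have h1 := ih x y (projIcc a b hab s)
          rw [projIcc_of_mem hab (hsub hs)] at h1 ⊢
          calc K s * _ ≤ K s * (κ s ^ k / k.factorial * dist x y) :=
                mul_le_mul_of_nonneg_left h1 (hK0 s)
            _ = _ := by ring
      refine hle.trans (le_of_eq ?_)
      rw [integral_const_mul, setIntegral_uIoc_mul_pow hK τ t k, Nat.factorial_succ]
      push_cast
      field_simp
      rfl
  set I := ∫ s, K s with hI
  have hI0 : 0 ≤ I := integral_nonneg hK0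
  obtain ⟨k, hk⟩ : ∃ k : ℕ, I ^ k / k.factorial < 1 :=
    ((FloorSemiring.tendsto_pow_div_factorial_atTop I).eventually_lt_const one_pos).exists
  have hq0 : 0 ≤ I ^ k / k.factorial := by positivity
  have hcontr : ContractingWith ⟨I ^ k / k.factorial, hq0⟩ P^[k] := by
    refine ⟨hk, LipschitzWith.of_dist_le_mul fun x y => ?_⟩
    refine (ContinuousMap.dist_le (by positivity)).mpr fun t => ?_
    rw [dist_eq_norm]
    refine (hiter k x y t).trans (mul_le_mul_of_nonneg_right ?_ dist_nonneg)
    change κ t ^ k / k.factorial ≤ I ^ k / k.factorial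
    have h1 : κ t ≤ I := integral_uIoc_le_integral hK hK0 τ t
    have h0 : 0 ≤ κ t := integral_uIoc_nonneg hK0 τ t
    gcongr
  have hfix := hcontr.isFixedPt_fixedPoint_iterate
  set x := ContractingWith.fixedPoint P^[k] hcontr
  refine ⟨fun s => x (projIcc a b hab s), hext x, fun t ht => ?_⟩
  have h1 := hPt x ⟨t, ht⟩
  rw [hfix] at h1
  change x (projIcc a b hab t) = _
  rw [projIcc_of_mem hab ht]
  exact h1

end Picard

/-! ### Absolutely continuous arcs -/

section Arcs

variable {X : Type*} [NormedAddCommGroup X] [NormedSpace ℝ X]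

/-- Unlike absolute continuity, domination of the increments by a fixed integrable m passes to
pointwise limits, so it is the working form of absolute continuity for limit arcs. -/
theorem absolutelyContinuousOnInterval_of_norm_sub_le {f : ℝ → X} {m : ℝ → ℝ}
    (hm : Integrable m) {a b : ℝ} (hab : a ≤ b)
    (h : ∀ s ∈ Icc a b, ∀ t ∈ Icc a b, s ≤ t → ‖f t - f s‖ ≤ ∫ r in s..t, m r) :
    AbsolutelyContinuousOnInterval f a b := by
  have hac := (hm.intervalIntegrable (a := a)
    (b := b)).absolutelyContinuousOnInterval_intervalIntegral
    (c := a) left_mem_uIcc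
  have hd : ∀ s ∈ Icc a b, ∀ t ∈ Icc a b,
      dist (f s) (f t) ≤ dist (∫ r in a..s, m r) (∫ r in a..t, m r) := by
    have key : ∀ s ∈ Icc a b, ∀ t ∈ Icc a b, s ≤ t →
        dist (f s) (f t) ≤ dist (∫ r in a..s, m r) (∫ r in a..t, m r) := by
      intro s hs t ht hst
      rw [dist_comm, dist_eq_norm, dist_comm (∫ r in a..s, m r), Real.dist_eq,
        intervalIntegral.integral_interval_sub_left hm.intervalIntegrable hm.intervalIntegrable]
      exact (h s hs t ht hst).trans (le_abs_self _)
    intro s hs t ht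
    rcases le_total s t with hst | hst
    · exact key s hs t ht hst
    · rw [dist_comm (f s), dist_comm (∫ r in a..s, m r)]
      exact key t ht s hs hst
  refine squeeze_zero' (Eventually.of_forall fun E => Finset.sum_nonneg fun _ _ => dist_nonneg) ?_
    hac
  filter_upwards [eventually_inf_principal.mpr (Eventually.of_forall fun E hE => hE)] with E hE
  refine Finset.sum_le_sum fun i hi => ?_
  have hmem := hE.1 i hi
  rw [uIcc_of_le hab] at hmem
  exact hd _ hmem.1 _ hmem.2

theorem norm_integral_le_of_ae_norm_le {v : ℝ → X} {m : ℝ → ℝ} (hm : Integrable m) {s t : ℝ}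
    (hst : s ≤ t) (h : ∀ᵐ r, r ∈ Ioc s t → ‖v r‖ ≤ m r) :
    ‖∫ r in s..t, v r‖ ≤ ∫ r in s..t, m r :=
  intervalIntegral.norm_integral_le_of_norm_le hst h hm.intervalIntegrable

theorem absolutelyContinuousOnInterval_integral {v : ℝ → X} (hv : Integrable v) {a b : ℝ}
    (hab : a ≤ b) (τ : ℝ) :
    AbsolutelyContinuousOnInterval (fun t => ∫ r in τ..t, v r) a b := by
  refine absolutelyContinuousOnInterval_of_norm_sub_le hv.norm hab fun s _ t _ hst => ?_
  rw [intervalIntegral.integral_interval_sub_left hv.intervalIntegrable hv.intervalIntegrable]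
  exact norm_integral_le_of_ae_norm_le hv.norm hst (ae_of_all _ fun _ _ => le_rfl)

theorem AbsolutelyContinuousOnInterval.eq_add_integral [CompleteSpace X] {x v : ℝ → X} {a b : ℝ}
    (hab : a ≤ b) (hx : AbsolutelyContinuousOnInterval x a b) (hv : Integrable v)
    (hd : ∀ᵐ t, t ∈ Icc a b → HasDerivAt x (v t) t) :
    ∀ t ∈ Icc a b, x t = x a + ∫ s in a..t, v s := by
  have hac := hx.sub (absolutelyContinuousOnInterval_integral hv hab a)
  obtain ⟨C, hC⟩ := hac.const_of_ae_hasDerivAt_zero (by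
    filter_upwards [hd, (hv.intervalIntegrable (a := a) (b := b)).ae_hasDerivAt_integral]
      with t h1 h2 ht
    have h3 := (h1 (by rwa [uIcc_of_le hab] at ht)).sub (h2 ht a left_mem_uIcc)
    rw [sub_self] at h3
    exact h3)
  intro t ht
  have h1 := hC t (by rwa [uIcc_of_le hab])
  have h2 := hC a left_mem_uIcc
  simp only [Pi.sub_apply, intervalIntegral.integral_same, sub_zero] at h1 h2
  rw [h2, ← h1]
  abel

theorem ae_differentiableAt_of_norm_sub_le {X : Type*} [NormedAddCommGroup X]
    [InnerProductSpace ℝ X] [FiniteDimensional ℝ X] {f : ℝ → X} {m : ℝ → ℝ}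
    (hm : Integrable m) {a b : ℝ} (hab : a ≤ b)
    (h : ∀ s ∈ Icc a b, ∀ t ∈ Icc a b, s ≤ t → ‖f t - f s‖ ≤ ∫ r in s..t, m r) :
    ∀ᵐ t, t ∈ Icc a b → DifferentiableAt ℝ f t := by
  set e := stdOrthonormalBasis ℝ X
  have hcoord : ∀ i, ∀ᵐ t, t ∈ Icc a b → DifferentiableAt ℝ (fun s => inner ℝ (e i) (f s)) t := by
    intro i
    have hac : AbsolutelyContinuousOnInterval (fun s => inner ℝ (e i) (f s)) a b := by
      refine absolutelyContinuousOnInterval_of_norm_sub_le hm hab fun s hs t ht hst => ?_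
      rw [← inner_sub_right]
      refine (norm_inner_le_norm _ _).trans ?_
      simpa using h s hs t ht hst
    have := hac.ae_differentiableAt
    rwa [uIcc_of_le hab] at this
  filter_upwards [ae_all_iff.mpr hcoord] with t ht htm
  have hf : f = fun s => ∑ i, inner ℝ (e i) (f s) • e i := by
    ext s; exact (e.sum_repr' (f s)).symm
  rw [hf]
  exact DifferentiableAt.fun_sum fun i _ => (ht i htm).smul_const (e i)

/-- The primitive of h minus y is monotone, so its derivative is nonnegative wherever it exists.
This recovers a pointwise bound from an integrated one. -/
theorem le_of_forall_sub_le_integral {y h : ℝ → ℝ} (hh : Integrable h) {a b : ℝ} (hab : a ≤ b)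
    (hy : ∀ s ∈ Icc a b, ∀ t ∈ Icc a b, s ≤ t → y t - y s ≤ ∫ r in s..t, h r) :
    ∀ᵐ t, t ∈ Icc a b → ∀ y', HasDerivAt y y' t → y' ≤ h t := by
  have hne : ∀ᵐ t : ℝ, t ≠ a ∧ t ≠ b := by
    have h1 : ∀ᵐ t : ℝ, t ≠ a := by simp [ae_iff, measure_singleton]
    have h2 : ∀ᵐ t : ℝ, t ≠ b := by simp [ae_iff, measure_singleton]
    filter_upwards [h1, h2] with t h1 h2 using ⟨h1, h2⟩
  filter_upwards [hne, (hh.intervalIntegrable (a := a) (b := b)).ae_hasDerivAt_integral]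
    with t htne ht htm y' hy'
  have hlt : a < b := by
    rcases hab.eq_or_lt with rfl | hlt
    · exact absurd (le_antisymm htm.2 htm.1) htne.1
    · exact hlt
  have hd := (ht (by rwa [uIcc_of_le hab]) a left_mem_uIcc).sub hy'
  have hmono : MonotoneOn ((fun s => ∫ r in a..s, h r) - y) (Icc a b) := by
    intro s hs s' hs' hss
    have h1 := hy s hs s' hs' hss
    rw [← intervalIntegral.integral_interval_sub_left hh.intervalIntegrable
      hh.intervalIntegrable (a := a)] at h1
    simp only [Pi.sub_apply]
    linarith
  have h1 := hmono.derivWithin_nonneg (x := t)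
  rw [hd.hasDerivWithinAt.derivWithin (uniqueDiffOn_Icc hlt t htm)] at h1
  linarith

/-- Arzelà–Ascoli: the primitive of m is a common modulus of continuity and bounds all the arcs. -/
theorem exists_subseq_tendsto_of_norm_sub_le {X : Type*} [NormedAddCommGroup X] [ProperSpace X]
    {Z : ℕ → ℝ → X} {m : ℝ → ℝ} (hm : Integrable m) {a b C : ℝ} (hab : a ≤ b)
    (h0 : ∀ i, ‖Z i a‖ ≤ C)
    (h : ∀ i, ∀ s ∈ Icc a b, ∀ t ∈ Icc a b, s ≤ t → ‖Z i t - Z i s‖ ≤ ∫ r in s..t, m r) :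
    ∃ φ : ℕ → ℕ, StrictMono φ ∧ ∃ z : ℝ → X, ∀ t ∈ Icc a b,
      Tendsto (fun i => Z (φ i) t) atTop (𝓝 (z t)) := by
  set Φ : ℝ → ℝ := fun t => ∫ r in a..t, m r with hΦ
  have hΦc : Continuous Φ := hm.continuous_primitive a
  have hd : ∀ i, ∀ s ∈ Icc a b, ∀ t ∈ Icc a b, dist (Z i s) (Z i t) ≤ |Φ s - Φ t| := by
    have key : ∀ i, ∀ s ∈ Icc a b, ∀ t ∈ Icc a b, s ≤ t → dist (Z i s) (Z i t) ≤ |Φ s - Φ t| := by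
      intro i s hs t ht hst
      rw [dist_comm, dist_eq_norm, abs_sub_comm, hΦ,
        intervalIntegral.integral_interval_sub_left hm.intervalIntegrable hm.intervalIntegrable]
      exact (h i s hs t ht hst).trans (le_abs_self _)
    intro i s hs t ht
    rcases le_total s t with hst | hst
    · exact key i s hs t ht hst
    · rw [dist_comm, abs_sub_comm]
      exact key i t ht s hs hst
  obtain ⟨M, hM⟩ := isCompact_Icc.exists_bound_of_continuousOn (hΦc.continuousOn (s := Icc a b))
  have hcont : ∀ i, Continuous fun t : Icc a b => Z i t := by
    intro i
    rw [continuous_iff_continuousAt]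
    intro t
    refine tendsto_iff_dist_tendsto_zero.mpr ?_
    have hlim : Tendsto (fun s : Icc a b => |Φ s - Φ t|) (𝓝 t) (𝓝 |Φ t - Φ t|) :=
      (((hΦc.comp continuous_subtype_val).sub continuous_const).abs).tendsto t
    rw [sub_self, abs_zero] at hlim
    exact squeeze_zero (fun _ => dist_nonneg) (fun s => hd i s s.2 t t.2) hlim
  set f : ℕ → BoundedContinuousFunction (Icc a b) X := fun i =>
    BoundedContinuousFunction.mkOfCompact ⟨fun t => Z i t, hcont i⟩ with hf
  have hcomp := BoundedContinuousFunction.arzela_ascoli (Metric.closedBall (0 : X) (C + M))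
    (isCompact_closedBall _ _) (range f) (by
      rintro _ t ⟨i, rfl⟩
      change Z i t ∈ _
      rw [mem_closedBall_zero_iff]
      have h1 := h i a (left_mem_Icc.mpr hab) t t.2 t.2.1
      have h2 : ∫ r in a..(t : ℝ), m r ≤ M := (le_abs_self _).trans (hM t t.2)
      have h3 := norm_le_norm_add_norm_sub' (Z i t) (Z i a)
      linarith [h0 i]) (by
      intro t
      refine Metric.equicontinuousAt_of_continuity_modulus (fun s : Icc a b => |Φ t - Φ s|) ?_ _ ?_
      · have hlim : Tendsto (fun s : Icc a b => |Φ t - Φ s|) (𝓝 t) (𝓝 |Φ t - Φ t|) :=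
          ((continuous_const.sub (hΦc.comp continuous_subtype_val)).abs).tendsto t
        rwa [sub_self, abs_zero] at hlim
      · refine Eventually.of_forall ?_
        rintro s ⟨_, i, rfl⟩
        exact hd i t t.2 s s.2)
  obtain ⟨g, -, φ, hφ, hlim⟩ := hcomp.tendsto_subseq (x := f)
    (fun i => subset_closure (mem_range_self i))
  refine ⟨φ, hφ, fun t => g (projIcc a b hab t), fun t ht => ?_⟩
  change Tendsto _ _ (𝓝 (g (projIcc a b hab t)))
  rw [projIcc_of_mem hab ht]
  exact (BoundedContinuousFunction.tendsto_iff_tendstoUniformly.mp hlim).tendsto_at _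

end Arcs

/-! ### Properties of the representation -/

/-- Nonnegative integrable coefficients on `[0,T]`. -/
structure Coefficients (T : ℝ) (c : ℝ → ℝ) (k : ℝ → ℝ → ℝ) (mu : ℝ → ℝ) : Prop where
  c_nonneg : ∀ t ∈ Icc 0 T, 0 ≤ c t
  c_int : IntegrableOn c (Icc 0 T)
  k_nonneg : ∀ R > 0, ∀ t ∈ Icc 0 T, 0 ≤ k R t
  k_int : ∀ R > 0, IntegrableOn (k R) (Icc 0 T)
  mu_int : IntegrableOn mu (Icc 0 T)

/-- The pair `(H, lam)` satisfies (H1)-(H4), (HLC), (BLC), and is bounded by `mu` at the origin. -/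
structure AdmissiblePair {n : ℕ} (T : ℝ) (c : ℝ → ℝ) (k : ℝ → ℝ → ℝ) (mu : ℝ → ℝ)
    (lam : ℝ → StateSpace n → ℝ) (H : ℝ → StateSpace n → StateSpace n → ℝ) : Prop where
  coeff : Coefficients T c k mu
  ham : HamiltonianConditions T c H
  hlc : HamiltonianLipschitz T k H
  blc : LagrangianBounded T k lam H
  ham_zero : ∀ t ∈ Icc 0 T, |H t 0 0| ≤ mu t
  lam_zero : ∀ t ∈ Icc 0 T, |lam t 0| ≤ mu t

/-- A bound for the radius `ω(t,x)` when `‖x‖ ≤ R`. -/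
def radiusBound (c : ℝ → ℝ) (k : ℝ → ℝ → ℝ) (mu : ℝ → ℝ) (R t : ℝ) : ℝ :=
  2 * (mu t + k R t * R) + c t * (1 + R) + 1

theorem Coefficients.integrableOn_radiusBound {T : ℝ} {c : ℝ → ℝ} {k : ℝ → ℝ → ℝ} {mu : ℝ → ℝ}
    (h : Coefficients T c k mu) {R : ℝ} (hR : 0 < R) :
    IntegrableOn (radiusBound c k mu R) (Icc 0 T) :=
  (((h.mu_int.add ((h.k_int R hR).mul_const R)).const_mul 2).add (h.c_int.mul_const (1 + R))).add
    (integrableOn_const (by simp))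

namespace AdmissiblePair

variable {n : ℕ} {T : ℝ} {c : ℝ → ℝ} {k : ℝ → ℝ → ℝ} {mu : ℝ → ℝ}
  {lam : ℝ → StateSpace n → ℝ} {H : ℝ → StateSpace n → StateSpace n → ℝ}

theorem gradient_coeff_nonneg (h : AdmissiblePair T c k mu lam H) {t : ℝ} (ht : t ∈ Icc 0 T)
    (x : StateSpace n) : 0 ≤ c t * (1 + ‖x‖) :=
  mul_nonneg (h.coeff.c_nonneg t ht) (by positivity)

theorem abs_ham_sub_le (h : AdmissiblePair T c k mu lam H) {t : ℝ} (ht : t ∈ Icc 0 T)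
    {R : ℝ} (hR : 0 < R) {x y : StateSpace n} (hx : ‖x‖ ≤ R) (hy : ‖y‖ ≤ R) (q : StateSpace n) :
    |H t x q - H t y q| ≤ k R t * ‖x - y‖ * (1 + ‖q‖) := by
  have := h.hlc R hR t ht x (by simpa using hx) y (by simpa using hy) q
  linarith [mul_right_comm (k R t) ‖x - y‖ (1 + ‖q‖)]

theorem abs_lam_sub_le (h : AdmissiblePair T c k mu lam H) {t : ℝ} (ht : t ∈ Icc 0 T)
    {R : ℝ} (hR : 0 < R) {x y : StateSpace n} (hx : ‖x‖ ≤ R) (hy : ‖y‖ ≤ R) :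
    |lam t x - lam t y| ≤ k R t * ‖x - y‖ :=
  h.blc.lipschitz_state R hR t ht x (by simpa using hx) y (by simpa using hy)

theorem abs_ham_zero_le (h : AdmissiblePair T c k mu lam H) {t : ℝ} (ht : t ∈ Icc 0 T)
    {R : ℝ} (hR : 0 < R) {x : StateSpace n} (hx : ‖x‖ ≤ R) : |H t x 0| ≤ mu t + k R t * R := by
  have h1 := h.abs_ham_sub_le ht hR hx (y := 0) (by simpa using hR.le) 0
  have h2 := h.ham_zero t ht
  have h3 := mul_le_mul_of_nonneg_left hx (h.coeff.k_nonneg R hR t ht)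
  have h4 : |H t x 0| ≤ |H t x 0 - H t 0 0| + |H t 0 0| := by
    simpa using abs_add_le (H t x 0 - H t 0 0) (H t 0 0)
  simp only [sub_zero, norm_zero, add_zero, mul_one] at h1
  linarith

theorem abs_lam_le (h : AdmissiblePair T c k mu lam H) {t : ℝ} (ht : t ∈ Icc 0 T)
    {R : ℝ} (hR : 0 < R) {x : StateSpace n} (hx : ‖x‖ ≤ R) : |lam t x| ≤ mu t + k R t * R := by
  have h1 := h.abs_lam_sub_le ht hR hx (y := 0) (by simpa using hR.le)
  have h2 := h.lam_zero t ht
  have h3 := mul_le_mul_of_nonneg_left hx (h.coeff.k_nonneg R hR t ht)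
  have h4 : |lam t x| ≤ |lam t x - lam t 0| + |lam t 0| := by
    simpa using abs_add_le (lam t x - lam t 0) (lam t 0)
  simp only [sub_zero] at h1
  linarith

theorem abs_ham_le (h : AdmissiblePair T c k mu lam H) {t : ℝ} (ht : t ∈ Icc 0 T)
    {R : ℝ} (hR : 0 < R) {x : StateSpace n} (hx : ‖x‖ ≤ R) (q : StateSpace n) :
    |H t x q| ≤ mu t + k R t * R + c t * (1 + R) * ‖q‖ := by
  have h1 := h.abs_ham_zero_le ht hR hx
  have h2 := h.ham.lipschitz_gradient t ht x q 0
  rw [sub_zero] at h2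
  have h3 : c t * (1 + ‖x‖) * ‖q‖ ≤ c t * (1 + R) * ‖q‖ :=
    mul_le_mul_of_nonneg_right (mul_le_mul_of_nonneg_left (by linarith)
      (h.coeff.c_nonneg t ht)) (norm_nonneg q)
  have h4 : |H t x q| ≤ |H t x q - H t x 0| + |H t x 0| := by
    simpa using abs_add_le (H t x q - H t x 0) (H t x 0)
  linarith

theorem one_le_repRadius (h : AdmissiblePair T c k mu lam H) {t : ℝ} (ht : t ∈ Icc 0 T)
    (x : StateSpace n) : 1 ≤ repRadius c lam H t x := by
  have := h.gradient_coeff_nonneg ht x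
  rw [repRadius]
  linarith [abs_nonneg (lam t x), abs_nonneg (H t x 0)]

theorem repRadius_le (h : AdmissiblePair T c k mu lam H) {t : ℝ} (ht : t ∈ Icc 0 T)
    {R : ℝ} (hR : 0 < R) {x : StateSpace n} (hx : ‖x‖ ≤ R) :
    repRadius c lam H t x ≤ radiusBound c k mu R t := by
  have h1 := h.abs_ham_zero_le ht hR hx
  have h2 := h.abs_lam_le ht hR hx
  have h3 : c t * (1 + ‖x‖) ≤ c t * (1 + R) :=
    mul_le_mul_of_nonneg_left (by linarith) (h.coeff.c_nonneg t ht)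
  rw [repRadius, radiusBound]
  linarith

theorem abs_repRadius_sub_le (h : AdmissiblePair T c k mu lam H) {t : ℝ} (ht : t ∈ Icc 0 T)
    {R : ℝ} (hR : 0 < R) {x y : StateSpace n} (hx : ‖x‖ ≤ R) (hy : ‖y‖ ≤ R) :
    |repRadius c lam H t x - repRadius c lam H t y| ≤ (2 * k R t + c t) * ‖x - y‖ := by
  have h1 := h.abs_ham_sub_le ht hR hx hy 0
  have h2 := h.abs_lam_sub_le ht hR hx hy
  have h3 : |c t * (1 + ‖x‖) - c t * (1 + ‖y‖)| ≤ c t * ‖x - y‖ := by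
    rw [← mul_sub, abs_mul, abs_of_nonneg (h.coeff.c_nonneg t ht), add_sub_add_left_eq_sub]
    exact mul_le_mul_of_nonneg_left (abs_norm_sub_norm_le x y) (h.coeff.c_nonneg t ht)
  simp only [norm_zero, add_zero, mul_one] at h1
  have h4 := abs_le.mp ((abs_abs_sub_abs_le_abs_sub (lam t x) (lam t y)).trans h2)
  have h5 := abs_le.mp ((abs_abs_sub_abs_le_abs_sub (H t x 0) (H t y 0)).trans h1)
  have h6 := abs_le.mp h3
  rw [repRadius, repRadius, abs_le]
  constructor <;> linarith [h4.1, h5.1, h6.1, h4.2, h5.2, h6.2]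

/-- Over the effective domain L ≤ λ, so the second component can be lowered to λ without leaving the
epigraph. -/
theorem min_mem_conjEpi (h : AdmissiblePair T c k mu lam H) {t : ℝ} (ht : t ∈ Icc 0 T)
    {x : StateSpace n} {z : EpiSpace n} (hz : z ∈ conjEpi (H t x)) :
    (WithLp.toLp 2 (z.fst, min z.snd (lam t x)) : EpiSpace n) ∈ conjEpi (H t x) := by
  have hz' : lagrangian H t x z.fst ≤ (z.snd : EReal) := by
    rw [← lagrangianEpigraph_eq] at hz
    exact hz
  have hdom : z.fst ∈ effectiveDomain (lagrangian H t x) := by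
    constructor
    · intro hbot
      have := le_iSup (fun p : StateSpace n => ((inner ℝ z.fst p - H t x p : ℝ) : EReal)) 0
      rw [lagrangian] at hbot
      rw [hbot, le_bot_iff] at this
      exact EReal.coe_ne_bot _ this
    · exact ne_top_of_le_ne_top (EReal.coe_ne_top _) hz'
  have hlam := h.blc.lagrangian_le t ht x _ hdom
  rw [← lagrangianEpigraph_eq]
  change lagrangian H t x z.fst ≤ ((min z.snd (lam t x) : ℝ) : EReal)
  rcases min_choice z.snd (lam t x) with hm | hm <;> rw [hm] <;> assumption

theorem neg_ham_zero_le {t : ℝ} {x : StateSpace n} {z : EpiSpace n}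
    (hz : z ∈ conjEpi (H t x)) : - H t x 0 ≤ z.snd := by
  simpa using hz 0

theorem norm_fst_le (h : AdmissiblePair T c k mu lam H) {t : ℝ} (ht : t ∈ Icc 0 T)
    {x : StateSpace n} {z : EpiSpace n} (hz : z ∈ conjEpi (H t x)) :
    ‖z.fst‖ ≤ c t * (1 + ‖x‖) :=
  norm_fst_le_of_mem_conjEpi (h.gradient_coeff_nonneg ht x) (h.ham.lipschitz_gradient t ht x) hz

/-- This explains the form of ω: (H4) bounds the velocity by c(1+|x|), the inequality at q = 0
bounds the cost below by -H(t,x,0), and truncation bounds it above by λ. -/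
theorem norm_min_le_repRadius (h : AdmissiblePair T c k mu lam H) {t : ℝ} (ht : t ∈ Icc 0 T)
    {x : StateSpace n} {z : EpiSpace n} (hz : z ∈ conjEpi (H t x)) :
    ‖(WithLp.toLp 2 (z.fst, min z.snd (lam t x)) : EpiSpace n)‖ ≤ repRadius c lam H t x := by
  refine (norm_epiSpace_le _).trans ?_
  change ‖z.fst‖ + |min z.snd (lam t x)| ≤ _
  have h1 := h.norm_fst_le ht hz
  have h2 : |min z.snd (lam t x)| ≤ |lam t x| + |H t x 0| := by
    have h3 := neg_ham_zero_le hz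
    rw [abs_le]
    refine ⟨le_min ?_ ?_, (min_le_right _ _).trans ?_⟩
    · linarith [le_abs_self (H t x 0), abs_nonneg (lam t x)]
    · linarith [neg_abs_le (lam t x), abs_nonneg (H t x 0)]
    · linarith [le_abs_self (lam t x), abs_nonneg (H t x 0)]
  rw [repRadius]
  linarith

theorem epiParam_mem_nearPart (h : AdmissiblePair T c k mu lam H) {t : ℝ} (ht : t ∈ Icc 0 T)
    (x : StateSpace n) (a : EpiSpace n) :
    epiParam c lam H t x a ∈ nearPart (repRadius c lam H t x • a) (conjEpi (H t x)) := by
  rw [epiParam_eq]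
  exact epiPoint_mem (h.ham.convex_gradient t ht x) (h.ham.lipschitz_gradient t ht x) _

theorem epiParam_mem (h : AdmissiblePair T c k mu lam H) {t : ℝ} (ht : t ∈ Icc 0 T)
    (x : StateSpace n) (a : EpiSpace n) : epiParam c lam H t x a ∈ conjEpi (H t x) :=
  (h.epiParam_mem_nearPart ht x a).1

/-- The center ωa has norm at most ω and, since the epigraph meets the ball of radius ω, distance at
most 2ω from it. The ball defining the near part has radius at most 4ω, whence 5ω. -/
theorem norm_epiParam_le (h : AdmissiblePair T c k mu lam H) {t : ℝ} (ht : t ∈ Icc 0 T)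
    (x : StateSpace n) {a : EpiSpace n} (ha : ‖a‖ ≤ 1) :
    ‖epiParam c lam H t x a‖ ≤ 5 * repRadius c lam H t x := by
  set ω := repRadius c lam H t x with hω
  have hω1 : 1 ≤ ω := h.one_le_repRadius ht x
  have hmem := h.epiParam_mem ht x a
  have h1 := Metric.infDist_le_dist_of_mem (x := ω • a) (h.min_mem_conjEpi ht hmem)
  have h2 := h.norm_min_le_repRadius ht hmem
  have h3 := norm_le_of_mem_nearPart (h.epiParam_mem_nearPart ht x a)
  have h4 : ‖ω • a‖ ≤ ω := by
    rw [norm_smul, Real.norm_of_nonneg (by linarith)]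
    nlinarith
  rw [dist_eq_norm] at h1
  have h5 := norm_sub_le (ω • a) (WithLp.toLp 2 ((epiParam c lam H t x a).fst,
    min (epiParam c lam H t x a).snd (lam t x)) : EpiSpace n)
  linarith

theorem norm_repDynamics_le (h : AdmissiblePair T c k mu lam H) {t : ℝ} (ht : t ∈ Icc 0 T)
    (x : StateSpace n) (a : EpiSpace n) : ‖repDynamics c lam H t x a‖ ≤ c t * (1 + ‖x‖) :=
  h.norm_fst_le ht (h.epiParam_mem ht x a)

theorem norm_epiParam_le_radiusBound (h : AdmissiblePair T c k mu lam H) {t : ℝ}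
    (ht : t ∈ Icc 0 T) {R : ℝ} (hR : 0 < R) {x : StateSpace n} (hx : ‖x‖ ≤ R) {a : EpiSpace n}
    (ha : ‖a‖ ≤ 1) : ‖epiParam c lam H t x a‖ ≤ 5 * radiusBound c k mu R t := by
  linarith [h.norm_epiParam_le ht x ha, h.repRadius_le ht hR hx]

theorem epiParam_inv_smul (h : AdmissiblePair T c k mu lam H) {t : ℝ} (ht : t ∈ Icc 0 T)
    {x : StateSpace n} {z : EpiSpace n} (hz : z ∈ conjEpi (H t x)) :
    epiParam c lam H t x ((repRadius c lam H t x)⁻¹ • z) = z := by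
  have hω := h.one_le_repRadius ht x
  rw [epiParam_eq, smul_inv_smul₀ (by linarith), epiPoint_of_mem hz]

theorem norm_inv_smul_le (h : AdmissiblePair T c k mu lam H) {t : ℝ} (ht : t ∈ Icc 0 T)
    {x : StateSpace n} {z : EpiSpace n} (hz : ‖z‖ ≤ repRadius c lam H t x) :
    ‖(repRadius c lam H t x)⁻¹ • z‖ ≤ 1 := by
  have hω := h.one_le_repRadius ht x
  have hpos : 0 < repRadius c lam H t x := by linarith
  rw [norm_smul, norm_inv, Real.norm_of_nonneg hpos.le, inv_mul_le_iff₀ hpos]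
  linarith

/-- Twice the Hamiltonian perturbation contributes 2k_R and the motion of the center ωa contributes
2k_R + c; the remaining factors come from near parts and Steiner points. -/
theorem norm_epiParam_sub_le (h : AdmissiblePair T c k mu lam H) {t : ℝ} (ht : t ∈ Icc 0 T)
    {R : ℝ} (hR : 0 < R) {x y : StateSpace n} (hx : ‖x‖ ≤ R) (hy : ‖y‖ ≤ R) {a : EpiSpace n}
    (ha : ‖a‖ ≤ 1) :
    ‖epiParam c lam H t x a - epiParam c lam H t y a‖ ≤
      Module.finrank ℝ (EpiSpace n) * 10 * (4 * k R t + c t) * ‖x - y‖ := by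
  have h1 := norm_epiPoint_sub_le (h.ham.convex_gradient t ht x) (h.ham.lipschitz_gradient t ht x)
    (h.ham.convex_gradient t ht y) (h.ham.lipschitz_gradient t ht y)
    (mul_nonneg (h.coeff.k_nonneg R hR t ht) (norm_nonneg (x - y)))
    (h.abs_ham_sub_le ht hR hx hy) (repRadius c lam H t x • a) (repRadius c lam H t y • a)
  rw [← epiParam_eq, ← epiParam_eq] at h1
  have h2 : dist (repRadius c lam H t x • a) (repRadius c lam H t y • a) ≤
      (2 * k R t + c t) * ‖x - y‖ := by
    rw [dist_eq_norm, ← sub_smul, norm_smul, Real.norm_eq_abs]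
    have := h.abs_repRadius_sub_le ht hR hx hy
    exact (mul_le_of_le_one_right (abs_nonneg _) ha).trans this
  refine h1.trans ?_
  have h3 : (0 : ℝ) ≤ Module.finrank ℝ (EpiSpace n) := Nat.cast_nonneg _
  rw [mul_assoc, mul_assoc]
  refine mul_le_mul_of_nonneg_left ?_ h3
  linarith

theorem aemeasurable_ham (h : AdmissiblePair T c k mu lam H) {x : ℝ → StateSpace n}
    {S : Set ℝ} (hS : MeasurableSet S) (hST : S ⊆ Icc 0 T)
    (hx : AEStronglyMeasurable x (volume.restrict S)) (q : StateSpace n) :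
    AEMeasurable (fun t => H t (x t) q) (volume.restrict S) := by
  refine (aestronglyMeasurable_superposition (F := fun t x => H t x q)
    (fun x => ((h.ham.measurable_time x q).mono_measure
      (Measure.restrict_mono hST le_rfl)).aestronglyMeasurable) ?_ hx).aemeasurable
  filter_upwards [ae_restrict_mem hS] with t ht
  exact (h.ham.continuous_space t (hST ht)).comp (continuous_id.prodMk continuous_const)

theorem aemeasurable_lam (h : AdmissiblePair T c k mu lam H) {x : ℝ → StateSpace n}
    {S : Set ℝ} (hS : MeasurableSet S) (hST : S ⊆ Icc 0 T)
    (hx : AEStronglyMeasurable x (volume.restrict S)) :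
    AEMeasurable (fun t => lam t (x t)) (volume.restrict S) := by
  refine (aestronglyMeasurable_superposition (F := lam)
    (fun x => ((h.blc.measurable_time x).mono_measure
      (Measure.restrict_mono hST le_rfl)).aestronglyMeasurable) ?_ hx).aemeasurable
  filter_upwards [ae_restrict_mem hS] with t ht
  exact h.blc.continuous_state t (hST ht)

theorem aemeasurable_repRadius (h : AdmissiblePair T c k mu lam H) {x : ℝ → StateSpace n}
    {S : Set ℝ} (hS : MeasurableSet S) (hST : S ⊆ Icc 0 T)
    (hx : AEStronglyMeasurable x (volume.restrict S)) :
    AEMeasurable (fun t => repRadius c lam H t (x t)) (volume.restrict S) := by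
  have hc := (h.coeff.c_int.mono_set hST).aemeasurable
  have h1 := (h.aemeasurable_lam hS hST hx).norm
  have h2 := (h.aemeasurable_ham hS hST hx 0).norm
  exact ((h1.add h2).add (hc.mul (hx.norm.aemeasurable.const_add 1))).add_const 1

theorem aestronglyMeasurable_epiParam (h : AdmissiblePair T c k mu lam H) {x : ℝ → StateSpace n}
    {a : ℝ → EpiSpace n} {S : Set ℝ} (hS : MeasurableSet S) (hST : S ⊆ Icc 0 T)
    (hx : AEStronglyMeasurable x (volume.restrict S))
    (ha : AEStronglyMeasurable a (volume.restrict S)) :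
    AEStronglyMeasurable (fun t => epiParam c lam H t (x t) (a t)) (volume.restrict S) := by
  simp_rw [epiParam_eq]
  have hc := (h.coeff.c_int.mono_set hST).aemeasurable
  refine (aemeasurable_epiPoint (c := fun t => c t * (1 + ‖x t‖))
    (fun q => h.aemeasurable_ham hS hST hx q) (hc.mul (hx.norm.aemeasurable.const_add 1))
    ((h.aemeasurable_repRadius hS hST hx).smul ha.aemeasurable) ?_ ?_).aestronglyMeasurable
  · filter_upwards [ae_restrict_mem hS] with t ht
    exact h.ham.convex_gradient t (hST ht) (x t)
  · filter_upwards [ae_restrict_mem hS] with t ht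
    exact h.ham.lipschitz_gradient t (hST ht) (x t)

/-- The common constant k_R allows the state to move along with i. The convergence of the
Hamiltonians at moving states is recorded separately for use in the limit of the dual inequalities.
-/
theorem tendsto_epiParam {lams : ℕ → ℝ → StateSpace n → ℝ}
    {Hs : ℕ → ℝ → StateSpace n → StateSpace n → ℝ} (h : AdmissiblePair T c k mu lam H)
    (hs : ∀ i, AdmissiblePair T c k mu (lams i) (Hs i)) {t : ℝ} (ht : t ∈ Icc 0 T)
    (hH : ∀ x q, Tendsto (fun i => Hs i t x q) atTop (𝓝 (H t x q)))
    (hlam : ∀ x, Tendsto (fun i => lams i t x) atTop (𝓝 (lam t x)))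
    {R : ℝ} (hR : 0 < R) {x : ℕ → StateSpace n} {x₀ : StateSpace n} (hx : ∀ i, ‖x i‖ ≤ R)
    (hx₀ : ‖x₀‖ ≤ R) (hlim : Tendsto x atTop (𝓝 x₀)) (a : EpiSpace n) :
    (∀ q, Tendsto (fun i => Hs i t (x i) q) atTop (𝓝 (H t x₀ q))) ∧
    Tendsto (fun i => epiParam c (lams i) (Hs i) t (x i) a) atTop
      (𝓝 (epiParam c lam H t x₀ a)) := by
  have hnorm : Tendsto (fun i => ‖x i - x₀‖) atTop (𝓝 0) :=
    tendsto_iff_norm_sub_tendsto_zero.mp hlim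
  have hH' : ∀ q, Tendsto (fun i => Hs i t (x i) q) atTop (𝓝 (H t x₀ q)) := by
    intro q
    refine (hH x₀ q).congr_dist (squeeze_zero (fun _ => dist_nonneg)
      (g := fun i => k R t * ‖x i - x₀‖ * (1 + ‖q‖)) (fun i => ?_) ?_)
    · rw [dist_comm, Real.dist_eq]
      exact (hs i).abs_ham_sub_le ht hR (hx i) hx₀ q
    · simpa using (hnorm.const_mul (k R t)).mul_const (1 + ‖q‖)
  have hlam' : Tendsto (fun i => lams i t (x i)) atTop (𝓝 (lam t x₀)) := by
    refine (hlam x₀).congr_dist (squeeze_zero (fun _ => dist_nonneg)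
      (g := fun i => k R t * ‖x i - x₀‖) (fun i => ?_) ?_)
    · rw [dist_comm, Real.dist_eq]
      exact (hs i).abs_lam_sub_le ht hR (hx i) hx₀
    · simpa using hnorm.const_mul (k R t)
  refine ⟨hH', ?_⟩
  simp_rw [epiParam_eq]
  have hω : Tendsto (fun i => repRadius c (lams i) (Hs i) t (x i)) atTop
      (𝓝 (repRadius c lam H t x₀)) :=
    ((hlam'.abs.add (hH' 0).abs).add ((hlim.norm.const_add 1).const_mul (c t))).add_const 1
  have hlip : ∀ {lam' : ℝ → StateSpace n → ℝ} {H' : ℝ → StateSpace n → StateSpace n → ℝ},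
      AdmissiblePair T c k mu lam' H' → ∀ y : StateSpace n, ‖y‖ ≤ R → ∀ p q,
      |H' t y p - H' t y q| ≤ c t * (1 + R) * ‖p - q‖ := by
    intro lam' H' h' y hy p q
    refine (h'.ham.lipschitz_gradient t ht y p q).trans ?_
    exact mul_le_mul_of_nonneg_right (mul_le_mul_of_nonneg_left (by linarith)
      (h'.coeff.c_nonneg t ht)) (norm_nonneg _)
  exact tendsto_epiPoint (fun i => (hs i).ham.convex_gradient t ht (x i))
    (h.ham.convex_gradient t ht x₀) (fun i => hlip (hs i) _ (hx i)) (hlip h _ hx₀) hH'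
    (hω.smul_const a)

end AdmissiblePair

/-! ### Trajectories of the representation -/

section Projections

variable {n : ℕ}

/-- The projection of `ℝⁿ × ℝ` onto `ℝⁿ`, as a continuous linear map. -/
noncomputable def epiFst (n : ℕ) : EpiSpace n →L[ℝ] StateSpace n :=
  (ContinuousLinearMap.fst ℝ _ _).comp
    (WithLp.prodContinuousLinearEquiv 2 ℝ (StateSpace n) ℝ).toContinuousLinearMap

/-- The projection of `ℝⁿ × ℝ` onto `ℝ`, as a continuous linear map. -/
noncomputable def epiSnd (n : ℕ) : EpiSpace n →L[ℝ] ℝ :=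
  (ContinuousLinearMap.snd ℝ _ _).comp
    (WithLp.prodContinuousLinearEquiv 2 ℝ (StateSpace n) ℝ).toContinuousLinearMap

@[simp] theorem epiFst_apply (z : EpiSpace n) : epiFst n z = z.fst := rfl

@[simp] theorem epiSnd_apply (z : EpiSpace n) : epiSnd n z = z.snd := rfl

end Projections

namespace Coefficients

variable {T : ℝ} {c : ℝ → ℝ} {k : ℝ → ℝ → ℝ} {mu : ℝ → ℝ}

theorem integrable_indicator_c (h : Coefficients T c k mu) : Integrable ((Icc 0 T).indicator c) :=
  h.c_int.integrable_indicator measurableSet_Icc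

theorem indicator_c_nonneg (h : Coefficients T c k mu) (s : ℝ) : 0 ≤ (Icc 0 T).indicator c s :=
  indicator_nonneg h.c_nonneg s

end Coefficients

/-- The a priori bound for arcs that start in the ball of radius `r`. -/
noncomputable def arcBound (T : ℝ) (c : ℝ → ℝ) (r : ℝ) : ℝ :=
  (r + ∫ s, (Icc 0 T).indicator c s) * Real.exp (∫ s, (Icc 0 T).indicator c s)

/-- Grönwall's inequality for linear growth. The base point is arbitrary, so the bound holds from an
initial as well as from a terminal condition. -/
theorem Coefficients.norm_le_arcBound {T : ℝ} {c : ℝ → ℝ} {k : ℝ → ℝ → ℝ} {mu : ℝ → ℝ}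
    (h : Coefficients T c k mu) {X : Type*} [NormedAddCommGroup X] [NormedSpace ℝ X]
    {x v : ℝ → X} {z : X} {a b τ r : ℝ} (ha : 0 ≤ a) (hb : b ≤ T) (hτ : τ ∈ Icc a b)
    (hx : ContinuousOn x (Icc a b)) (hv : Integrable v) (hz : ‖z‖ ≤ r)
    (heq : ∀ t ∈ Icc a b, x t = z + ∫ s in τ..t, v s)
    (hvx : ∀ᵐ s, s ∈ Icc a b → ‖v s‖ ≤ c s * (1 + ‖x s‖)) :
    ∀ t ∈ Icc a b, ‖x t‖ ≤ arcBound T c r := by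
  set K := (Icc 0 T).indicator c with hK
  have hKi : Integrable K := h.integrable_indicator_c
  have hK0 : ∀ s, 0 ≤ K s := h.indicator_c_nonneg
  have hr0 : 0 ≤ r := (norm_nonneg z).trans hz
  have hI0 : 0 ≤ ∫ s, K s := integral_nonneg hK0
  intro t ht
  have hg := le_mul_exp_of_le_add_integral (φ := fun t => ‖x t‖) hKi hK0
    (A := r + ∫ s, K s) (by positivity) hτ hx.norm (fun t ht => by
      have hsub := uIoc_subset_Icc hτ ht
      have hint : IntegrableOn (fun s => K s * ‖x s‖) (uIoc τ t) :=
        hKi.integrableOn.mul_continuousOn_of_subset hx.norm measurableSet_uIoc isCompact_Icc hsub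
      have h1 : ‖∫ s in τ..t, v s‖ ≤ ∫ s in uIoc τ t, (K s + K s * ‖x s‖) := by
        refine intervalIntegral.norm_integral_le_integral_norm_uIoc.trans ?_
        refine setIntegral_mono_on_ae hv.norm.integrableOn (hKi.integrableOn.add hint)
          measurableSet_uIoc ?_
        filter_upwards [hvx] with s hs hsm
        refine (hs (hsub hsm)).trans (le_of_eq ?_)
        have hs' := hsub hsm
        rw [hK, indicator_of_mem (show s ∈ Icc 0 T from ⟨ha.trans hs'.1, hs'.2.trans hb⟩)]
        ring
      rw [integral_add hKi.integrableOn hint] at h1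
      have h2 := integral_uIoc_le_integral hKi hK0 τ t
      have h3 := norm_add_le z (∫ s in τ..t, v s)
      rw [← heq t ht] at h3
      change ‖x t‖ ≤ r + (∫ s, K s) + ∫ s in uIoc τ t, K s * ‖x s‖
      linarith) t ht
  refine hg.trans ?_
  rw [arcBound]
  refine mul_le_mul_of_nonneg_left (Real.exp_le_exp.mpr ?_) (by positivity)
  exact integral_uIoc_le_integral hKi hK0 τ t

/-- The velocity `(x', cost')` along a trajectory-control pair, extended by `0`. -/
noncomputable def arcVelocity {n : ℕ} (T : ℝ) (c : ℝ → ℝ) (lam : ℝ → StateSpace n → ℝ)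
    (H : ℝ → StateSpace n → StateSpace n → ℝ) (τ : ℝ) (x : ℝ → StateSpace n)
    (a : ℝ → EpiSpace n) : ℝ → EpiSpace n :=
  (Ioc τ T).indicator fun t => epiParam c lam H t (x t) (a t)

namespace AdmissiblePair

variable {n : ℕ} {T : ℝ} {c : ℝ → ℝ} {k : ℝ → ℝ → ℝ} {mu : ℝ → ℝ}
  {lam : ℝ → StateSpace n → ℝ} {H : ℝ → StateSpace n → StateSpace n → ℝ}
  {τ : ℝ} {ξ : StateSpace n} {x : ℝ → StateSpace n} {a : ℝ → EpiSpace n}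

theorem norm_arcVelocity_le (h : AdmissiblePair T c k mu lam H) (hτ : τ ∈ Icc 0 T)
    (ha : ∀ᵐ t ∂(volume.restrict (Icc τ T)), a t ∈ Metric.closedBall (0 : EpiSpace n) 1)
    {R : ℝ} (hR : 0 < R) (hxR : ∀ t ∈ Icc τ T, ‖x t‖ ≤ R) :
    ∀ᵐ t, ‖arcVelocity T c lam H τ x a t‖ ≤
      (Icc 0 T).indicator (fun t => 5 * radiusBound c k mu R t) t := by
  rw [ae_restrict_iff' measurableSet_Icc] at ha
  filter_upwards [ha] with t hat
  by_cases htm : t ∈ Ioc τ T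
  · have htI : t ∈ Icc τ T := Ioc_subset_Icc_self htm
    have ht0 : t ∈ Icc 0 T := ⟨hτ.1.trans htI.1, htI.2⟩
    rw [arcVelocity, indicator_of_mem htm, indicator_of_mem ht0]
    exact h.norm_epiParam_le_radiusBound ht0 hR (hxR t htI) (by simpa using hat htI)
  · rw [arcVelocity, indicator_of_notMem htm, norm_zero]
    refine indicator_nonneg (fun s hs => ?_) t
    have h1 := h.one_le_repRadius hs 0
    have h2 := h.repRadius_le hs hR (x := 0) (by simpa using hR.le)
    linarith

theorem integrable_arcVelocity (h : AdmissiblePair T c k mu lam H) (hτ : τ ∈ Icc 0 T)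
    (ha : ∀ᵐ t ∂(volume.restrict (Icc τ T)), a t ∈ Metric.closedBall (0 : EpiSpace n) 1)
    (ham : AEStronglyMeasurable a (volume.restrict (Icc τ T)))
    (hx : ContinuousOn x (Icc τ T)) : Integrable (arcVelocity T c lam H τ x a) := by
  obtain ⟨M, hM⟩ := isCompact_Icc.exists_bound_of_continuousOn hx
  have hxR : ∀ t ∈ Icc τ T, ‖x t‖ ≤ |M| + 1 := fun t ht => by
    linarith [hM t ht, le_abs_self M]
  have hR : 0 < |M| + 1 := by positivity
  have hmeas : AEStronglyMeasurable (arcVelocity T c lam H τ x a) := by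
    rw [arcVelocity, aestronglyMeasurable_indicator_iff measurableSet_Ioc]
    refine (h.aestronglyMeasurable_epiParam measurableSet_Icc (Icc_subset_Icc_left hτ.1)
      (hx.aestronglyMeasurable measurableSet_Icc) ham).mono_measure ?_
    exact Measure.restrict_mono Ioc_subset_Icc_self le_rfl
  have hbd : IntegrableOn (fun t => 5 * radiusBound c k mu (|M| + 1) t) (Icc 0 T) :=
    (h.coeff.integrableOn_radiusBound hR).const_mul 5
  exact Integrable.mono' (hbd.integrable_indicator measurableSet_Icc) hmeas
    (h.norm_arcVelocity_le hτ ha hR hxR)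

theorem ae_hasDerivAt_arcVelocity
    (htr : IsTrajectoryControl (Metric.closedBall (0 : EpiSpace n) 1) (repDynamics c lam H) T τ ξ
      x a) :
    ∀ᵐ t, t ∈ Icc τ T → HasDerivAt x (arcVelocity T c lam H τ x a t).fst t := by
  have h1 := htr.dynamics
  rw [ae_restrict_iff' measurableSet_Icc] at h1
  have h2 : ∀ᵐ t : ℝ, t ≠ τ := by simp [ae_iff, measure_singleton]
  filter_upwards [h1, h2] with t h1 h2 ht
  rw [arcVelocity, indicator_of_mem (show t ∈ Ioc τ T from ⟨lt_of_le_of_ne ht.1 h2.symm, ht.2⟩)]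
  exact h1 ht

theorem continuousOn_trajectory (hτT : τ ≤ T)
    (htr : IsTrajectoryControl (Metric.closedBall (0 : EpiSpace n) 1) (repDynamics c lam H) T τ ξ
      x a) : ContinuousOn x (Icc τ T) := by
  have := htr.absolutelyContinuous.continuousOn
  rwa [uIcc_of_le hτT] at this

theorem trajectory_eq (h : AdmissiblePair T c k mu lam H) (hτ : τ ∈ Icc 0 T)
    (htr : IsTrajectoryControl (Metric.closedBall (0 : EpiSpace n) 1) (repDynamics c lam H) T τ ξ
      x a) :
    ∀ t ∈ Icc τ T, x t = ξ + ∫ s in τ..t, (arcVelocity T c lam H τ x a s).fst := by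
  have hint := h.integrable_arcVelocity hτ htr.control_mem htr.control_measurable
    (continuousOn_trajectory hτ.2 htr)
  have := htr.absolutelyContinuous.eq_add_integral hτ.2 ((epiFst n).integrable_comp hint)
    (ae_hasDerivAt_arcVelocity htr)
  rw [htr.initial] at this
  exact this

theorem norm_trajectory_le (h : AdmissiblePair T c k mu lam H) (hτ : τ ∈ Icc 0 T)
    (htr : IsTrajectoryControl (Metric.closedBall (0 : EpiSpace n) 1) (repDynamics c lam H) T τ ξ
      x a) {r : ℝ} (hr : ‖ξ‖ ≤ r) : ∀ t ∈ Icc τ T, ‖x t‖ ≤ arcBound T c r := by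
  have hint := h.integrable_arcVelocity hτ htr.control_mem htr.control_measurable
    (continuousOn_trajectory hτ.2 htr)
  refine h.coeff.norm_le_arcBound hτ.1 le_rfl (left_mem_Icc.mpr hτ.2)
    (continuousOn_trajectory hτ.2 htr) ((epiFst n).integrable_comp hint) hr
    (h.trajectory_eq hτ htr) (ae_of_all _ fun t ht => ?_)
  have ht0 : t ∈ Icc 0 T := ⟨hτ.1.trans ht.1, ht.2⟩
  simp only [epiFst_apply]
  by_cases htm : t ∈ Ioc τ T
  · rw [arcVelocity, indicator_of_mem htm]
    exact h.norm_repDynamics_le ht0 _ _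
  · rw [arcVelocity, indicator_of_notMem htm]
    simpa using h.gradient_coeff_nonneg ht0 (x t)

theorem integral_repCost_eq (hτT : τ ≤ T) :
    ∫ t in τ..T, repCost c lam H t (x t) (a t) =
      ∫ t in τ..T, (arcVelocity T c lam H τ x a t).snd := by
  refine intervalIntegral.integral_congr_ae (ae_of_all _ fun t ht => ?_)
  rw [uIoc_of_le hτT] at ht
  rw [arcVelocity, indicator_of_mem ht]
  rfl

theorem arcVelocity_eq_zero {t : ℝ} (ht : t ≤ τ) : arcVelocity T c lam H τ x a t = 0 :=
  indicator_of_notMem (fun h => absurd h.1 (not_lt.mpr ht)) _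

/-- The arc `(x, cost)` along a trajectory, constant before the initial time. -/
theorem exists_extended_arc (h : AdmissiblePair T c k mu lam H) (hτ : τ ∈ Icc 0 T)
    (htr : IsTrajectoryControl (Metric.closedBall (0 : EpiSpace n) 1) (repDynamics c lam H) T τ ξ
      x a) {Z : ℝ → EpiSpace n}
    (hZ : ∀ t, Z t = WithLp.toLp 2 (ξ, 0) + ∫ s in (0 : ℝ)..t, arcVelocity T c lam H τ x a s) :
    (∀ t ∈ Icc 0 τ, Z t = WithLp.toLp 2 (ξ, 0)) ∧
    (∀ t ∈ Icc τ T, (Z t).fst = x t) ∧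
    (Z T).snd = ∫ t in τ..T, repCost c lam H t (x t) (a t) := by
  have hint := h.integrable_arcVelocity hτ htr.control_mem htr.control_measurable
    (continuousOn_trajectory hτ.2 htr)
  have hzero : ∀ t ∈ Icc 0 τ, ∫ s in (0 : ℝ)..t, arcVelocity T c lam H τ x a s = 0 := by
    intro t ht
    refine intervalIntegral.integral_zero_ae (ae_of_all _ fun s hs => ?_)
    rw [uIoc_of_le ht.1] at hs
    exact arcVelocity_eq_zero (hs.2.trans ht.2)
  have hsplit : ∀ t, ∫ s in (0 : ℝ)..t, arcVelocity T c lam H τ x a s =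
      ∫ s in τ..t, arcVelocity T c lam H τ x a s := by
    intro t
    rw [← intervalIntegral.integral_add_adjacent_intervals (b := τ) hint.intervalIntegrable
      hint.intervalIntegrable, hzero τ ⟨hτ.1, le_rfl⟩, zero_add]
  refine ⟨fun t ht => by rw [hZ, hzero t ht, add_zero], fun t ht => ?_, ?_⟩
  · rw [h.trajectory_eq hτ htr t ht, hZ, hsplit, WithLp.add_fst]
    congr 1
    exact ((epiFst n).intervalIntegral_comp_comm hint.intervalIntegrable).symm
  · rw [integral_repCost_eq hτ.2, hZ, hsplit, WithLp.add_snd]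
    have := (epiSnd n).intervalIntegral_comp_comm (hint.intervalIntegrable (a := τ) (b := T))
    simp only [epiSnd_apply] at this
    rw [this]
    exact zero_add _

end AdmissiblePair

/-! ### Limits of trajectories -/

theorem aestronglyMeasurable_inv_smul {α X : Type*} [MeasurableSpace α] {μ : Measure α}
    [NormedAddCommGroup X] [NormedSpace ℝ X] {r : α → ℝ} {w : α → X} (hr : AEMeasurable r μ)
    (hw : AEStronglyMeasurable w μ) : AEStronglyMeasurable (fun t => (r t)⁻¹ • w t) μ :=
  hr.inv.aestronglyMeasurable.smul hw

theorem measurable_deriv_of_complete {X : Type*} [NormedAddCommGroup X] [NormedSpace ℝ X]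
    [CompleteSpace X] [MeasurableSpace X] [BorelSpace X] (Z : ℝ → X) : Measurable (deriv Z) :=
  measurable_deriv Z

theorem continuousSMul_of_normedSpace (X : Type*) [NormedAddCommGroup X] [NormedSpace ℝ X] :
    ContinuousSMul ℝ X := inferInstance

instance (n : ℕ) : ContinuousSMul ℝ (EpiSpace n) := continuousSMul_of_normedSpace _

namespace AdmissiblePair

variable {n : ℕ} {T : ℝ} {c : ℝ → ℝ} {k : ℝ → ℝ → ℝ} {mu : ℝ → ℝ}
  {lam : ℝ → StateSpace n → ℝ} {H : ℝ → StateSpace n → StateSpace n → ℝ}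

/-- An absolutely continuous arc whose velocity lies in the epigraph of the Lagrangian gives a
trajectory-control pair of the representation with no larger cost. -/
theorem exists_trajectory_of_arc (h : AdmissiblePair T c k mu lam H) {τ : ℝ} (hτ : τ ∈ Icc 0 T)
    {Z : ℝ → EpiSpace n} {m : ℝ → ℝ} (hm : Integrable m)
    (hZ : ∀ s ∈ Icc τ T, ∀ t ∈ Icc τ T, s ≤ t → ‖Z t - Z s‖ ≤ ∫ r in s..t, m r)
    {R : ℝ} (hR : 0 < R) (hZR : ∀ t ∈ Icc τ T, ‖(Z t).fst‖ ≤ R)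
    (hd : ∀ᵐ t, t ∈ Icc τ T → DifferentiableAt ℝ Z t ∧ deriv Z t ∈ conjEpi (H t (Z t).fst)) :
    ∃ a : ℝ → EpiSpace n,
      IsTrajectoryControl (Metric.closedBall (0 : EpiSpace n) 1) (repDynamics c lam H) T τ
        (Z τ).fst (fun t => (Z t).fst) a ∧
      ∫ t in τ..T, repCost c lam H t (Z t).fst (a t) ≤ (Z T).snd - (Z τ).snd := by
  have hST : Icc τ T ⊆ Icc 0 T := Icc_subset_Icc_left hτ.1
  have hacx : AbsolutelyContinuousOnInterval (fun t => (Z t).fst) τ T := by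
    refine absolutelyContinuousOnInterval_of_norm_sub_le hm hτ.2 fun s hs t ht hst => ?_
    rw [← WithLp.sub_fst]
    exact (norm_fst_le_norm _).trans (hZ s hs t ht hst)
  have hacy : AbsolutelyContinuousOnInterval (fun t => (Z t).snd) τ T := by
    refine absolutelyContinuousOnInterval_of_norm_sub_le hm hτ.2 fun s hs t ht hst => ?_
    rw [← WithLp.sub_snd]
    exact (abs_snd_le_norm _).trans (hZ s hs t ht hst)
  have hxc : ContinuousOn (fun t => (Z t).fst) (Icc τ T) := by
    have := hacx.continuousOn
    rwa [uIcc_of_le hτ.2] at this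
  have hxm : AEStronglyMeasurable (fun t => (Z t).fst) (volume.restrict (Icc τ T)) :=
    hxc.aestronglyMeasurable measurableSet_Icc
  -- Lowering the cost rate to λ brings the velocity into the ball of radius ω, hence into the range
  -- of the parametrization.
  set w : ℝ → EpiSpace n := fun t =>
    WithLp.toLp 2 ((deriv Z t).fst, min (deriv Z t).snd (lam t (Z t).fst)) with hw
  have hZ' : Measurable (deriv Z) := measurable_deriv_of_complete Z
  have hwm : AEStronglyMeasurable w (volume.restrict (Icc τ T)) := by
    have h1 : AEMeasurable (fun t => (deriv Z t).fst) (volume.restrict (Icc τ T)) :=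
      (continuous_epiSpace_fst.measurable.comp hZ').aemeasurable
    have h2 : AEMeasurable (fun t => (deriv Z t).snd) (volume.restrict (Icc τ T)) :=
      (continuous_epiSpace_snd.measurable.comp hZ').aemeasurable
    have h3 := h.aemeasurable_lam measurableSet_Icc hST hxm
    exact ((WithLp.prod_continuous_toLp 2 (StateSpace n) ℝ).measurable.comp_aemeasurable
      (h1.prodMk (h2.min h3))).aestronglyMeasurable
  -- The control is explicit, so no measurable selection theorem is needed.
  set a : ℝ → EpiSpace n := fun t => (repRadius c lam H t (Z t).fst)⁻¹ • w t with ha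
  have key : ∀ᵐ t, t ∈ Icc τ T → HasDerivAt Z (deriv Z t) t ∧
      epiParam c lam H t (Z t).fst (a t) = w t ∧ ‖a t‖ ≤ 1 ∧
      ‖w t‖ ≤ repRadius c lam H t (Z t).fst := by
    filter_upwards [hd] with t ht htm
    obtain ⟨hdiff, hmem⟩ := ht htm
    have hn := h.norm_min_le_repRadius (hST htm) hmem
    exact ⟨hdiff.hasDerivAt, h.epiParam_inv_smul (hST htm) (h.min_mem_conjEpi (hST htm) hmem),
      h.norm_inv_smul_le (hST htm) hn, hn⟩
  refine ⟨a, ⟨?_, ?_, hacx, rfl, ?_⟩, ?_⟩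
  · exact aestronglyMeasurable_inv_smul (h.aemeasurable_repRadius measurableSet_Icc hST hxm) hwm
  · rw [ae_restrict_iff' measurableSet_Icc]
    filter_upwards [key] with t ht htm
    simpa using (ht htm).2.2.1
  · rw [ae_restrict_iff' measurableSet_Icc]
    filter_upwards [key] with t ht htm
    rw [repDynamics, (ht htm).2.1]
    exact (epiFst n).hasFDerivAt.comp_hasDerivAt t (ht htm).1
  · have hwint : IntervalIntegrable (fun t => (w t).snd) volume τ T := by
      rw [intervalIntegrable_iff_integrableOn_Icc_of_le hτ.2]
      refine Integrable.mono' ((h.coeff.integrableOn_radiusBound hR).mono_set hST)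
        (continuous_epiSpace_snd.comp_aestronglyMeasurable hwm) ?_
      rw [ae_restrict_iff' measurableSet_Icc]
      filter_upwards [key] with t ht htm
      exact (abs_snd_le_norm _).trans (((ht htm).2.2.2).trans
        (h.repRadius_le (hST htm) hR (hZR t htm)))
    have hcost : ∫ t in τ..T, repCost c lam H t (Z t).fst (a t) = ∫ t in τ..T, (w t).snd := by
      refine intervalIntegral.integral_congr_ae ?_
      filter_upwards [key] with t ht htm
      rw [uIoc_of_le hτ.2] at htm
      rw [repCost, (ht (Ioc_subset_Icc_self htm)).2.1]
    have hfund := hacy.integral_deriv_eq_sub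
    rw [hcost, ← hfund]
    refine intervalIntegral.integral_mono_ae_restrict hτ.2 hwint hacy.intervalIntegrable_deriv ?_
    rw [EventuallyLE, ae_restrict_iff' measurableSet_Icc]
    filter_upwards [key] with t ht htm
    have hder : HasDerivAt (fun t => (Z t).snd) (deriv Z t).snd t :=
      (epiSnd n).hasFDerivAt.comp_hasDerivAt t (ht htm).1
    rw [hder.deriv]
    exact min_le_left _ _

/-- **Compactness of trajectories**: trajectories of the representations of `Hs i` subconverge to a
trajectory of the representation of the limit `H`, without increase of the cost. -/
theorem exists_limit_trajectory {lams : ℕ → ℝ → StateSpace n → ℝ}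
    {Hs : ℕ → ℝ → StateSpace n → StateSpace n → ℝ} (h : AdmissiblePair T c k mu lam H)
    (hs : ∀ i, AdmissiblePair T c k mu (lams i) (Hs i))
    (hH : ∀ t ∈ Icc 0 T, ∀ x q, Tendsto (fun i => Hs i t x q) atTop (𝓝 (H t x q)))
    (hlam : ∀ t ∈ Icc 0 T, ∀ x, Tendsto (fun i => lams i t x) atTop (𝓝 (lam t x)))
    {τ : ℕ → ℝ} {τ₀ : ℝ} (hτ : ∀ i, τ i ∈ Icc 0 T) (hτ₀ : τ₀ ∈ Icc 0 T)
    (hτlim : Tendsto τ atTop (𝓝 τ₀)) {ξ : ℕ → StateSpace n} {ξ₀ : StateSpace n}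
    (hξ : Tendsto ξ atTop (𝓝 ξ₀)) {x : ℕ → ℝ → StateSpace n} {a : ℕ → ℝ → EpiSpace n}
    (htr : ∀ i, IsTrajectoryControl (Metric.closedBall (0 : EpiSpace n) 1)
      (repDynamics c (lams i) (Hs i)) T (τ i) (ξ i) (x i) (a i)) :
    ∃ φ : ℕ → ℕ, StrictMono φ ∧ ∃ (x₀ : ℝ → StateSpace n) (a₀ : ℝ → EpiSpace n) (y : ℝ),
      IsTrajectoryControl (Metric.closedBall (0 : EpiSpace n) 1) (repDynamics c lam H) T τ₀ ξ₀
        x₀ a₀ ∧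
      Tendsto (fun i => x (φ i) T) atTop (𝓝 (x₀ T)) ∧
      Tendsto (fun i => ∫ t in τ (φ i)..T,
        repCost c (lams (φ i)) (Hs (φ i)) t (x (φ i) t) (a (φ i) t)) atTop (𝓝 y) ∧
      ∫ t in τ₀..T, repCost c lam H t (x₀ t) (a₀ t) ≤ y := by
  have hT0 : 0 ≤ T := hτ₀.1.trans hτ₀.2
  obtain ⟨r, hr⟩ := (Metric.isBounded_range_of_tendsto ξ hξ).exists_norm_le
  have hξr : ∀ i, ‖ξ i‖ ≤ r := fun i => hr _ (mem_range_self i)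
  set R := max (arcBound T c r) r + 1 with hRdef
  have hr0 : 0 ≤ r := (norm_nonneg _).trans (hξr 0)
  have hR : 0 < R := by linarith [le_max_right (arcBound T c r) r]
  have hrR : r ≤ R := by linarith [le_max_right (arcBound T c r) r]
  have hxR : ∀ i, ∀ t ∈ Icc (τ i) T, ‖x i t‖ ≤ R := fun i t ht => by
    linarith [(hs i).norm_trajectory_le (hτ i) (htr i) (hξr i) t ht,
      le_max_left (arcBound T c r) r]
  set V : ℕ → ℝ → EpiSpace n := fun i => arcVelocity T c (lams i) (Hs i) (τ i) (x i) (a i) with hV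
  set m : ℝ → ℝ := (Icc 0 T).indicator (fun t => 5 * radiusBound c k mu R t) with hmdef
  have hm : Integrable m := by
    have hbd : IntegrableOn (fun t => 5 * radiusBound c k mu R t) (Icc 0 T) :=
      (h.coeff.integrableOn_radiusBound hR).const_mul 5
    exact hbd.integrable_indicator measurableSet_Icc
  have hVm : ∀ i, ∀ᵐ t, ‖V i t‖ ≤ m t := fun i =>
    (hs i).norm_arcVelocity_le (hτ i) (htr i).control_mem hR (hxR i)
  have hVint : ∀ i, Integrable (V i) := fun i =>
    (hs i).integrable_arcVelocity (hτ i) (htr i).control_mem (htr i).control_measurable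
      (continuousOn_trajectory (hτ i).2 (htr i))
  -- With velocities extended by zero, arcs with different initial times are all defined on [0,T].
  set Z : ℕ → ℝ → EpiSpace n := fun i t =>
    WithLp.toLp 2 (ξ i, 0) + ∫ s in (0 : ℝ)..t, V i s with hZdef
  have hZprop := fun i => (hs i).exists_extended_arc (hτ i) (htr i) (Z := Z i) (fun t => rfl)
  have hZsub : ∀ i s t, Z i t - Z i s = ∫ q in s..t, V i q := by
    intro i s t
    simp only [hZdef, add_sub_add_left_eq_sub]
    exact intervalIntegral.integral_interval_sub_left (hVint i).intervalIntegrable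
      (hVint i).intervalIntegrable
  have hZb : ∀ i s t, s ≤ t → ‖Z i t - Z i s‖ ≤ ∫ q in s..t, m q := by
    intro i s t hst
    rw [hZsub]
    refine norm_integral_le_of_ae_norm_le hm hst ?_
    filter_upwards [hVm i] with q hq _ using hq
  have hZx : ∀ i, ∀ t ∈ Icc (τ i) T, (Z i t).fst = x i t := fun i => (hZprop i).2.1
  have hZR : ∀ i, ∀ t ∈ Icc 0 T, ‖(Z i t).fst‖ ≤ R := by
    intro i t ht
    rcases le_total t (τ i) with hle | hle
    · rw [(hZprop i).1 t ⟨ht.1, hle⟩]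
      exact (hξr i).trans hrR
    · rw [hZx i t ⟨hle, ht.2⟩]
      exact hxR i t ⟨hle, ht.2⟩
  obtain ⟨φ, hφ, z, hz⟩ := exists_subseq_tendsto_of_norm_sub_le (Z := Z) hm hT0 (C := r)
    (fun i => by
      rw [(hZprop i).1 0 ⟨le_rfl, (hτ i).1⟩]
      refine (norm_epiSpace_le _).trans ?_
      change ‖ξ i‖ + |(0 : ℝ)| ≤ r
      simpa using hξr i) (fun i s _ t _ hst => hZb i s t hst)
  have hφt := hφ.tendsto_atTop
  have hzb : ∀ s ∈ Icc 0 T, ∀ t ∈ Icc 0 T, s ≤ t → ‖z t - z s‖ ≤ ∫ q in s..t, m q :=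
    fun s hs' t ht hst => le_of_tendsto ((hz t ht).sub (hz s hs')).norm
      (Eventually.of_forall fun i => hZb (φ i) s t hst)
  have hzfst : ∀ t ∈ Icc 0 T, Tendsto (fun i => (Z (φ i) t).fst) atTop (𝓝 (z t).fst) :=
    fun t ht => (continuous_epiSpace_fst.tendsto _).comp (hz t ht)
  have hzR : ∀ t ∈ Icc 0 T, ‖(z t).fst‖ ≤ R := fun t ht =>
    le_of_tendsto (hzfst t ht).norm (Eventually.of_forall fun i => hZR (φ i) t ht)
  have hzτ : z τ₀ = WithLp.toLp 2 (ξ₀, 0) := by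
    have h1 : Tendsto (fun i => Z (φ i) (τ (φ i))) atTop (𝓝 (WithLp.toLp 2 (ξ₀, 0))) := by
      have h2 : ∀ i, Z (φ i) (τ (φ i)) = WithLp.toLp 2 (ξ (φ i), 0) := fun i =>
        (hZprop (φ i)).1 _ ⟨(hτ _).1, le_rfl⟩
      simp_rw [h2]
      exact ((WithLp.prod_continuous_toLp 2 (StateSpace n) ℝ).tendsto (ξ₀, 0)).comp
        ((hξ.comp hφt).prodMk_nhds tendsto_const_nhds)
    -- The initial time varies with i; equicontinuity makes the difference between τ_i and τ₀
    -- negligible.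
    have h3 : Tendsto (fun i => dist (Z (φ i) (τ (φ i))) (Z (φ i) τ₀)) atTop (𝓝 0) := by
      have hc : Tendsto (fun s => |∫ q in τ₀..s, m q|) (𝓝 τ₀) (𝓝 |∫ q in τ₀..τ₀, m q|) :=
        ((hm.continuous_primitive τ₀).abs).tendsto τ₀
      rw [intervalIntegral.integral_same, abs_zero] at hc
      refine squeeze_zero (fun _ => dist_nonneg) (fun i => ?_) (hc.comp (hτlim.comp hφt))
      simp only [Function.comp]
      rcases le_total τ₀ (τ (φ i)) with hle | hle
      · rw [dist_eq_norm]
        exact (hZb _ _ _ hle).trans (le_abs_self _)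
      · rw [dist_comm, dist_eq_norm, intervalIntegral.integral_symm, abs_neg]
        exact (hZb _ _ _ hle).trans (le_abs_self _)
    exact tendsto_nhds_unique (hz τ₀ hτ₀) (h1.congr_dist h3)
  have hSub : Icc τ₀ T ⊆ Icc 0 T := Icc_subset_Icc_left hτ₀.1
  have hzc : ContinuousOn z (Icc 0 T) := by
    have := (absolutelyContinuousOnInterval_of_norm_sub_le hm hT0 hzb).continuousOn
    rwa [uIcc_of_le hT0] at this
  have hZc : ∀ i, Continuous (Z i) := fun i =>
    continuous_const.add ((hVint i).continuous_primitive 0)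
  -- The limit arc satisfies the dual form of the differential inclusion.
  have hdual : ∀ q : StateSpace n, ∀ᵐ t, t ∈ Icc τ₀ T → DifferentiableAt ℝ z t →
      inner ℝ (deriv z t).fst q - (deriv z t).snd ≤ H t (z t).fst q := by
    intro q
    set B : ℝ → ℝ := (Icc 0 T).indicator
      (fun t => mu t + k R t * R + c t * (1 + R) * ‖q‖) with hB
    have hBint : Integrable B := by
      have hbd : IntegrableOn (fun t => mu t + k R t * R + c t * (1 + R) * ‖q‖) (Icc 0 T) :=
        (h.coeff.mu_int.add ((h.coeff.k_int R hR).mul_const R)).add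
          ((h.coeff.c_int.mul_const (1 + R)).mul_const ‖q‖)
      exact hbd.integrable_indicator measurableSet_Icc
    set g : ℝ → ℝ := (Icc 0 T).indicator (fun t => H t (z t).fst q) with hg
    -- Before τ_i the velocity is zero and H_i may be negative, so the bound is cut off there as
    -- well.
    set gs : ℕ → ℝ → ℝ := fun i => (Ioc (τ i) T).indicator (fun t => Hs i t (Z i t).fst q) with hgs
    have hIocs : ∀ i, Ioc (τ i) T ⊆ Icc 0 T := fun i =>
      Ioc_subset_Icc_self.trans (Icc_subset_Icc_left (hτ i).1)
    have hgm : AEStronglyMeasurable g := by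
      rw [hg, aestronglyMeasurable_indicator_iff measurableSet_Icc]
      exact (h.aemeasurable_ham measurableSet_Icc le_rfl
        ((continuous_epiSpace_fst.comp_continuousOn hzc).aestronglyMeasurable measurableSet_Icc)
        q).aestronglyMeasurable
    have hgint : Integrable g := by
      refine hBint.mono' hgm (ae_of_all _ fun t => ?_)
      by_cases ht : t ∈ Icc 0 T
      · rw [hg, hB, indicator_of_mem ht, indicator_of_mem ht]
        exact h.abs_ham_le ht hR (hzR t ht) q
      · rw [hg, hB, indicator_of_notMem ht, indicator_of_notMem ht, norm_zero]
    have hgsm : ∀ i, AEStronglyMeasurable (gs i) := by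
      intro i
      rw [hgs, aestronglyMeasurable_indicator_iff measurableSet_Ioc]
      exact ((hs i).aemeasurable_ham measurableSet_Ioc (hIocs i)
        (continuous_epiSpace_fst.comp (hZc i)).aestronglyMeasurable q).aestronglyMeasurable
    have hgsb : ∀ i t, ‖gs i t‖ ≤ B t := by
      intro i t
      by_cases ht : t ∈ Ioc (τ i) T
      · have ht0 := hIocs i ht
        simp only [hgs, hB, indicator_of_mem ht, indicator_of_mem ht0]
        exact (hs i).abs_ham_le ht0 hR (hZR i t ht0) q
      · simp only [hgs, hB, indicator_of_notMem ht, norm_zero]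
        refine indicator_nonneg (fun s hs' => ?_) t
        exact (abs_nonneg _).trans (h.abs_ham_le hs' hR (x := 0) (by simpa using hR.le) q)
    have hgsint : ∀ i, Integrable (gs i) := fun i =>
      hBint.mono' (hgsm i) (ae_of_all _ (hgsb i))
    have hVg : ∀ i t, inner ℝ (V i t).fst q - (V i t).snd ≤ gs i t := by
      intro i t
      by_cases ht : t ∈ Ioc (τ i) T
      · simp only [hgs, hV, arcVelocity, indicator_of_mem ht]
        rw [hZx i t (Ioc_subset_Icc_self ht)]
        have := (hs i).epiParam_mem (hIocs i ht) (x i t) (a i t) q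
        linarith
      · simp [hgs, hV, arcVelocity, indicator_of_notMem ht]
    have hineq : ∀ s ∈ Icc τ₀ T, ∀ t ∈ Icc τ₀ T, s ≤ t →
        (inner ℝ (z t).fst q - (z t).snd) - (inner ℝ (z s).fst q - (z s).snd) ≤
          ∫ r in s..t, g r := by
      intro s hs' t ht hst
      set L : EpiSpace n →L[ℝ] ℝ := (innerSL ℝ q).comp (epiFst n) - epiSnd n with hL
      have hLv : ∀ w : EpiSpace n, L w = inner ℝ w.fst q - w.snd := by
        intro w
        simp [hL, real_inner_comm]
      have hlim1 : Tendsto (fun i => L (Z (φ i) t) - L (Z (φ i) s)) atTop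
          (𝓝 (L (z t) - L (z s))) :=
        ((L.continuous.tendsto _).comp (hz t (hSub ht))).sub
          ((L.continuous.tendsto _).comp (hz s (hSub hs')))
      have hlim2 : Tendsto (fun i => ∫ r in s..t, gs (φ i) r) atTop (𝓝 (∫ r in s..t, g r)) := by
        refine intervalIntegral.tendsto_integral_filter_of_dominated_convergence B
          (Eventually.of_forall fun i => (hgsm (φ i)).restrict)
          (Eventually.of_forall fun i => ae_of_all _ fun r _ => hgsb (φ i) r)
          hBint.intervalIntegrable (ae_of_all _ fun r hrm => ?_)
        rw [uIoc_of_le hst] at hrm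
        have hr0 : r ∈ Icc 0 T := hSub ⟨hs'.1.trans hrm.1.le, hrm.2.trans ht.2⟩
        -- Since r > s ≥ τ₀, the cutoff eventually disappears at r.
        have hτr : ∀ᶠ i in atTop, τ (φ i) < r :=
          (hτlim.comp hφt).eventually_lt_const (lt_of_le_of_lt hs'.1 hrm.1)
        have hconv := ((h.tendsto_epiParam (lams := fun i => lams (φ i))
          (Hs := fun i => Hs (φ i)) (fun i => hs (φ i)) hr0
          (fun y p => (hH r hr0 y p).comp hφt) (fun y => (hlam r hr0 y).comp hφt) hR
          (fun i => hZR (φ i) r hr0) (hzR r hr0) (hzfst r hr0) 0).1 q)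
        rw [hg, indicator_of_mem hr0]
        refine hconv.congr' ?_
        filter_upwards [hτr] with i hi
        simp only [hgs]
        rw [indicator_of_mem (show r ∈ Ioc (τ (φ i)) T from ⟨hi, hr0.2⟩)]
      have hle : ∀ i, L (Z (φ i) t) - L (Z (φ i) s) ≤ ∫ r in s..t, gs (φ i) r := by
        intro i
        rw [← map_sub, hZsub, ← L.intervalIntegral_comp_comm (hVint _).intervalIntegrable]
        refine intervalIntegral.integral_mono_on hst (L.integrable_comp
          (hVint _)).intervalIntegrable (hgsint _).intervalIntegrable fun r _ => ?_
        rw [hLv]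
        exact hVg _ _
      have := le_of_tendsto_of_tendsto' hlim1 hlim2 hle
      rwa [hLv, hLv] at this
    filter_upwards [le_of_forall_sub_le_integral hgint hτ₀.2 hineq] with t ht htm hdiff
    have hder : HasDerivAt (fun t => inner ℝ (z t).fst q - (z t).snd)
        (inner ℝ (deriv z t).fst q - (deriv z t).snd) t := by
      have h1 : HasDerivAt (fun t => (z t).fst) (deriv z t).fst t :=
        (epiFst n).hasFDerivAt.comp_hasDerivAt t hdiff.hasDerivAt
      have h2 : HasDerivAt (fun t => (z t).snd) (deriv z t).snd t :=
        (epiSnd n).hasFDerivAt.comp_hasDerivAt t hdiff.hasDerivAt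
      have h3 := h1.inner ℝ (hasDerivAt_const t q)
      simp only [inner_zero_right, zero_add] at h3
      exact h3.sub h2
    have := ht htm _ hder
    rwa [hg, indicator_of_mem (hSub htm)] at this
  have hdiff := ae_differentiableAt_of_norm_sub_le hm hT0 hzb
  set d := TopologicalSpace.denseSeq (StateSpace n) with hd
  have hincl : ∀ᵐ t, t ∈ Icc τ₀ T →
      DifferentiableAt ℝ z t ∧ deriv z t ∈ conjEpi (H t (z t).fst) := by
    -- The exceptional null set depends on q, so q first runs over a countable dense set; continuity
    -- of H in q then covers all q.
    filter_upwards [hdiff, ae_all_iff.mpr fun j => hdual (d j)] with t h1 h2 htm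
    have hdt := h1 (hSub htm)
    refine ⟨hdt, fun q => ?_⟩
    have hHc := continuous_of_abs_sub_le (h.ham.lipschitz_gradient t (hSub htm) (z t).fst)
    have hclosed : IsClosed {q | inner ℝ (deriv z t).fst q - (deriv z t).snd ≤ H t (z t).fst q} :=
      isClosed_le (by fun_prop) hHc
    have hall : q ∈ {q | inner ℝ (deriv z t).fst q - (deriv z t).snd ≤ H t (z t).fst q} := by
      refine hclosed.closure_subset_iff.mpr ?_
        ((TopologicalSpace.denseRange_denseSeq (StateSpace n)) q)
      rintro _ ⟨j, rfl⟩
      exact h2 j htm hdt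
    have : inner ℝ (deriv z t).fst q - (deriv z t).snd ≤ H t (z t).fst q := hall
    linarith
  obtain ⟨a₀, ha₀, hcost⟩ := h.exists_trajectory_of_arc hτ₀ hm
    (fun s hs' t ht hst => hzb s (hSub hs') t (hSub ht) hst) hR
    (fun t ht => hzR t (hSub ht)) hincl
  have hTm : T ∈ Icc 0 T := ⟨hT0, le_rfl⟩
  refine ⟨φ, hφ, fun t => (z t).fst, a₀, (z T).snd, ?_, ?_, ?_, ?_⟩
  · rw [hzτ] at ha₀
    exact ha₀
  · refine (hzfst T hTm).congr fun i => ?_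
    exact hZx (φ i) T ⟨(hτ _).2, le_rfl⟩
  · refine ((continuous_epiSpace_snd.tendsto _).comp (hz T hTm)).congr fun i => ?_
    exact (hZprop (φ i)).2.2
  · rw [hzτ] at hcost
    simpa using hcost

end AdmissiblePair

/-! ### Recovery trajectories -/

section RadialRetraction

variable {X : Type*} [NormedAddCommGroup X] [NormedSpace ℝ X] {R : ℝ}

/-- The radial retraction onto the ball of radius `R`. -/
noncomputable def radialRetraction (R : ℝ) (y : X) : X := (R / max R ‖y‖) • y

theorem norm_radialRetraction (hR : 0 < R) (y : X) :
    ‖radialRetraction R y‖ = R * (‖y‖ / max R ‖y‖) := by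
  have : 0 < max R ‖y‖ := lt_max_of_lt_left hR
  rw [radialRetraction, norm_smul, Real.norm_of_nonneg (by positivity)]
  ring

theorem norm_radialRetraction_le (hR : 0 < R) (y : X) : ‖radialRetraction R y‖ ≤ R := by
  have : 0 < max R ‖y‖ := lt_max_of_lt_left hR
  rw [norm_radialRetraction hR]
  exact mul_le_of_le_one_right hR.le ((div_le_one this).mpr (le_max_right _ _))

theorem norm_radialRetraction_le_norm (hR : 0 < R) (y : X) : ‖radialRetraction R y‖ ≤ ‖y‖ := by
  have : 0 < max R ‖y‖ := lt_max_of_lt_left hR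
  rw [radialRetraction, norm_smul, Real.norm_of_nonneg (by positivity)]
  exact mul_le_of_le_one_left (norm_nonneg y) ((div_le_one this).mpr (le_max_left _ _))

theorem radialRetraction_of_norm_le (hR : 0 < R) {y : X} (hy : ‖y‖ ≤ R) :
    radialRetraction R y = y := by
  rw [radialRetraction, max_eq_left hy, div_self hR.ne', one_smul]

/-- The scaling factor and the vector are varied one at a time; each change costs at most ‖x - y‖.
-/
theorem norm_radialRetraction_sub_le (hR : 0 < R) (x y : X) :
    ‖radialRetraction R x - radialRetraction R y‖ ≤ 2 * ‖x - y‖ := by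
  set A := max R ‖x‖ with hA
  set B := max R ‖y‖ with hB
  have hA0 : 0 < A := lt_max_of_lt_left hR
  have hB0 : 0 < B := lt_max_of_lt_left hR
  have hsplit : radialRetraction R x - radialRetraction R y =
      (R / A) • (x - y) + (R / A - R / B) • y := by
    rw [radialRetraction, radialRetraction, smul_sub, sub_smul]
    abel
  have h1 : ‖(R / A) • (x - y)‖ ≤ ‖x - y‖ := by
    rw [norm_smul, Real.norm_of_nonneg (by positivity)]
    exact mul_le_of_le_one_left (norm_nonneg _) ((div_le_one hA0).mpr (le_max_left _ _))
  have h2 : ‖(R / A - R / B) • y‖ ≤ ‖x - y‖ := by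
    have hAB : |B - A| ≤ ‖x - y‖ := by
      have h3 : |B - A| ≤ |‖y‖ - ‖x‖| := by
        have := abs_max_sub_max_le_max R ‖y‖ R ‖x‖
        rwa [sub_self, abs_zero, max_eq_right (abs_nonneg (‖y‖ - ‖x‖))] at this
      rw [norm_sub_rev]
      exact h3.trans (abs_norm_sub_norm_le y x)
    have h4 : R / A - R / B = R / A * ((B - A) / B) := by
      field_simp
    rw [norm_smul, Real.norm_eq_abs, h4, abs_mul, abs_of_pos (div_pos hR hA0), abs_div,
      abs_of_pos hB0]
    calc R / A * (|B - A| / B) * ‖y‖ = R / A * (‖y‖ / B) * |B - A| := by ring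
      _ ≤ 1 * 1 * |B - A| := by
        refine mul_le_mul_of_nonneg_right (mul_le_mul ((div_le_one hA0).mpr (le_max_left _ _))
          ((div_le_one hB0).mpr (le_max_right _ _)) (by positivity) zero_le_one) (abs_nonneg _)
      _ ≤ ‖x - y‖ := by linarith
  rw [hsplit]
  linarith [norm_add_le ((R / A) • (x - y)) ((R / A - R / B) • y)]

theorem continuous_radialRetraction (hR : 0 < R) : Continuous (radialRetraction R : X → X) := by
  have : ∀ y : X, max R ‖y‖ ≠ 0 := fun y => (lt_max_of_lt_left hR).ne'
  unfold radialRetraction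
  exact (continuous_const.div (continuous_const.max continuous_norm) this).smul continuous_id

end RadialRetraction

/-! ### Backward solution of the state equation with a prescribed control -/

namespace AdmissiblePair

variable {n : ℕ} {T : ℝ} {c : ℝ → ℝ} {k : ℝ → ℝ → ℝ} {mu : ℝ → ℝ}
  {lam : ℝ → StateSpace n → ℝ} {H : ℝ → StateSpace n → StateSpace n → ℝ}

theorem norm_repDynamics_sub_le (h : AdmissiblePair T c k mu lam H) {t : ℝ} (ht : t ∈ Icc 0 T)
    {R : ℝ} (hR : 0 < R) {x y : StateSpace n} (hx : ‖x‖ ≤ R) (hy : ‖y‖ ≤ R) {a : EpiSpace n}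
    (ha : ‖a‖ ≤ 1) :
    ‖repDynamics c lam H t x a - repDynamics c lam H t y a‖ ≤
      Module.finrank ℝ (EpiSpace n) * 10 * (4 * k R t + c t) * ‖x - y‖ := by
  rw [repDynamics, repDynamics, ← WithLp.sub_fst]
  exact (norm_fst_le_norm _).trans (h.norm_epiParam_sub_le ht hR hx hy ha)

/-- The Lipschitz coefficient of the dynamics on the ball of radius `R`, extended by `0`. -/
noncomputable def dynamicsLip (n : ℕ) (T : ℝ) (c : ℝ → ℝ) (k : ℝ → ℝ → ℝ) (R : ℝ) : ℝ → ℝ :=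
  (Icc 0 T).indicator fun t => Module.finrank ℝ (EpiSpace n) * 10 * (4 * k R t + c t)

theorem _root_.Coefficients.integrable_dynamicsLip (h : Coefficients T c k mu) {R : ℝ}
    (hR : 0 < R) : Integrable (dynamicsLip n T c k R) := by
  have hbd : IntegrableOn (fun t => Module.finrank ℝ (EpiSpace n) * 10 * (4 * k R t + c t))
      (Icc 0 T) := (((h.k_int R hR).const_mul 4).add h.c_int).const_mul _
  exact hbd.integrable_indicator measurableSet_Icc

theorem _root_.Coefficients.dynamicsLip_nonneg (h : Coefficients T c k mu) {R : ℝ}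
    (hR : 0 < R) (s : ℝ) : 0 ≤ dynamicsLip n T c k R s := by
  refine indicator_nonneg (fun t ht => ?_) s
  have := h.k_nonneg R hR t ht
  have := h.c_nonneg t ht
  positivity

/-- Trajectories with a prescribed control and a prescribed endpoint exist. -/
theorem exists_trajectory_of_control (h : AdmissiblePair T c k mu lam H) {τ : ℝ}
    (hτ : τ ∈ Icc 0 T) {a : ℝ → EpiSpace n}
    (ham : AEStronglyMeasurable a (volume.restrict (Icc τ T)))
    (ha : ∀ᵐ t ∂(volume.restrict (Icc τ T)), a t ∈ Metric.closedBall (0 : EpiSpace n) 1)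
    (z : StateSpace n) :
    ∃ x : ℝ → StateSpace n,
      IsTrajectoryControl (Metric.closedBall (0 : EpiSpace n) 1) (repDynamics c lam H) T τ
        (x τ) x a ∧ x T = z := by
  classical
  have ha' := ha
  rw [ae_restrict_iff' measurableSet_Icc] at ha'
  set R := max (arcBound T c ‖z‖) 0 + 1 with hRdef
  have hR : 0 < R := by linarith [le_max_right (arcBound T c ‖z‖) 0]
  have hbR : arcBound T c ‖z‖ ≤ R := by linarith [le_max_left (arcBound T c ‖z‖) 0]
  have hsub : Ioc τ T ⊆ Icc 0 T := Ioc_subset_Icc_self.trans (Icc_subset_Icc_left hτ.1)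
  -- The dynamics are Lipschitz on balls only, so the state is retracted to a ball where the
  -- Lipschitz constant is integrable; times with an inadmissible control are set to zero to make
  -- the estimate hold everywhere.
  set F : ℝ → StateSpace n → StateSpace n := fun s y =>
    if s ∈ Ioc τ T ∧ ‖a s‖ ≤ 1 then repDynamics c lam H s (radialRetraction R y) (a s) else 0
    with hF
  have hFle : ∀ s ∈ Icc 0 T, ∀ y, ‖F s y‖ ≤ c s * (1 + ‖radialRetraction R y‖) := by
    intro s hs y
    by_cases hsa : s ∈ Ioc τ T ∧ ‖a s‖ ≤ 1
    · simp only [hF, if_pos hsa]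
      exact h.norm_repDynamics_le hs _ _
    · simp only [hF, if_neg hsa, norm_zero]
      exact h.gradient_coeff_nonneg hs _
  have hFout : ∀ s, s ∉ Icc 0 T → ∀ y, F s y = 0 := fun s hs y =>
    if_neg fun hsa => hs (hsub hsa.1)
  have hFae : ∀ X : ℝ → StateSpace n, ∀ᵐ s, F s (X s) =
      (Ioc τ T).indicator (fun s => repDynamics c lam H s (radialRetraction R (X s)) (a s)) s := by
    intro X
    filter_upwards [ha'] with s hs
    by_cases hsm : s ∈ Ioc τ T
    · rw [indicator_of_mem hsm]
      exact if_pos ⟨hsm, by simpa using hs (Ioc_subset_Icc_self hsm)⟩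
    · rw [indicator_of_notMem hsm]
      exact if_neg fun hsa => hsm hsa.1
  have hmeas : ∀ X : ℝ → StateSpace n, Continuous X → AEStronglyMeasurable fun s => F s (X s) := by
    intro X hX
    refine AEStronglyMeasurable.congr ?_ (EventuallyEq.symm (hFae X))
    rw [aestronglyMeasurable_indicator_iff measurableSet_Ioc]
    exact continuous_epiSpace_fst.comp_aestronglyMeasurable
      (h.aestronglyMeasurable_epiParam measurableSet_Ioc hsub
        ((continuous_radialRetraction hR).comp hX).aestronglyMeasurable
        (ham.mono_measure (Measure.restrict_mono Ioc_subset_Icc_self le_rfl)))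
  set m : ℝ → ℝ := (Icc 0 T).indicator (fun t => c t * (1 + R)) with hm
  have hmi : Integrable m := by
    have hbd : IntegrableOn (fun t => c t * (1 + R)) (Icc 0 T) := h.coeff.c_int.mul_const _
    exact hbd.integrable_indicator measurableSet_Icc
  have hFm : ∀ s y, ‖F s y‖ ≤ m s := by
    intro s y
    by_cases hs : s ∈ Icc 0 T
    · rw [hm, indicator_of_mem hs]
      refine (hFle s hs y).trans (mul_le_mul_of_nonneg_left ?_ (h.coeff.c_nonneg s hs))
      linarith [norm_radialRetraction_le hR y]
    · rw [hm, indicator_of_notMem hs, hFout s hs, norm_zero]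
  obtain ⟨X, hXc, hX⟩ := exists_eq_add_integral
    (K := fun s => 2 * dynamicsLip n T c k R s) (F := F) (m := m)
    ((h.coeff.integrable_dynamicsLip hR).const_mul 2)
    (fun s => mul_nonneg zero_le_two (h.coeff.dynamicsLip_nonneg hR s)) hmi hmeas
    (fun s x y => by
      by_cases hsa : s ∈ Ioc τ T ∧ ‖a s‖ ≤ 1
      · simp only [hF, if_pos hsa]
        have hs := hsub hsa.1
        have h0 := h.coeff.dynamicsLip_nonneg (n := n) hR s
        rw [dynamicsLip, indicator_of_mem hs] at h0 ⊢
        refine (h.norm_repDynamics_sub_le hs hR (norm_radialRetraction_le hR x)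
          (norm_radialRetraction_le hR y) hsa.2).trans ?_
        refine (mul_le_mul_of_nonneg_left (norm_radialRetraction_sub_le hR x y) h0).trans
          (le_of_eq (by ring))
      · simp only [hF, if_neg hsa, sub_self, norm_zero]
        have := h.coeff.dynamicsLip_nonneg (n := n) hR s
        positivity)
    (ae_of_all _ hFm) (a := τ) (b := T) (τ := T) (right_mem_Icc.mpr hτ.2) z
  set v : ℝ → StateSpace n := fun s => F s (X s) with hv
  have hvi : Integrable v := hmi.mono' (hmeas X hXc) (ae_of_all _ fun s => hFm s _)
  -- The retraction does not increase norms, so the a priori bound holds for the truncated equation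
  -- too and shows that the truncation is inactive along X.
  have hXb : ∀ t ∈ Icc τ T, ‖X t‖ ≤ R := fun t ht =>
    (h.coeff.norm_le_arcBound hτ.1 le_rfl (right_mem_Icc.mpr hτ.2) hXc.continuousOn hvi le_rfl hX
      (ae_of_all _ fun s hs => by
        have hs0 : s ∈ Icc 0 T := ⟨hτ.1.trans hs.1, hs.2⟩
        refine (hFle s hs0 _).trans (mul_le_mul_of_nonneg_left ?_ (h.coeff.c_nonneg s hs0))
        linarith [norm_radialRetraction_le_norm hR (X s)]) t ht).trans hbR
  -- X solves the equation on [τ,T] only; the integral formula on the whole line yields two-sided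
  -- derivatives almost everywhere.
  set x : ℝ → StateSpace n := fun t => z + ∫ s in T..t, v s with hx
  have hxX : ∀ t ∈ Icc τ T, x t = X t := fun t ht => (hX t ht).symm
  refine ⟨x, ⟨ham, ha, ?_, rfl, ?_⟩, by simp [hx]⟩
  · refine absolutelyContinuousOnInterval_of_norm_sub_le hvi.norm hτ.2 fun s _ t _ hst => ?_
    simp only [hx, add_sub_add_left_eq_sub]
    rw [intervalIntegral.integral_interval_sub_left hvi.intervalIntegrable hvi.intervalIntegrable]
    exact norm_integral_le_of_ae_norm_le hvi.norm hst (ae_of_all _ fun _ _ => le_rfl)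
  · rw [ae_restrict_iff' measurableSet_Icc]
    have hne : ∀ᵐ t : ℝ, t ≠ τ := by simp [ae_iff, measure_singleton]
    filter_upwards [LocallyIntegrable.ae_hasDerivAt_integral hvi.locallyIntegrable, hne, hFae X]
      with t ht1 ht2 ht3 htm
    have hd := (ht1 T).const_add z
    have htm' : t ∈ Ioc τ T := ⟨lt_of_le_of_ne htm.1 ht2.symm, htm.2⟩
    have hvt : v t = repDynamics c lam H t (x t) (a t) := by
      change F t (X t) = _
      rw [ht3, indicator_of_mem htm', radialRetraction_of_norm_le hR (hXb t htm), hxX t htm]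
    rw [← hvt]
    exact hd

end AdmissiblePair

namespace AdmissiblePair

variable {n : ℕ} {T : ℝ} {c : ℝ → ℝ} {k : ℝ → ℝ → ℝ} {mu : ℝ → ℝ}
  {lam : ℝ → StateSpace n → ℝ} {H : ℝ → StateSpace n → StateSpace n → ℝ}
  {τ : ℝ} {ξ : StateSpace n} {x : ℝ → StateSpace n} {a : ℝ → EpiSpace n}

theorem trajectory_eq_terminal (h : AdmissiblePair T c k mu lam H) (hτ : τ ∈ Icc 0 T)
    (htr : IsTrajectoryControl (Metric.closedBall (0 : EpiSpace n) 1) (repDynamics c lam H) T τ ξ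
      x a) :
    ∀ t ∈ Icc τ T, x t = x T + ∫ s in T..t, (arcVelocity T c lam H τ x a s).fst := by
  intro t ht
  have hint := (epiFst n).integrable_comp (h.integrable_arcVelocity hτ htr.control_mem
    htr.control_measurable (continuousOn_trajectory hτ.2 htr))
  rw [h.trajectory_eq hτ htr t ht, h.trajectory_eq hτ htr T (right_mem_Icc.mpr hτ.2), add_assoc]
  congr 1
  exact (intervalIntegral.integral_add_adjacent_intervals hint.intervalIntegrable
    hint.intervalIntegrable).symm

theorem norm_trajectory_le_of_terminal (h : AdmissiblePair T c k mu lam H) (hτ : τ ∈ Icc 0 T)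
    (htr : IsTrajectoryControl (Metric.closedBall (0 : EpiSpace n) 1) (repDynamics c lam H) T τ ξ
      x a) {r : ℝ} (hr : ‖x T‖ ≤ r) : ∀ t ∈ Icc τ T, ‖x t‖ ≤ arcBound T c r := by
  have hint := h.integrable_arcVelocity hτ htr.control_mem htr.control_measurable
    (continuousOn_trajectory hτ.2 htr)
  refine h.coeff.norm_le_arcBound hτ.1 le_rfl (right_mem_Icc.mpr hτ.2)
    (continuousOn_trajectory hτ.2 htr) ((epiFst n).integrable_comp hint) hr
    (h.trajectory_eq_terminal hτ htr) (ae_of_all _ fun t ht => ?_)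
  have ht0 : t ∈ Icc 0 T := ⟨hτ.1.trans ht.1, ht.2⟩
  simp only [epiFst_apply]
  by_cases htm : t ∈ Ioc τ T
  · rw [arcVelocity, indicator_of_mem htm]
    exact h.norm_repDynamics_le ht0 _ _
  · rw [arcVelocity, indicator_of_notMem htm]
    simpa using h.gradient_coeff_nonneg ht0 (x t)

/-- **Stability of trajectories** with a common control: if the endpoints converge, then so do the
trajectories and their costs. -/
theorem tendsto_trajectory {lams : ℕ → ℝ → StateSpace n → ℝ}
    {Hs : ℕ → ℝ → StateSpace n → StateSpace n → ℝ} (h : AdmissiblePair T c k mu lam H)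
    (hs : ∀ i, AdmissiblePair T c k mu (lams i) (Hs i))
    (hH : ∀ t ∈ Icc 0 T, ∀ x q, Tendsto (fun i => Hs i t x q) atTop (𝓝 (H t x q)))
    (hlam : ∀ t ∈ Icc 0 T, ∀ x, Tendsto (fun i => lams i t x) atTop (𝓝 (lam t x)))
    (hτ : τ ∈ Icc 0 T) {ξs : ℕ → StateSpace n} {xs : ℕ → ℝ → StateSpace n}
    (htr : IsTrajectoryControl (Metric.closedBall (0 : EpiSpace n) 1) (repDynamics c lam H) T τ ξ
      x a)
    (htrs : ∀ i, IsTrajectoryControl (Metric.closedBall (0 : EpiSpace n) 1)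
      (repDynamics c (lams i) (Hs i)) T τ (ξs i) (xs i) a)
    (hT : Tendsto (fun i => xs i T) atTop (𝓝 (x T))) :
    (∀ t ∈ Icc τ T, Tendsto (fun i => xs i t) atTop (𝓝 (x t))) ∧
      Tendsto (fun i => ∫ t in τ..T, repCost c (lams i) (Hs i) t (xs i t) (a t)) atTop
        (𝓝 (∫ t in τ..T, repCost c lam H t (x t) (a t))) := by
  obtain ⟨r, hr⟩ := (Metric.isBounded_range_of_tendsto _ hT).exists_norm_le
  have hr1 : ∀ i, ‖xs i T‖ ≤ r := fun i => hr _ (mem_range_self i)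
  have hr2 : ‖x T‖ ≤ r := le_of_tendsto hT.norm (Eventually.of_forall hr1)
  set R := max (arcBound T c r) 0 + 1 with hRdef
  have hR : 0 < R := by linarith [le_max_right (arcBound T c r) 0]
  have hbR : arcBound T c r ≤ R := by linarith [le_max_left (arcBound T c r) 0]
  have hxR : ∀ t ∈ Icc τ T, ‖x t‖ ≤ R := fun t ht =>
    (h.norm_trajectory_le_of_terminal hτ htr hr2 t ht).trans hbR
  have hxsR : ∀ i, ∀ t ∈ Icc τ T, ‖xs i t‖ ≤ R := fun i t ht =>
    ((hs i).norm_trajectory_le_of_terminal hτ (htrs i) (hr1 i) t ht).trans hbR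
  have hxc := continuousOn_trajectory hτ.2 htr
  have hxsc := fun i => continuousOn_trajectory hτ.2 (htrs i)
  have hsub : Icc τ T ⊆ Icc 0 T := Icc_subset_Icc_left hτ.1
  have ha := htr.control_mem
  have ham := htr.control_measurable
  set m : ℝ → ℝ := (Icc 0 T).indicator (fun t => 5 * radiusBound c k mu R t) with hmdef
  have hm : Integrable m := by
    have hbd : IntegrableOn (fun t => 5 * radiusBound c k mu R t) (Icc 0 T) :=
      (h.coeff.integrableOn_radiusBound hR).const_mul 5
    exact hbd.integrable_indicator measurableSet_Icc
  set V := arcVelocity T c lam H τ x a with hV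
  -- The intermediate velocity: perturbed data along the limit arc. Then W - V tends to 0 in L¹ by
  -- dominated convergence, and the state component of U - W is controlled by the Lipschitz
  -- estimate, so Grönwall's inequality applies.
  set W := fun i => arcVelocity T c (lams i) (Hs i) τ x a with hW
  set U := fun i => arcVelocity T c (lams i) (Hs i) τ (xs i) a with hU
  have hVi : Integrable V := h.integrable_arcVelocity hτ ha ham hxc
  have hWi : ∀ i, Integrable (W i) := fun i => (hs i).integrable_arcVelocity hτ ha ham hxc
  have hUi : ∀ i, Integrable (U i) := fun i => (hs i).integrable_arcVelocity hτ ha ham (hxsc i)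
  have hD : Tendsto (fun i => ∫ s, ‖W i s - V s‖) atTop (𝓝 0) := by
    have hlim := tendsto_integral_of_dominated_convergence (F := fun i s => ‖W i s - V s‖)
      (f := fun _ => 0) (μ := volume) (fun s => 2 * m s)
      (fun i => ((hWi i).sub hVi).norm.aestronglyMeasurable) (hm.const_mul 2)
      (fun i => by
        filter_upwards [(hs i).norm_arcVelocity_le hτ ha hR hxR, h.norm_arcVelocity_le hτ ha hR hxR]
          with s h1 h2
        rw [norm_norm]
        have := norm_sub_le (W i s) (V s)
        simp only [hmdef, hW, hV] at *
        linarith)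
      (ae_of_all _ fun s => by
        by_cases hsm : s ∈ Ioc τ T
        · have hsI := Ioc_subset_Icc_self hsm
          have := (h.tendsto_epiParam hs (hsub hsI) (hH s (hsub hsI)) (hlam s (hsub hsI)) hR
            (fun _ => hxR s hsI) (hxR s hsI) tendsto_const_nhds (a s)).2
          simp only [hW, hV, arcVelocity, indicator_of_mem hsm]
          exact tendsto_iff_norm_sub_tendsto_zero.mp this
        · simp [hW, hV, arcVelocity, indicator_of_notMem hsm])
    simpa using hlim
  set K := dynamicsLip n T c k R with hK
  have hKi : Integrable K := h.coeff.integrable_dynamicsLip hR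
  have hK0 : ∀ s, 0 ≤ K s := h.coeff.dynamicsLip_nonneg hR
  have hUW : ∀ i, ∀ᵐ s, s ∈ Icc τ T → ‖(U i s).fst - (W i s).fst‖ ≤ K s * ‖xs i s - x s‖ := by
    intro i
    rw [ae_restrict_iff' measurableSet_Icc] at ha
    filter_upwards [ha] with s hsa hsI
    by_cases hsm : s ∈ Ioc τ T
    · simp only [hU, hW, arcVelocity, indicator_of_mem hsm, hK, dynamicsLip,
        indicator_of_mem (hsub hsI)]
      exact (hs i).norm_repDynamics_sub_le (hsub hsI) hR (hxsR i s hsI) (hxR s hsI)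
        (by simpa using hsa hsI)
    · simp only [hU, hW, arcVelocity, indicator_of_notMem hsm, sub_self, norm_zero]
      exact mul_nonneg (hK0 s) (norm_nonneg _)
  have hfi : ∀ {v : ℝ → EpiSpace n}, Integrable v → Integrable fun s => (v s).fst :=
    fun hv => (epiFst n).integrable_comp hv
  have hbound : ∀ i, ∀ t ∈ Icc τ T, ‖xs i t - x t‖ ≤
      (‖xs i T - x T‖ + ∫ s, ‖W i s - V s‖) * Real.exp (∫ s in uIoc T t, K s) := by
    intro i
    have hD0 : 0 ≤ ∫ s, ‖W i s - V s‖ := integral_nonneg fun _ => norm_nonneg _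
    have hTm : T ∈ Icc τ T := right_mem_Icc.mpr hτ.2
    refine le_mul_exp_of_le_add_integral (φ := fun t => ‖xs i t - x t‖) hKi hK0
      (add_nonneg (norm_nonneg _) hD0) hTm ((hxsc i).sub hxc).norm fun t ht => ?_
    have hsubt := uIoc_subset_Icc hTm ht
    have hint : IntegrableOn (fun s => K s * ‖xs i s - x s‖) (uIoc T t) :=
      hKi.integrableOn.mul_continuousOn_of_subset ((hxsc i).sub hxc).norm measurableSet_uIoc
        isCompact_Icc hsubt
    have hWV : Integrable fun s => ‖W i s - V s‖ := ((hWi i).sub hVi).norm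
    have heq : xs i t - x t = (xs i T - x T) + ∫ s in T..t, ((U i s).fst - (V s).fst) := by
      rw [(hs i).trajectory_eq_terminal hτ (htrs i) t ht, h.trajectory_eq_terminal hτ htr t ht,
        intervalIntegral.integral_sub (hfi (hUi i)).intervalIntegrable
          (hfi hVi).intervalIntegrable]
      abel
    have h1 : ‖∫ s in T..t, ((U i s).fst - (V s).fst)‖ ≤
        ∫ s in uIoc T t, (‖W i s - V s‖ + K s * ‖xs i s - x s‖) := by
      refine intervalIntegral.norm_integral_le_integral_norm_uIoc.trans ?_
      refine setIntegral_mono_on_ae ((hfi (hUi i)).sub (hfi hVi)).norm.integrableOn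
        (hWV.integrableOn.add hint) measurableSet_uIoc ?_
      filter_upwards [hUW i] with s hs' hsm
      have h3 := hs' (hsubt hsm)
      have h4 : ‖(W i s).fst - (V s).fst‖ ≤ ‖W i s - V s‖ := by
        rw [← WithLp.sub_fst]
        exact norm_fst_le_norm _
      have h5 := norm_sub_le_norm_sub_add_norm_sub (U i s).fst (W i s).fst (V s).fst
      linarith
    rw [integral_add hWV.integrableOn hint] at h1
    have h2 := integral_uIoc_le_integral hWV (fun _ => norm_nonneg _) T t
    have h3 := norm_add_le (xs i T - x T) (∫ s in T..t, ((U i s).fst - (V s).fst))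
    rw [← heq] at h3
    linarith
  have hconv : ∀ t ∈ Icc τ T, Tendsto (fun i => xs i t) atTop (𝓝 (x t)) := by
    intro t ht
    rw [tendsto_iff_norm_sub_tendsto_zero] at hT ⊢
    refine squeeze_zero (fun _ => norm_nonneg _) (fun i => hbound i t ht) ?_
    simpa using (hT.add hD).mul_const (Real.exp (∫ s in uIoc T t, K s))
  refine ⟨hconv, ?_⟩
  have hcost : ∀ i, ∫ t in τ..T, repCost c (lams i) (Hs i) t (xs i t) (a t) =
      ∫ t in τ..T, (U i t).snd := fun i => integral_repCost_eq hτ.2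
  simp_rw [hcost]
  rw [integral_repCost_eq hτ.2]
  refine intervalIntegral.tendsto_integral_filter_of_dominated_convergence m
    (Eventually.of_forall fun i =>
      ((epiSnd n).integrable_comp (hUi i)).aestronglyMeasurable.restrict)
    (Eventually.of_forall fun i => ?_) hm.intervalIntegrable (ae_of_all _ fun s hsm => ?_)
  · filter_upwards [(hs i).norm_arcVelocity_le hτ ha hR (hxsR i)] with s h1 _
    exact (abs_snd_le_norm _).trans h1
  · rw [uIoc_of_le hτ.2] at hsm
    have hsI := Ioc_subset_Icc_self hsm
    simp only [hU, arcVelocity, indicator_of_mem hsm]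
    exact (continuous_epiSpace_snd.tendsto _).comp
      (h.tendsto_epiParam hs (hsub hsI) (hH s (hsub hsI)) (hlam s (hsub hsI)) hR
        (fun i => hxsR i s hsI) (hxR s hsI) (hconv s hsI) (a s)).2

end AdmissiblePair

/-! ### Epi-convergence of the value functions -/

/-- Epi-convergence is tested on full sequences; filling the gaps of a subsequence with its limit
makes it applicable to subsequences. -/
theorem tendsto_extend_of_strictMono {X : Type*} [TopologicalSpace X] {χ : ℕ → ℕ}
    (hχ : StrictMono χ) {f : ℕ → X} {l : X} (hf : Tendsto f atTop (𝓝 l)) :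
    Tendsto (Function.extend χ f fun _ => l) atTop (𝓝 l) := by
  intro s hs
  obtain ⟨J, hJ⟩ := eventually_atTop.mp (hf hs)
  refine mem_map.mpr (mem_atTop_sets.mpr ⟨χ J, fun i hi => ?_⟩)
  by_cases h : ∃ j, χ j = i
  · obtain ⟨j, rfl⟩ := h
    rw [mem_preimage, hχ.injective.extend_apply]
    exact hJ j (hχ.le_iff_le.mp hi)
  · rw [mem_preimage, Function.extend_apply' _ _ _ h]
    exact mem_of_mem_nhds hs

/-- The diagonal index at i is the largest m ≤ i whose threshold has been passed. -/
theorem exists_tendsto_atTop_eventually_diag {P : ℕ → ℕ → Prop} (h : ∀ m, ∀ᶠ i in atTop, P m i) :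
    ∃ N : ℕ → ℕ, Tendsto N atTop atTop ∧ ∀ᶠ i in atTop, P (N i) i := by
  simp_rw [eventually_atTop] at h
  choose J hJ using h
  refine ⟨fun i => Nat.findGreatest (fun m => J m ≤ i) i, ?_, ?_⟩
  · refine tendsto_atTop.mpr fun m => ?_
    filter_upwards [eventually_ge_atTop m, eventually_ge_atTop (J m)] with i h1 h2
    exact Nat.le_findGreatest h1 h2
  · filter_upwards [eventually_ge_atTop (J 0)] with i hi
    exact hJ _ _ (Nat.findGreatest_spec (P := fun m => J m ≤ i) (Nat.zero_le i) hi)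

/-- A sequence realizing the upper epi-limit exists as soon as there is one for each larger
bound. -/
theorem exists_seq_limsup_le {X : Type*} [PseudoMetricSpace X] {D : Set X} {φ : ℕ → X → EReal}
    {z : X} (hz : z ∈ D) {y : EReal}
    (h : ∀ ρ, y < ρ → ∃ u : ℕ → X, (∀ i, u i ∈ D) ∧ Tendsto u atTop (𝓝 z) ∧
      ∀ᶠ i in atTop, φ i (u i) < ρ) :
    ∃ u : ℕ → X, (∀ i, u i ∈ D) ∧ Tendsto u atTop (𝓝 z) ∧
      limsup (fun i => φ i (u i)) atTop ≤ y := by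
  rcases eq_or_ne y ⊤ with rfl | hy
  · exact ⟨fun _ => z, fun _ => hz, tendsto_const_nhds, le_top⟩
  obtain ⟨r, -, hr, hrlim⟩ := exists_seq_strictAnti_tendsto' (lt_top_iff_ne_top.mpr hy)
  choose u huD hu hφ using fun m => h (r m) (hr m).1
  have hP : ∀ m : ℕ, ∀ᶠ i in atTop,
      dist (u m i) z < 1 / ((m : ℝ) + 1) ∧ φ i (u m i) < r m := fun m =>
    ((Metric.tendsto_nhds.mp (hu m)) _ Nat.one_div_pos_of_nat).and (hφ m)
  obtain ⟨N, hN, hPN⟩ := exists_tendsto_atTop_eventually_diag hP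
  refine ⟨fun i => u (N i) i, fun i => huD _ _, ?_, ?_⟩
  · rw [tendsto_iff_dist_tendsto_zero]
    refine squeeze_zero' (Eventually.of_forall fun _ => dist_nonneg)
      (hPN.mono fun i hi => hi.1.le) ?_
    exact tendsto_one_div_add_atTop_nhds_zero_nat.comp hN
  · rw [← (hrlim.comp hN).limsup_eq]
    exact limsup_le_limsup (hPN.mono fun i hi => hi.2.le)

theorem epiConvergesOn_of_forall_lt {X : Type*} [PseudoMetricSpace X] {D : Set X}
    {φ : ℕ → X → EReal} {ψ : X → EReal}
    (hinf : ∀ z ∈ D, ∀ u : ℕ → X, (∀ i, u i ∈ D) → Tendsto u atTop (𝓝 z) →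
      ψ z ≤ liminf (fun i => φ i (u i)) atTop)
    (hsup : ∀ z ∈ D, ∀ ρ, ψ z < ρ → ∃ u : ℕ → X, (∀ i, u i ∈ D) ∧ Tendsto u atTop (𝓝 z) ∧
      ∀ᶠ i in atTop, φ i (u i) < ρ) : EpiConvergesOn D φ ψ :=
  fun z hz => ⟨hinf z hz, exists_seq_limsup_le hz (hsup z hz)⟩

section Value

variable {n : ℕ} {T : ℝ} {c : ℝ → ℝ} {lam : ℝ → StateSpace n → ℝ}
  {H : ℝ → StateSpace n → StateSpace n → ℝ} {g : StateSpace n → EReal} {τ : ℝ}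
  {ξ : StateSpace n}

theorem repValue_le {x : ℝ → StateSpace n} {a : ℝ → EpiSpace n}
    (htr : IsTrajectoryControl (Metric.closedBall (0 : EpiSpace n) 1) (repDynamics c lam H) T τ ξ
      x a) :
    repValue T c lam H g τ ξ ≤
      g (x T) + ((∫ t in τ..T, repCost c lam H t (x t) (a t) : ℝ) : EReal) :=
  iInf_le_of_le x (iInf_le_of_le a (iInf_le _ htr))

theorem exists_trajectory_of_repValue_lt {ρ : EReal} (h : repValue T c lam H g τ ξ < ρ) :
    ∃ (x : ℝ → StateSpace n) (a : ℝ → EpiSpace n),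
      IsTrajectoryControl (Metric.closedBall (0 : EpiSpace n) 1) (repDynamics c lam H) T τ ξ x a ∧
      g (x T) + ((∫ t in τ..T, repCost c lam H t (x t) (a t) : ℝ) : EReal) < ρ := by
  rw [repValue, valueFunction] at h
  simp only [iInf_lt_iff] at h
  obtain ⟨x, a, htr, hlt⟩ := h
  exact ⟨x, a, htr, hlt⟩

end Value

namespace AdmissiblePair

variable {n : ℕ} {T : ℝ} {c : ℝ → ℝ} {k : ℝ → ℝ → ℝ} {mu : ℝ → ℝ}
  {lam : ℝ → StateSpace n → ℝ} {H : ℝ → StateSpace n → StateSpace n → ℝ}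
  {lams : ℕ → ℝ → StateSpace n → ℝ} {Hs : ℕ → ℝ → StateSpace n → StateSpace n → ℝ}
  {g : StateSpace n → EReal} {gs : ℕ → StateSpace n → EReal} {τ₀ : ℝ} {ξ₀ : StateSpace n}

theorem repValue_le_liminf (h : AdmissiblePair T c k mu lam H)
    (hs : ∀ i, AdmissiblePair T c k mu (lams i) (Hs i))
    (hH : ∀ t ∈ Icc 0 T, ∀ x q, Tendsto (fun i => Hs i t x q) atTop (𝓝 (H t x q)))
    (hlam : ∀ t ∈ Icc 0 T, ∀ x, Tendsto (fun i => lams i t x) atTop (𝓝 (lam t x)))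
    (hg : EpiConvergesOn univ gs g) (hτ₀ : τ₀ ∈ Icc 0 T) {τ : ℕ → ℝ} {ξ : ℕ → StateSpace n}
    (hτ : ∀ i, τ i ∈ Icc 0 T) (hτlim : Tendsto τ atTop (𝓝 τ₀)) (hξ : Tendsto ξ atTop (𝓝 ξ₀)) :
    repValue T c lam H g τ₀ ξ₀ ≤
      liminf (fun i => repValue T c (lams i) (Hs i) (gs i) (τ i) (ξ i)) atTop := by
  by_contra! hlt
  obtain ⟨r, hr1, hr2⟩ := EReal.lt_iff_exists_real_btwn.mp hlt
  obtain ⟨φ, hφ, hφr⟩ := extraction_of_frequently_atTop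
    (frequently_lt_of_liminf_lt (by isBoundedDefault) hr1)
  choose x a htr hxr using fun j => exists_trajectory_of_repValue_lt (hφr j)
  have hφt := hφ.tendsto_atTop
  obtain ⟨ψ, hψ, x₀, a₀, y, htr₀, hxT, hcost, hy⟩ := h.exists_limit_trajectory
    (fun j => hs (φ j)) (fun t ht x q => (hH t ht x q).comp hφt)
    (fun t ht x => (hlam t ht x).comp hφt) (fun j => hτ (φ j)) hτ₀ (hτlim.comp hφt)
    (hξ.comp hφt) htr
  have hχ : StrictMono (φ ∘ ψ) := hφ.comp hψ
  -- Along the subsequence the terminal cost is below r minus a running cost that tends to y; the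
  -- lower epi-limit of the terminal costs transfers this to g.
  have hgle : g (x₀ T) ≤ ((r - y : ℝ) : EReal) := by
    have hlim := ((hg (x₀ T) (mem_univ _)).1 _ (fun _ => mem_univ _)
      (tendsto_extend_of_strictMono hχ hxT))
    refine le_of_forall_lt fun b hb => ?_
    by_contra! hrb
    obtain ⟨b', hb1, hb2⟩ := exists_between hb
    have hev := hχ.tendsto_atTop.eventually (eventually_lt_of_lt_liminf (hb2.trans_le hlim))
    have hlim2 : Tendsto (fun j => ((r - ∫ t in τ (φ (ψ j))..T, repCost c (lams (φ (ψ j)))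
        (Hs (φ (ψ j))) t (x (ψ j) t) (a (ψ j) t) : ℝ) : EReal)) atTop
        (𝓝 ((r - y : ℝ) : EReal)) :=
      (continuous_coe_real_ereal.tendsto _).comp (tendsto_const_nhds.sub hcost)
    have hb' : b' ≤ ((r - y : ℝ) : EReal) := by
      refine ge_of_tendsto hlim2 (hev.mono fun j hj => ?_)
      rw [hχ.injective.extend_apply] at hj
      refine hj.le.trans ?_
      rw [EReal.coe_sub]
      exact (EReal.le_sub_iff_add_le (.inl (EReal.coe_ne_bot _)) (.inl (EReal.coe_ne_top _))).mpr
        (hxr (ψ j)).le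
    exact absurd (hb1.trans_le (hb'.trans hrb)) (lt_irrefl _)
  have hle : repValue T c lam H g τ₀ ξ₀ ≤ (r : EReal) := by
    refine (repValue_le htr₀).trans ?_
    refine (add_le_add hgle (EReal.coe_le_coe_iff.mpr hy)).trans (le_of_eq ?_)
    rw [← EReal.coe_add, sub_add_cancel]
  exact absurd hr2 (not_lt.mpr hle)

theorem exists_seq_eventually_repValue_lt (h : AdmissiblePair T c k mu lam H)
    (hs : ∀ i, AdmissiblePair T c k mu (lams i) (Hs i))
    (hH : ∀ t ∈ Icc 0 T, ∀ x q, Tendsto (fun i => Hs i t x q) atTop (𝓝 (H t x q)))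
    (hlam : ∀ t ∈ Icc 0 T, ∀ x, Tendsto (fun i => lams i t x) atTop (𝓝 (lam t x)))
    (hgp : IsProperFn g) (hg : EpiConvergesOn univ gs g) (hτ₀ : τ₀ ∈ Icc 0 T) {ρ : EReal}
    (hρ : repValue T c lam H g τ₀ ξ₀ < ρ) :
    ∃ ξ : ℕ → StateSpace n, Tendsto ξ atTop (𝓝 ξ₀) ∧
      ∀ᶠ i in atTop, repValue T c (lams i) (Hs i) (gs i) τ₀ (ξ i) < ρ := by
  obtain ⟨x, a, htr, hlt⟩ := exists_trajectory_of_repValue_lt hρ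
  obtain ⟨z, -, hz, hzg⟩ := (hg (x T) (mem_univ _)).2
  -- The terminal cost is controlled only at the recovery points z_i and may be infinite nearby, so
  -- the endpoint must be hit exactly. The initial point is free to move instead.
  choose xs htrs hxsT using fun i => (hs i).exists_trajectory_of_control hτ₀
    htr.control_measurable htr.control_mem (z i)
  obtain ⟨hconv, hcost⟩ := h.tendsto_trajectory hs hH hlam hτ₀ htr htrs
    (by simpa only [hxsT] using hz)
  refine ⟨fun i => xs i τ₀, ?_, ?_⟩
  · simpa only [htr.initial] using hconv τ₀ (left_mem_Icc.mpr hτ₀.2)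
  set C := ∫ t in τ₀..T, repCost c lam H t (x t) (a t) with hC
  have htop : g (x T) ≠ ⊤ := by
    intro htop
    rw [htop, EReal.top_add_coe] at hlt
    exact not_top_lt hlt
  lift g (x T) to ℝ using ⟨htop, hgp.1 _⟩ with G hG
  obtain ⟨r, hr1, hr2⟩ := EReal.lt_iff_exists_real_btwn.mp hlt
  rw [← EReal.coe_add, EReal.coe_lt_coe_iff] at hr1
  -- The slack r - G - C is divided equally between terminal and running cost.
  have h1 : ∀ᶠ i in atTop, gs i (z i) < ((G + (r - G - C) / 2 : ℝ) : EReal) := by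
    refine eventually_lt_of_limsup_lt (lt_of_le_of_lt hzg ?_) (by isBoundedDefault)
    rw [EReal.coe_lt_coe_iff]
    linarith
  have h2 := hcost.eventually_lt_const (show C < C + (r - G - C) / 2 by linarith)
  filter_upwards [h1, h2] with i hi1 hi2
  refine lt_of_le_of_lt (repValue_le (htrs i)) (lt_of_lt_of_le ?_ hr2.le)
  rw [hxsT]
  refine (EReal.add_lt_add hi1 (EReal.coe_lt_coe_iff.mpr hi2)).trans_le (le_of_eq ?_)
  rw [← EReal.coe_add]
  congr 1
  ring

end AdmissiblePair

theorem corollary3p6 (n : ℕ) (hn : 1 ≤ n) (T : ℝ) (hT : 0 < T)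
    (H : ℝ → StateSpace n → StateSpace n → ℝ)
    (Hs : ℕ → ℝ → StateSpace n → StateSpace n → ℝ)
    (lam : ℝ → StateSpace n → ℝ) (lams : ℕ → ℝ → StateSpace n → ℝ)
    (g : StateSpace n → EReal) (gs : ℕ → StateSpace n → EReal)
    (c : ℝ → ℝ) (k : ℝ → ℝ → ℝ) (mu : ℝ → ℝ)
    (hc_nonneg : ∀ t ∈ Icc 0 T, 0 ≤ c t)
    (hc_int : IntegrableOn c (Icc 0 T))
    (hk_nonneg : ∀ R > 0, ∀ t ∈ Icc 0 T, 0 ≤ k R t)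
    (hk_int : ∀ R > 0, IntegrableOn (k R) (Icc 0 T))
    (hH : HamiltonianConditions T c H)
    (hHs : ∀ i, HamiltonianConditions T c (Hs i))
    (hHLC : HamiltonianLipschitz T k H)
    (hHLCs : ∀ i, HamiltonianLipschitz T k (Hs i))
    (hBLC : LagrangianBounded T k lam H)
    (hBLCs : ∀ i, LagrangianBounded T k (lams i) (Hs i))
    (hg_proper : IsProperFn g) (hg_lsc : LowerSemicontinuous g)
    (hgs_proper : ∀ i, IsProperFn (gs i)) (hgs_lsc : ∀ i, LowerSemicontinuous (gs i))
    (hg_epi : EpiConvergesOn univ gs g)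
    (hmu_int : IntegrableOn mu (Icc 0 T))
    (hmu_H : ∀ i, ∀ t ∈ Icc 0 T, |Hs i t 0 0| ≤ mu t)
    (hmu_lam : ∀ i, ∀ t ∈ Icc 0 T, |lams i t 0| ≤ mu t)
    (hH_conv : ∀ t ∈ Icc 0 T, ∀ K : Set (StateSpace n × StateSpace n), IsCompact K →
      TendstoUniformlyOn (fun i z => Hs i t z.1 z.2) (fun z => H t z.1 z.2) atTop K)
    (hlam_conv : ∀ t ∈ Icc 0 T, ∀ K : Set (StateSpace n), IsCompact K →
      TendstoUniformlyOn (fun i x => lams i t x) (fun x => lam t x) atTop K) :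
    EpiConvergesOn (Icc 0 T ×ˢ (univ : Set (StateSpace n)))
      (fun i z => repValue T c (lams i) (Hs i) (gs i) z.1 z.2)
      (fun z => repValue T c lam H g z.1 z.2) := by

  have hH' : ∀ t ∈ Icc 0 T, ∀ x q, Tendsto (fun i => Hs i t x q) atTop (𝓝 (H t x q)) :=
    fun t ht x q => (hH_conv t ht {(x, q)} isCompact_singleton).tendsto_at (mem_singleton _)
  have hlam' : ∀ t ∈ Icc 0 T, ∀ x, Tendsto (fun i => lams i t x) atTop (𝓝 (lam t x)) :=
    fun t ht x => (hlam_conv t ht {x} isCompact_singleton).tendsto_at (mem_singleton _)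
  have hcoeff : Coefficients T c k mu := ⟨hc_nonneg, hc_int, hk_nonneg, hk_int, hmu_int⟩
  have hs : ∀ i, AdmissiblePair T c k mu (lams i) (Hs i) := fun i =>
    ⟨hcoeff, hHs i, hHLCs i, hBLCs i, hmu_H i, hmu_lam i⟩
  -- The bounds by μ at the origin pass from the approximations to the limit.
  have h : AdmissiblePair T c k mu lam H :=
    ⟨hcoeff, hH, hHLC, hBLC,
      fun t ht => le_of_tendsto' (hH' t ht 0 0).abs fun i => hmu_H i t ht,
      fun t ht => le_of_tendsto' (hlam' t ht 0).abs fun i => hmu_lam i t ht⟩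
  refine epiConvergesOn_of_forall_lt (fun z hz u hu hlim => ?_) (fun z hz ρ hρ => ?_)
  · exact h.repValue_le_liminf hs hH' hlam' hg_epi hz.1 (fun i => (hu i).1)
      ((continuous_fst.tendsto _).comp hlim) ((continuous_snd.tendsto _).comp hlim)
  · obtain ⟨ξ, hξ, hlt⟩ :=
      h.exists_seq_eventually_repValue_lt hs hH' hlam' hg_proper hg_epi hz.1 hρ
    exact ⟨fun i => (z.1, ξ i), fun i => ⟨hz.1, mem_univ _⟩,
      tendsto_const_nhds.prodMk_nhds hξ, hlt⟩
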